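/- Let $\Bbbk$ be a field and let $\mathscr{A}$ be a $\Bbbk$-linear abelian category in which every object has finite length, equipped with a $\Bbbk$-linear automorphism $\langle 1\rangle$, with powers $\langle n\rangle$ ($n\in\mathbb{Z}$). Let $\mathscr{S}$ be the set of isomorphism classes of simple objects modulo the action of $\mathbb{Z}$ by $\langle n\rangle$, equipped with a partial order $\leq$. For each $s\in\mathscr{S}$ fix a representative simple object $L_s$, objects $\Delta_s$ and $\nabla_s$, and morphisms $\Delta_s\to L_s$ and $L_s\to\nabla_s$. For $\mathscr{T}\subset\mathscr{S}$ let $\mathscr{A}_{\mathscr{T}}$ be the Serre subcategory of $\mathscr{A}$ generated by the objects $L_t\langle n\rangle$ ($t\in\mathscr{T}$, $n\in\mathbb{Z}$), and write $\mathscr{A}_{\leq s}$, $\mathscr{A}_{<s}$ for $\mathscr{T}=\{t\mid t\leq s\}$, $\mathscr{T}=\{t\mid t<s\}$. Assume that $\mathscr{A}$ is graded highest weight, i.e. for all $s,t\in\mathscr{S}$ and $n\in\mathbb{Z}$: 1. the set $\{t\in\mathscr{S}\mid t\leq s\}$ is finite; 2. $\dim_{\Bbbk}\mathrm{Hom}(L_s,L_s)=1$,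 and $\mathrm{Hom}(L_s,L_s\langle n\rangle)=0$ if $n\neq 0$; 3. for every $\mathscr{T}\subset\mathscr{S}$ that is closed downwards and in which $s$ is a maximal element, $\Delta_s\to L_s$ is a projective cover in $\mathscr{A}_{\mathscr{T}}$ and $L_s\to\nabla_s$ is an injective envelope in $\mathscr{A}_{\mathscr{T}}$; 4. the kernel of $\Delta_s\to L_s$ and the cokernel of $L_s\to\nabla_s$ belong to $\mathscr{A}_{<s}$; 5. $\mathrm{Ext}^2(\Delta_s,\nabla_t\langle n\rangle)=0$. Let $\dag:\mathscr{S}\to\{0,1\}$ be a function. An object $M$ of $D^{\mathrm b}(\mathscr{A})$ is called even if, for all $s\in\mathscr{S}$ and $n,m\in\mathbb{Z}$, each of $\mathrm{Hom}(\Delta_s,M\langle n\rangle[m])\neq 0$ and $\mathrm{Hom}(M\langle n\rangle[m],\nabla_s)\neq 0$ implies $m=n$ and $n\equiv\dag(s)\pmod 2$. It is called a parity object if $M\cong M_0\oplus M_1$ with $M_0$ and $M_1\langle 1\rangle[1]$ even. Parity objects of $D^{\mathrm b}(\mathscr{A}_{\leq s})$ are defined in the same way, using the objects $\Delta_t,\nabla_t$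 and the values $\dag(t)$ for $t\leq s$. Let $\iota_{\leq s}:D^{\mathrm b}(\mathscr{A}_{\leq s})\to D^{\mathrm b}(\mathscr{A})$ and $\Pi_{<s}:D^{\mathrm b}(\mathscr{A}_{\leq s})\to D^{\mathrm b}(\mathscr{A}_{\leq s}/\mathscr{A}_{<s})$ be the functors induced by the inclusion and by the Serre quotient functor. Then for every $s\in\mathscr{S}$ there is, up to isomorphism, at most one indecomposable parity object $E_s$ in $D^{\mathrm b}(\mathscr{A}_{\leq s})$ such that $\Pi_{<s}(E_s)\cong\Pi_{<s}(\Delta_s)$. Moreover, the objects $\iota_{\leq s}(E_s)\langle n\rangle[n]$, for $s\in\mathscr{S}$ such that $E_s$ exists and $n\in\mathbb{Z}$, form a set of representatives of the isomorphism classes of indecomposable parity objects of $D^{\mathrm b}(\mathscr{A})$: each of them is an indecomposable parity object, every indecomposable parity object is isomorphic to one of them, and those attached to distinct pairs $(s,n)$ are not isomorphic. -/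

import Mathlib

open CategoryTheory CategoryTheory.Limits

universe w w' w₁ w₂ v v' u u' x y

namespace GradedHW

section General

/-- `f : P ⟶ X` is a projective cover: `P` is projective and `f` is an essential epimorphism. -/
structure IsProjectiveCover {C : Type u} [Category.{v} C] {P X : C} (f : P ⟶ X) : Prop where
  projective : Projective P
  epi : Epi f
  essential : ∀ ⦃Y : C⦄ (g : Y ⟶ P), Epi (g ≫ f) → Epi g

/-- `f : X ⟶ I` is an injective envelope: `I` is injective and `f` is an essential
monomorphism. -/
structure IsInjectiveEnvelope {C : Type u} [Category.{v} C] {X I : C} (f : X ⟶ I) : Prop where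
  injective : Injective I
  mono : Mono f
  essential : ∀ ⦃Y : C⦄ (g : I ⟶ Y), Mono (f ≫ g) → Mono g

variable {C : Type u} [Category.{v} C] [Abelian C]

/-- The Serre subcategory generated by a class of objects `G`, i.e. the smallest Serre
subcategory containing all objects of `G`. -/
def serreClosure (G : ObjectProperty C) : ObjectProperty C := fun X =>
  ∀ P : ObjectProperty C, P.IsSerreClass → G ≤ P → P X

lemma le_serreClosure (G : ObjectProperty C) : G ≤ serreClosure G :=
  fun X hX _ _ h => h X hX

lemma serreClosure_le {G P : ObjectProperty C} [hP : P.IsSerreClass] (h : G ≤ P) :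
    serreClosure G ≤ P := fun _ hX => hX P hP h

instance (G : ObjectProperty C) : (serreClosure G).IsSerreClass where
  exists_zero := ⟨_, isZero_zero C, fun P _ _ => P.prop_of_isZero (isZero_zero C)⟩
  prop_of_mono f _ hY := fun P hP h => P.prop_of_mono f (hY P hP h)
  prop_of_epi f _ hX := fun P hP h => P.prop_of_epi f (hX P hP h)
  prop_X₂_of_shortExact hS h₁ h₃ :=
    fun P hP h => P.prop_X₂_of_shortExact hS (h₁ P hP h) (h₃ P hP h)

/-- A Serre subcategory is an abelian category (through the instance of Mathlib for full
subcategories closed under kernels, cokernels and finite products). -/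
instance (P : ObjectProperty C) [P.IsSerreClass] : P.IsClosedUnderFiniteProducts := by
  have : P.IsClosedUnderLimitsOfShape (Discrete.{0} PEmpty) := .mk' (by
    rintro _ ⟨F⟩
    have e := HasLimit.isoOfNatIso (Functor.uniqueFromEmpty F)
    exact P.prop_of_isZero ((isZero_zero C).of_iso
      (e ≪≫ terminalIsTerminal.uniqueUpToIso (isZero_zero C).isTerminal)))
  have : P.IsClosedUnderBinaryProducts := .mk' (by
    rintro _ ⟨F, hF⟩
    refine P.prop_of_iso ?_
      (P.prop_biprod (hF ⟨WalkingPair.left⟩) (hF ⟨WalkingPair.right⟩))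
    exact biprod.isoProd _ _ ≪≫ HasLimit.isoOfNatIso (diagramIsoPair F).symm)
  exact .mk'

/-- The inclusion of a Serre subcategory is exact. -/
instance (P : ObjectProperty C) [P.IsSerreClass] : PreservesFiniteLimits P.ι :=
  ((Functor.preservesFiniteLimits_tfae P.ι).out 3 2).2 (P.preservesKernels_ι)

instance (P : ObjectProperty C) [P.IsSerreClass] : PreservesFiniteColimits P.ι :=
  ((Functor.preservesFiniteColimits_tfae P.ι).out 3 2).2 (P.preservesCokernels_ι)

/-- The Serre quotient `C / P`. -/
abbrev SerreQuotient (P : ObjectProperty C) [P.IsSerreClass] := P.isoModSerre.Localization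

/-- The quotient functor `C ⥤ C / P`. -/
abbrev serreQuotientFunctor (P : ObjectProperty C) [P.IsSerreClass] : C ⥤ SerreQuotient P :=
  P.isoModSerre.Q

noncomputable instance (P : ObjectProperty C) [P.IsSerreClass] : Abelian (SerreQuotient P) :=
  ObjectProperty.SerreClassLocalization.abelian (serreQuotientFunctor P) P

instance (P : ObjectProperty C) [P.IsSerreClass] :
    PreservesFiniteLimits (serreQuotientFunctor P) :=
  ObjectProperty.SerreClassLocalization.preservesFiniteLimits (serreQuotientFunctor P) P

instance (P : ObjectProperty C) [P.IsSerreClass] :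
    PreservesFiniteColimits (serreQuotientFunctor P) :=
  ObjectProperty.SerreClassLocalization.preservesFiniteColimits (serreQuotientFunctor P) P

end General

section Bounded

variable {C : Type u} [Category.{v} C] [Abelian C] [HasDerivedCategory.{w} C]
  {D : Type u'} [Category.{v'} D] [Abelian D] [HasDerivedCategory.{w'} D]

open DerivedCategory in
/-- An object of `C`, seen as an object of the bounded derived category concentrated in
degree `0`. -/
noncomputable def single (X : C) : DerivedCategory.Bounded C :=
  ⟨(singleFunctor C 0).obj X, ⟨0, inferInstance⟩, ⟨0, inferInstance⟩⟩

open DerivedCategory DerivedCategory.TStructure in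
lemma bounded_map (F : C ⥤ D) [F.Additive] [PreservesFiniteLimits F] [PreservesFiniteColimits F]
    (X : DerivedCategory C) (hX : (t : Triangulated.TStructure (DerivedCategory C)).bounded X) :
    (t : Triangulated.TStructure (DerivedCategory D)).bounded (F.mapDerivedCategory.obj X) := by
  obtain ⟨⟨a, ha⟩, ⟨b, hb⟩⟩ := hX
  obtain ⟨K, hK, hK', ⟨e⟩⟩ := X.exists_iso_Q_obj_of_isGE_of_isLE a b
  refine ObjectProperty.prop_of_iso _
    (F.mapDerivedCategory.mapIso e ≪≫ F.mapDerivedCategoryFactors.app K).symm ?_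
  let K' : CochainComplex D ℤ := (F.mapHomologicalComplex (ComplexShape.up ℤ)).obj K
  have : K'.IsStrictlyGE a :=
    inferInstanceAs (((F.mapHomologicalComplex (ComplexShape.up ℤ)).obj K).IsStrictlySupported _)
  have : K'.IsStrictlyLE b :=
    inferInstanceAs (((F.mapHomologicalComplex (ComplexShape.up ℤ)).obj K).IsStrictlySupported _)
  exact ⟨⟨a, (inferInstance : (Q.obj K').IsGE a)⟩, ⟨b, (inferInstance : (Q.obj K').IsLE b)⟩⟩

/-- The functor between bounded derived categories induced by an exact functor. -/
noncomputable def mapBounded (F : C ⥤ D) [F.Additive] [PreservesFiniteLimits F]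
    [PreservesFiniteColimits F] : DerivedCategory.Bounded C ⥤ DerivedCategory.Bounded D :=
  ObjectProperty.lift _ (DerivedCategory.Bounded.ι ⋙ F.mapDerivedCategory)
    (fun X => bounded_map F X.obj X.property)

end Bounded

section HighestWeight

/-! The grading automorphisms `⟨n⟩` of an abelian category `A` are encoded by `HasShift A ℤ`:
`⟨n⟩` is `shiftFunctor A n`.  This is unrelated to the cohomological shift `[n]`, which is the
shift of the derived category. -/

/-- Objects `L s`, `Δ s`, `∇ s` and morphisms `Δ s ⟶ L s`, `L s ⟶ ∇ s` indexed by a set of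
weights. -/
structure WeightData (A : Type u) [Category.{v} A] (S : Type x) where
  /-- the simple object `L s` -/
  L : S → A
  /-- the standard object `Δ s` -/
  std : S → A
  /-- the costandard object `∇ s` -/
  costd : S → A
  /-- the morphism `Δ s ⟶ L s` -/
  π : ∀ s, std s ⟶ L s
  /-- the morphism `L s ⟶ ∇ s` -/
  i : ∀ s, L s ⟶ costd s

namespace WeightData

variable {A : Type u} [Category.{v} A] [Abelian A] [HasShift A ℤ] {S : Type x}

/-- The Serre subcategory `A_T` generated by the objects `L t ⟨n⟩` with `t ∈ T` and `n ∈ ℤ`. -/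
def serre (D : WeightData A S) (T : Set S) : ObjectProperty A :=
  serreClosure (fun X => ∃ t ∈ T, ∃ n : ℤ, X = (shiftFunctor A n).obj (D.L t))

instance (D : WeightData A S) (T : Set S) : (D.serre T).IsSerreClass :=
  inferInstanceAs (serreClosure _).IsSerreClass

lemma serre_mono (D : WeightData A S) {T T' : Set S} (h : T ⊆ T') : D.serre T ≤ D.serre T' :=
  serreClosure_le (by
    rintro X ⟨t, ht, n, hX⟩
    exact le_serreClosure _ X ⟨t, h ht, n, hX⟩)

instance [∀ n : ℤ, (shiftFunctor A n).Additive] (D : WeightData A S) (T : Set S) :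
    (D.serre T).IsStableUnderShift ℤ where
  isStableUnderShiftBy n :=
    { le_shift := by
        change _ ≤ (D.serre T).inverseImage (shiftFunctor A n)
        refine serreClosure_le ?_
        rintro X ⟨t, ht, m, rfl⟩
        exact (D.serre T).prop_of_iso ((shiftFunctorAdd A m n).app (D.L t))
          (le_serreClosure _ _ ⟨t, ht, m + n, rfl⟩) }

/-- The graded category `A`, with weights indexed by the poset `S`, is a graded highest weight
category over `k`. -/
structure IsGradedHighestWeight (k : Type y) [Field k] [Linear k A] [PartialOrder S]
    (D : WeightData A S) : Prop where
  /-- every object of `A` has finite length -/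
  finite_length : ∀ X : A, IsNoetherianObject X ∧ IsArtinianObject X
  /-- `s ↦ L s` is a system of representatives of the simple objects, up to isomorphism and
  grading shift -/
  simple : ∀ s, Simple (D.L s)
  exists_iso : ∀ X : A, Simple X → ∃ (s : S) (n : ℤ), Nonempty (X ≅ (shiftFunctor A n).obj (D.L s))
  eq_of_iso : ∀ (s t : S) (n : ℤ), Nonempty (D.L s ≅ (shiftFunctor A n).obj (D.L t)) → s = t
  finite_Iic : ∀ s : S, (Set.Iic s).Finite
  finrank_end : ∀ s, Module.finrank k (D.L s ⟶ D.L s) = 1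
  hom_eq_zero : ∀ (s : S) (n : ℤ), n ≠ 0 → ∀ f : D.L s ⟶ (shiftFunctor A n).obj (D.L s), f = 0
  projective_cover : ∀ (T : Set S) (s : S), IsLowerSet T → Maximal (· ∈ T) s →
    ∃ (hL : D.serre T (D.L s)) (hΔ : D.serre T (D.std s)),
      IsProjectiveCover (C := (D.serre T).FullSubcategory) (P := ⟨D.std s, hΔ⟩) (X := ⟨D.L s, hL⟩)
        (ObjectProperty.homMk (D.π s))
  injective_envelope : ∀ (T : Set S) (s : S), IsLowerSet T → Maximal (· ∈ T) s →
    ∃ (hL : D.serre T (D.L s)) (hN : D.serre T (D.costd s)),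
      IsInjectiveEnvelope (C := (D.serre T).FullSubcategory) (X := ⟨D.L s, hL⟩)
        (I := ⟨D.costd s, hN⟩) (ObjectProperty.homMk (D.i s))
  kernel_mem : ∀ s, D.serre (Set.Iio s) (kernel (D.π s))
  cokernel_mem : ∀ s, D.serre (Set.Iio s) (cokernel (D.i s))
  ext_two : ∀ (s t : S) (n : ℤ),
    haveI := HasExt.standard A
    Subsingleton (Abelian.Ext.{max u v} (D.std s) ((shiftFunctor A n).obj (D.costd t)) 2)

section

variable [∀ n : ℤ, (shiftFunctor A n).Additive] [HasDerivedCategory.{w} A]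

/-- The autoequivalence `⟨n⟩` of the bounded derived category, induced by `⟨n⟩` on `A`. -/
noncomputable def _root_.GradedHW.grade (n : ℤ) :
    DerivedCategory.Bounded A ⥤ DerivedCategory.Bounded A :=
  mapBounded (shiftFunctor A n)

/-- `M⟨n⟩[m]`. -/
noncomputable def _root_.GradedHW.bishift (M : DerivedCategory.Bounded A) (n m : ℤ) :
    DerivedCategory.Bounded A :=
  (shiftFunctor (DerivedCategory.Bounded A) m).obj ((grade n).obj M)

variable (D : WeightData A S) (dag : S → ZMod 2)

/-- `(!,†)`-even objects: `Hom(Δ s, M⟨n⟩[m]) ≠ 0` implies `m = n` and `n ≡ †(s) mod 2`. -/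
def IsShriekEven (M : DerivedCategory.Bounded A) : Prop :=
  ∀ (s : S) (n m : ℤ), (∃ f : single (D.std s) ⟶ bishift M n m, f ≠ 0) →
    m = n ∧ (n : ZMod 2) = dag s

/-- `(*,†)`-even objects: `Hom(M⟨n⟩[m], ∇ s) ≠ 0` implies `m = n` and `n ≡ †(s) mod 2`. -/
def IsStarEven (M : DerivedCategory.Bounded A) : Prop :=
  ∀ (s : S) (n m : ℤ), (∃ f : bishift M n m ⟶ single (D.costd s), f ≠ 0) →
    m = n ∧ (n : ZMod 2) = dag s

/-- `†`-even objects. -/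
def IsEven (M : DerivedCategory.Bounded A) : Prop :=
  D.IsShriekEven dag M ∧ D.IsStarEven dag M

/-- Parity objects: `M ≅ M₀ ⊕ M₁` with `M₀` and `M₁⟨1⟩[1]` even. -/
def IsParity (M : DerivedCategory.Bounded A) : Prop :=
  ∃ M₀ M₁ : DerivedCategory.Bounded A, Nonempty (M ≅ M₀ ⊞ M₁) ∧
    D.IsEven dag M₀ ∧ D.IsEven dag (bishift M₁ 1 1)

end

/-! The subcategories `A_{≤ s}`, the quotients `A_{≤ s} / A_{< s}`, and the functors between their
derived categories. -/

section

variable [PartialOrder S] (D : WeightData A S)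

/-- The category `A_{≤ s}`. -/
abbrev SubcatLE (s : S) := (D.serre (Set.Iic s)).FullSubcategory

/-- The Serre subcategory `A_{< s}`, as a subcategory of `A_{≤ s}`. -/
abbrev ltInLE (s : S) : ObjectProperty (D.SubcatLE s) :=
  (D.serre (Set.Iio s)).inverseImage (D.serre (Set.Iic s)).ι

/-- The Serre quotient `A_{≤ s} / A_{< s}`. -/
abbrev QuotLE (s : S) := SerreQuotient (D.ltInLE s)

/-- The functor `ι_{≤ s} : Dᵇ(A_{≤ s}) ⥤ Dᵇ(A)`. -/
noncomputable def iotaLE (s : S) [HasDerivedCategory.{w} A]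
    [HasDerivedCategory.{w₁} (D.SubcatLE s)] :
    DerivedCategory.Bounded (D.SubcatLE s) ⥤ DerivedCategory.Bounded A :=
  mapBounded (D.serre (Set.Iic s)).ι

/-- The functor `Π_{< s} : Dᵇ(A_{≤ s}) ⥤ Dᵇ(A_{≤ s} / A_{< s})`. -/
noncomputable def piLT (s : S) [HasDerivedCategory.{w₁} (D.SubcatLE s)]
    [HasDerivedCategory.{w₂} (D.QuotLE s)] :
    DerivedCategory.Bounded (D.SubcatLE s) ⥤ DerivedCategory.Bounded (D.QuotLE s) :=
  mapBounded (serreQuotientFunctor (D.ltInLE s))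

variable {D} {k : Type y} [Field k] [Linear k A]

namespace IsGradedHighestWeight

lemma mem_serre (h : D.IsGradedHighestWeight k) (s t : S) (hts : t ≤ s) : D.serre (Set.Iic s) (D.L t) ∧
    D.serre (Set.Iic s) (D.std t) ∧ D.serre (Set.Iic s) (D.costd t) := by
  have hle : D.serre (Set.Iic t) ≤ D.serre (Set.Iic s) := D.serre_mono (Set.Iic_subset_Iic.2 hts)
  have hmax : Maximal (· ∈ Set.Iic t) t := ⟨le_refl t, fun _ hy _ => hy⟩
  obtain ⟨hL, hΔ, -⟩ := h.projective_cover (Set.Iic t) t (isLowerSet_Iic t) hmax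
  obtain ⟨-, hN, -⟩ := h.injective_envelope (Set.Iic t) t (isLowerSet_Iic t) hmax
  exact ⟨hle _ hL, hle _ hΔ, hle _ hN⟩

/-- The objects `L t`, `Δ t`, `∇ t` with `t ≤ s`, as objects of `A_{≤ s}`. -/
def restrictLE (h : D.IsGradedHighestWeight k) (s : S) : WeightData (D.SubcatLE s) (Set.Iic s) where
  L t := ⟨D.L t, (h.mem_serre s t t.2).1⟩
  std t := ⟨D.std t, (h.mem_serre s t t.2).2.1⟩
  costd t := ⟨D.costd t, (h.mem_serre s t t.2).2.2⟩
  π t := ObjectProperty.homMk (D.π t)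
  i t := ObjectProperty.homMk (D.i t)

/-- `E` is an indecomposable parity object of `Dᵇ(A_{≤ s})` with `Π_{< s}(E) ≅ Π_{< s}(Δ s)`. -/
def IsParityExtension (h : D.IsGradedHighestWeight k)
    [∀ n : ℤ, (shiftFunctor A n).Additive] (dag : S → ZMod 2) (s : S)
    [HasDerivedCategory.{w₁} (D.SubcatLE s)] [HasDerivedCategory.{w₂} (D.QuotLE s)]
    (E : DerivedCategory.Bounded (D.SubcatLE s)) : Prop :=
  Indecomposable E ∧ (h.restrictLE s).IsParity (fun t => dag t) E ∧
    Nonempty ((D.piLT s).obj E ≅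
      (D.piLT s).obj (single ((h.restrictLE s).std ⟨s, le_refl s⟩)))

end IsGradedHighestWeight

end

end WeightData

end HighestWeight

end GradedHW

/-!
The simple objects of the graded category are the `L s⟨n⟩`, so that it is a highest weight category
in an ungraded sense (`IsHW`) whose simple objects are indexed by `Λ = S × ℤ` and whose weights are
the first projections. Everything up to the classification of pure objects is done in this setting.

*Vanishing.* The first point is that `Extⁿ(Δ l, ∇ m) = 0` for all `n ≠ 0`, although only the cases
`n = 1, 2` follow from the axioms. By induction on weights, the vanishing of `Ext²` implies that
extensions of degrees `1` and `2` of objects filtered by standard objects are effaced by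
epimorphisms whose kernels are filtered by standard objects (`IsHW.eff_filt`). Thus every
epimorphism to a standard object is refined by one of this type (`IsHW.refines`), and since
arbitrary extensions are effaceable, the higher vanishing follows by induction on the degree
(`IsHW.ext_std_costd`). For a lower set `T` of weights, the epimorphisms constructed from objects of
the Serre subcategory `A_T` remain in `A_T`. Hence the same vanishing holds in `A_T`
(`Refines.restrict`), and the bounded derived category of `A_T` is equivalent to the full
subcategory of the objects supported on `T` (`IsHW.bijHom_ι`, `IsHW.exists_ι_iso`).

*Purity.* An object `M` is pure of degrees `e : Λ → ℤ` if `Hom(Δ l[m], M) ≠ 0` implies `m = e l`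
(`ShriekPure`) and `Hom(M, ∇ l[m]) ≠ 0` implies `m = e l` (`StarPure`). An even object is pure of
degrees `e (s, n) = n`, and so is an indecomposable parity object `M₀ ⊞ M₁`, being one of the two
summands up to isomorphism (`exists_isPureOfParity`). The key fact is that `Hom(M, N[1]) = 0` if `M`
is `*`-pure and `N` is `!`-pure of the same degrees (`IsHW.hom_shift_one`). Therefore, if `l` has
maximal weight in the support of `M`, every morphism from `Δ l[m]` to `N` extends along a nonzero
morphism `Δ l[m] ⟶ M` (`IsHW.exists_extend`).

*Classification.* The bounded derived category is `Hom`-finite and its idempotents split, so that an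
endomorphism of an indecomposable object which fixes a nonzero morphism is invertible, by Fitting's
lemma (`TrivialIdempotents.isIso_of_comp_eq`). Together with the extension of morphisms, this shows
that an indecomposable pure object `M` has a single maximal weight, with a morphism `a` from a
single standard object `Δ s⟨n⟩[n]` through which all the morphisms from standard objects of this
weight factor (`IsHW.exists_leading`), and that `M` is determined by `(s, n)`
(`IsHW.nonempty_iso_of_pure`). The cone of `a` is supported on the weights `< s` (`IsHW.supp_cone`),
hence is killed by the quotient functor. After a shift by `⟨-n⟩[-n]`, the object `M` thus comes from
an object of the derived category of `A_{≤ s}` with the same image as `Δ s` in the quotient.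

Conversely, the objects `Δ s⟨n⟩` are projective in `A_{≤ s}`, and morphisms from their shifts do not
change in the quotient (`IsHW.bijHom_quotient`). So an indecomposable parity object of the derived
category of `A_{≤ s}` with the same image as `Δ s` is the one attached to `(s, 0)`, and the pair
`(s, n)` can be recovered from the morphisms from standard objects.
-/

namespace GradedHW

/-! ### Extension closures in abelian categories -/

section ExtClosure

variable {C : Type u} [Category.{v} C] [Abelian C]

/-- The closure of a class of objects under extensions (and zero objects). -/
inductive ExtClosure (G : ObjectProperty C) : C → Prop
  | of {X : C} (h : G X) : ExtClosure G X
  | zero {X : C} (h : IsZero X) : ExtClosure G X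
  | ext {S : ShortComplex C} (hS : S.ShortExact) (h₁ : ExtClosure G S.X₁)
      (h₃ : ExtClosure G S.X₃) : ExtClosure G S.X₂

lemma ExtClosure.of_iso {G : ObjectProperty C} {X Y : C} (e : X ≅ Y) (h : ExtClosure G X) :
    ExtClosure G Y := by
  have hz : IsZero (⊥_ C) :=
    (isZero_zero C).of_iso (initialIsInitial.uniqueUpToIso (isZero_zero C).isInitial)
  have hS : (ShortComplex.mk e.hom (0 : Y ⟶ (⊥_ C)) comp_zero).ShortExact :=
    { exact := by
        rw [ShortComplex.exact_iff_epi _ rfl]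
        dsimp; infer_instance
      mono_f := by dsimp; infer_instance
      epi_g := ⟨fun _ _ _ => hz.eq_of_src _ _⟩ }
  exact .ext hS h (.zero hz)

lemma ExtClosure.mono {G G' : ObjectProperty C} (hG : ∀ X, G X → ExtClosure G' X) {X : C}
    (h : ExtClosure G X) : ExtClosure G' X := by
  induction h with
  | of h => exact hG _ h
  | zero h => exact .zero h
  | ext hS _ _ h₁ h₃ => exact .ext hS h₁ h₃

lemma shortExact_kernel_image {X Y : C} (f : X ⟶ Y) :
    (ShortComplex.mk (kernel.ι f) (factorThruImage f) (by
      rw [← cancel_mono (image.ι f)]; simp)).ShortExact where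
  exact := by
    refine ShortComplex.exact_of_f_is_kernel _ ?_
    refine KernelFork.IsLimit.ofι _ _ (fun {W} g hg => kernel.lift f g ?_) ?_ ?_
    · rw [← image.fac f, ← Category.assoc]
      dsimp at hg
      rw [hg, zero_comp]
    · intro W g hg; simp
    · intro W g hg m hm
      rw [← cancel_mono (kernel.ι f)]; simpa using hm

lemma shortExact_image_cokernel {X Y : C} (f : X ⟶ Y) :
    (ShortComplex.mk (image.ι f) (cokernel.π f) (by
      rw [← cancel_epi (factorThruImage f)]; simp)).ShortExact where
  exact := by
    refine ShortComplex.exact_of_g_is_cokernel _ ?_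
    refine CokernelCofork.IsColimit.ofπ _ _ (fun {W} g hg => cokernel.desc f g ?_) ?_ ?_
    · rw [← image.fac f, Category.assoc]
      dsimp at hg
      rw [hg, comp_zero]
    · intro W g hg; simp
    · intro W g hg m hm
      rw [← cancel_epi (cokernel.π f)]; simpa using hm

lemma shortExact_kernel {X Y : C} (p : X ⟶ Y) [Epi p] :
    (ShortComplex.mk (kernel.ι p) p (kernel.condition p)).ShortExact where
  exact := ShortComplex.exact_kernel p

lemma shortExact_cokernel {X Y : C} (i : X ⟶ Y) [Mono i] :
    (ShortComplex.mk i (cokernel.π i) (cokernel.condition i)).ShortExact where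
  exact := ShortComplex.exact_cokernel i

/-- Subobjects of iterated extensions of simple objects are again such extensions: intersect the
subobject with the extension. -/
lemma ExtClosure.prop_of_mono {G : ObjectProperty C} (hG : ∀ X, G X → Simple X) {X : C}
    (h : ExtClosure G X) : ∀ {Y : C} (f : Y ⟶ X) [Mono f], ExtClosure G Y := by
  induction h with
  | @of X h =>
    intro Y f _
    have := hG _ h
    by_cases hf : f = 0
    · subst hf
      exact .zero (IsZero.of_mono_zero Y X)
    · have := isIso_of_mono_of_nonzero hf
      exact .of_iso (asIso f).symm (.of h)
  | zero h =>
    intro Y f _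
    exact .zero (IsZero.of_mono f h)
  | @ext S hS _ _ h₁ h₃ =>
    intro Y f _
    have := hS.mono_f
    let φ := f ≫ S.g
    have w : (kernel.ι φ ≫ f) ≫ S.g = 0 := (Category.assoc _ _ _).trans (kernel.condition φ)
    have : Mono (hS.exact.lift _ w) := by
      have : Mono (hS.exact.lift _ w ≫ S.f) := by
        rw [hS.exact.lift_f]; infer_instance
      exact mono_of_mono _ S.f
    exact .ext (shortExact_kernel_image φ) (h₁ (hS.exact.lift _ w)) (h₃ (image.ι φ))

lemma ExtClosure.prop_of_epi {G : ObjectProperty C} (hG : ∀ X, G X → Simple X) {X : C}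
    (h : ExtClosure G X) : ∀ {Y : C} (f : X ⟶ Y) [Epi f], ExtClosure G Y := by
  induction h with
  | @of X h =>
    intro Y f _
    have := hG _ h
    by_cases hf : f = 0
    · subst hf
      exact .zero (IsZero.of_epi_zero X Y)
    · have := isIso_of_epi_of_nonzero hf
      exact .of_iso (asIso f) (.of h)
  | zero h =>
    intro Y f _
    exact .zero (IsZero.of_epi f h)
  | @ext S hS _ _ h₁ h₃ =>
    intro Y f _
    have := hS.epi_g
    let φ := S.f ≫ f
    have w : S.f ≫ f ≫ cokernel.π φ = 0 :=
      (Category.assoc _ _ _).symm.trans (cokernel.condition φ)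
    have : Epi (hS.exact.desc _ w) := by
      have : Epi (S.g ≫ hS.exact.desc _ w) := by
        rw [hS.exact.g_desc]; infer_instance
      exact epi_of_epi S.g _
    exact .ext (shortExact_image_cokernel φ) (h₁ (factorThruImage φ)) (h₃ (hS.exact.desc _ w))

lemma isSerreClass_extClosure {G : ObjectProperty C} (hG : ∀ X, G X → Simple X) :
    ObjectProperty.IsSerreClass (ExtClosure G : ObjectProperty C) where
  exists_zero := ⟨_, isZero_zero C, .zero (isZero_zero C)⟩
  prop_of_mono f _ hY := ExtClosure.prop_of_mono hG hY f
  prop_of_epi f _ hX := ExtClosure.prop_of_epi hG hX f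
  prop_X₂_of_shortExact hS h₁ h₃ := .ext hS h₁ h₃

/-- The Serre subcategory generated by a class of simple objects consists of the iterated
extensions of these objects. -/
lemma serreClosure_eq_extClosure {G : ObjectProperty C} (hG : ∀ X, G X → Simple X) :
    serreClosure G = (ExtClosure G : ObjectProperty C) := by
  have := isSerreClass_extClosure hG
  refine le_antisymm (serreClosure_le fun X hX => .of hX) ?_
  intro X hX
  induction hX with
  | of h => exact le_serreClosure G _ h
  | zero h => exact (serreClosure G).prop_of_isZero h
  | ext hS _ _ h₁ h₃ => exact (serreClosure G).prop_X₂_of_shortExact hS h₁ h₃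

/-- Every object of finite length is an iterated extension of simple objects. -/
lemma extClosure_simple_of_finite_length (X : C) [IsNoetherianObject X] [IsArtinianObject X] :
    ExtClosure (fun Y : C => Simple Y) X := by
  -- a maximal subobject `Y` of `X` which is an iterated extension of simple objects
  obtain ⟨Y, hY, hmax⟩ := WellFounded.has_min (wellFounded_gt (α := Subobject X))
    {Y | ExtClosure (fun Y : C => Simple Y) (Y : C)}
    ⟨⊥, .zero ((isZero_zero C).of_iso Subobject.botCoeIsoZero)⟩
  by_cases hYt : Y = ⊤
  · subst hYt
    exact .of_iso (asIso (⊤ : Subobject X).arrow) hY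
  exfalso
  -- a minimal subobject `Z` among those strictly containing `Y`
  obtain ⟨Z, hZ, hmin⟩ := WellFounded.has_min (wellFounded_lt (α := Subobject X))
    {Z | Y < Z} ⟨⊤, lt_of_le_of_ne le_top hYt⟩
  have hYZ : Y < Z := hZ
  let i := Y.ofLE Z hYZ.le
  suffices hsimple : Simple (cokernel i) from
    hmax Z (.ext (shortExact_cokernel i) hY (.of hsimple)) hYZ
  have hne : ¬ IsZero (cokernel i) := fun h0 => by
    have : Epi i := Preadditive.epi_of_cokernel_zero (h0.eq_of_tgt _ _)
    have : IsIso i := isIso_of_mono_of_epi i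
    exact hYZ.not_ge (Subobject.le_of_comm (inv i) (by
      rw [IsIso.inv_comp_eq, Subobject.ofLE_arrow]))
  refine ⟨fun {W} f _ => ⟨fun hf h0 => ?_, fun hf => ?_⟩⟩
  · subst h0
    exact hne (IsZero.of_epi_zero W _)
  · -- the inverse image of a subobject of `Z / Y` lies between `Y` and `Z`
    let P := Subobject.mk (pullback.snd f (cokernel.π i) ≫ Z.arrow)
    have hPZ : P ≤ Z := Subobject.mk_le_of_comm (pullback.snd f (cokernel.π i)) rfl
    have hYP : Y ≤ P := Subobject.le_mk_of_comm
      (pullback.lift 0 i (by simp)) (by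
        rw [pullback.lift_snd_assoc, Subobject.ofLE_arrow])
    rcases hYP.lt_or_eq with h | h
    · have hPZ' : P = Z := hPZ.eq_of_not_lt (hmin P h)
      have : Epi (pullback.snd f (cokernel.π i)) := by
        have hle : Z ≤ Subobject.mk (pullback.snd f (cokernel.π i) ≫ Z.arrow) := hPZ'.ge
        have hc : Subobject.ofLEMk Z _ hle ≫ pullback.snd f (cokernel.π i) = 𝟙 _ := by
          rw [← cancel_mono Z.arrow, Category.assoc, Subobject.ofLEMk_comp, Category.id_comp]
        exact (SplitEpi.mk _ hc).epi
      have : Epi (pullback.fst f (cokernel.π i) ≫ f) := by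
        rw [pullback.condition]; infer_instance
      have : Epi f := epi_of_epi (pullback.fst f (cokernel.π i)) f
      exact isIso_of_mono_of_epi f
    · refine (hf ?_).elim
      have hle : Subobject.mk (pullback.snd f (cokernel.π i) ≫ Z.arrow) ≤ Y := h.ge
      have hc : pullback.snd f (cokernel.π i) = Subobject.ofMkLE _ Y hle ≫ i := by
        rw [← cancel_mono Z.arrow, Category.assoc, Subobject.ofLE_arrow, Subobject.ofMkLE_arrow]
      rw [← cancel_epi (pullback.fst f (cokernel.π i)), pullback.condition, hc, Category.assoc,
        cokernel.condition, comp_zero, comp_zero]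

end ExtClosure

/-! ### Vanishing of morphisms -/

section HomZero

variable {C : Type u} [Category.{v} C] [Preadditive C]

/-- There are no nonzero morphisms from `X` to `Y`. -/
def HomZero (X Y : C) : Prop := ∀ f : X ⟶ Y, f = 0

namespace HomZero

lemma congr_left {X X' Y : C} (e : X ≅ X') (h : HomZero X Y) : HomZero X' Y := fun f => by
  rw [← cancel_epi e.hom, h (e.hom ≫ f), comp_zero]

lemma congr_right {X Y Y' : C} (e : Y ≅ Y') (h : HomZero X Y) : HomZero X Y' := fun f => by
  rw [← cancel_mono e.inv, h (f ≫ e.inv), zero_comp]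

lemma of_isZero_left {X Y : C} (h : IsZero X) : HomZero X Y := fun _ => h.eq_of_src _ _

lemma of_isZero_right {X Y : C} (h : IsZero Y) : HomZero X Y := fun _ => h.eq_of_tgt _ _

end HomZero

lemma homZero_map_iff {D : Type u'} [Category.{v'} D] [Preadditive D] (F : C ⥤ D) [F.Additive]
    [F.Full] [F.Faithful] {X Y : C} : HomZero (F.obj X) (F.obj Y) ↔ HomZero X Y :=
  ⟨fun h f => F.map_injective (by rw [h (F.map f), F.map_zero]), fun h f => by
    obtain ⟨g, rfl⟩ := F.map_surjective f
    rw [h g, F.map_zero]⟩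

variable [HasShift C ℤ]

lemma homZero_shift_zero_iff {X Y : C} : HomZero X (Y⟦(0 : ℤ)⟧) ↔ HomZero X Y :=
  ⟨fun H => H.congr_right ((shiftFunctorZero C ℤ).app Y),
    fun H => H.congr_right ((shiftFunctorZero C ℤ).app Y).symm⟩

variable [∀ n : ℤ, (shiftFunctor C n).Additive]

/-- `Hom(X⟦a⟧, Y⟦b⟧) = 0` if and only if `Hom(X, Y⟦b - a⟧) = 0`. -/
lemma homZero_shift_iff {X Y : C} {a b : ℤ} (c : ℤ) (h : c + a = b) :
    HomZero (X⟦a⟧) (Y⟦b⟧) ↔ HomZero X (Y⟦c⟧) :=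
  ⟨fun H => (homZero_map_iff (shiftFunctor C a)).1
    (H.congr_right ((shiftFunctorAdd' C c a b h).app Y)), fun H =>
    ((homZero_map_iff (shiftFunctor C a)).2 H).congr_right
      ((shiftFunctorAdd' C c a b h).app Y).symm⟩

lemma homZero_shift_left_iff {X Y : C} {a : ℤ} (c : ℤ) (h : c + a = 0) :
    HomZero (X⟦a⟧) Y ↔ HomZero X (Y⟦c⟧) :=
  ⟨fun H => (homZero_shift_iff c h).1 (H.congr_right ((shiftFunctorZero C ℤ).app Y).symm),
    fun H => ((homZero_shift_iff c h).2 H).congr_right ((shiftFunctorZero C ℤ).app Y)⟩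

end HomZero

/-! ### Distinguished triangles with explicit vertices and edges -/

section Triangles

open Pretriangulated

variable {C : Type u} [Category.{v} C] [Preadditive C] [HasZeroObject C] [HasShift C ℤ]
  [∀ n : ℤ, (shiftFunctor C n).Additive] [Pretriangulated C]

/-- The triangle `X ⟶ Y ⟶ Z ⟶ X⟦1⟧` is distinguished. -/
def Dist {X Y Z : C} (f : X ⟶ Y) (g : Y ⟶ Z) (h : Z ⟶ X⟦(1 : ℤ)⟧) : Prop :=
  Triangle.mk f g h ∈ distTriang C

namespace Dist

lemma exists_cone {X Y : C} (f : X ⟶ Y) :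
    ∃ (Z : C) (g : Y ⟶ Z) (h : Z ⟶ X⟦(1 : ℤ)⟧), Dist f g h :=
  distinguished_cocone_triangle f

lemma exists_middle {X Z : C} (h : Z ⟶ X⟦(1 : ℤ)⟧) :
    ∃ (Y : C) (f : X ⟶ Y) (g : Y ⟶ Z), Dist f g h :=
  distinguished_cocone_triangle₂ h

variable {X Y Z : C} {f : X ⟶ Y} {g : Y ⟶ Z} {h : Z ⟶ X⟦(1 : ℤ)⟧} (T : Dist f g h)

include T

lemma rot : Dist g h (-f⟦(1 : ℤ)⟧') := rot_of_distTriang _ T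

lemma inv_rot : Dist (-h⟦(-1 : ℤ)⟧' ≫ (shiftEquiv C (1 : ℤ)).unitIso.inv.app X) f
    (g ≫ (shiftEquiv C (1 : ℤ)).counitIso.inv.app Z) :=
  by simpa [Dist] using! inv_rot_of_distTriang _ T

lemma comp₁₂ : f ≫ g = 0 := comp_distTriang_mor_zero₁₂ _ T

lemma comp₂₃ : g ≫ h = 0 := comp_distTriang_mor_zero₂₃ _ T

lemma comp₃₁ : h ≫ f⟦(1 : ℤ)⟧' = 0 := comp_distTriang_mor_zero₃₁ _ T

/-- A morphism to `Y` which vanishes in `Z` comes from `X`. -/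
lemma lift₂ {W : C} (a : W ⟶ Y) (ha : a ≫ g = 0) : ∃ b : W ⟶ X, a = b ≫ f :=
  Triangle.coyoneda_exact₂ _ T a ha

/-- A morphism to `Z` which vanishes in `X⟦1⟧` comes from `Y`. -/
lemma lift₃ {W : C} (a : W ⟶ Z) (ha : a ≫ h = 0) : ∃ b : W ⟶ Y, a = b ≫ g :=
  Triangle.coyoneda_exact₃ _ T a ha

/-- A morphism to `X⟦1⟧` which vanishes in `Y⟦1⟧` comes from `Z`. -/
lemma lift₁ {W : C} (a : W ⟶ X⟦(1 : ℤ)⟧) (ha : a ≫ f⟦(1 : ℤ)⟧' = 0) : ∃ b : W ⟶ Z, a = b ≫ h :=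
  Triangle.coyoneda_exact₁ _ T a ha

/-- A morphism from `Y` which vanishes on `X` comes from `Z`. -/
lemma desc₂ {W : C} (a : Y ⟶ W) (ha : f ≫ a = 0) : ∃ b : Z ⟶ W, a = g ≫ b :=
  Triangle.yoneda_exact₂ _ T a ha

/-- A morphism from `Z` which vanishes on `Y` comes from `X⟦1⟧`. -/
lemma desc₃ {W : C} (a : Z ⟶ W) (ha : g ≫ a = 0) : ∃ b : X⟦(1 : ℤ)⟧ ⟶ W, a = h ≫ b :=
  Triangle.yoneda_exact₃ _ T a ha

/-- A morphism from `X` which vanishes after composition with the shifted connecting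
morphism extends to `Y`. -/
lemma desc₁ {W : C} (a : X ⟶ W) (ha : h ≫ a⟦(1 : ℤ)⟧' = 0) : ∃ b : Y ⟶ W, a = f ≫ b := by
  obtain ⟨b, hb⟩ := T.rot.desc₃ (a⟦(1 : ℤ)⟧') ha
  obtain ⟨b', rfl⟩ := (shiftFunctor C (1 : ℤ)).map_surjective b
  refine ⟨-b', (shiftFunctor C (1 : ℤ)).map_injective ?_⟩
  rw [hb]; simp

section

variable {X' Y' Z' : C} {f' : X' ⟶ Y'} {g' : Y' ⟶ Z'} {h' : Z' ⟶ X'⟦(1 : ℤ)⟧}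
  (T' : Dist f' g' h')

include T'

lemma complete₃ (a : X ⟶ X') (b : Y ⟶ Y') (w : f ≫ b = a ≫ f') :
    ∃ c : Z ⟶ Z', g ≫ c = b ≫ g' ∧ h ≫ a⟦(1 : ℤ)⟧' = c ≫ h' :=
  complete_distinguished_triangle_morphism _ _ T T' a b w

lemma complete₂ (a : X ⟶ X') (c : Z ⟶ Z') (w : h ≫ a⟦(1 : ℤ)⟧' = c ≫ h') :
    ∃ b : Y ⟶ Y', f ≫ b = a ≫ f' ∧ g ≫ c = b ≫ g' :=
  complete_distinguished_triangle_morphism₂ _ _ T T' a c w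

lemma isIso₂ {a : X ⟶ X'} {b : Y ⟶ Y'} {c : Z ⟶ Z'} (w₁ : f ≫ b = a ≫ f') (w₂ : g ≫ c = b ≫ g')
    (w₃ : h ≫ a⟦(1 : ℤ)⟧' = c ≫ h') [IsIso a] [IsIso c] : IsIso b :=
  isIso₂_of_isIso₁₃ (T := Triangle.mk f g h) (T' := Triangle.mk f' g' h')
    { hom₁ := a, hom₂ := b, hom₃ := c, comm₁ := w₁, comm₂ := w₂, comm₃ := w₃ } T T' ‹_› ‹_›

end

lemma isZero₃_iff : IsZero Z ↔ IsIso f := Triangle.isZero₃_iff_isIso₁ _ T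

end Dist

/-- The signs are those of the shift of triangles; the connecting morphism is left unspecified, as
only the exact sequences of the shifted triangle matter. -/
lemma Dist.shift {X Y Z : C} {f : X ⟶ Y} {g : Y ⟶ Z} {h : Z ⟶ X⟦(1 : ℤ)⟧} (T : Dist f g h)
    (n : ℤ) : ∃ h' : Z⟦n⟧ ⟶ (X⟦n⟧)⟦(1 : ℤ)⟧,
      Dist (n.negOnePow • f⟦n⟧') (n.negOnePow • g⟦n⟧') h' :=
  ⟨_, Triangle.shift_distinguished _ T n⟩

namespace Dist

variable {X Y Z : C} {f : X ⟶ Y} {g : Y ⟶ Z} {h : Z ⟶ X⟦(1 : ℤ)⟧} (T : Dist f g h)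

include T

lemma homZero₂_left {W : C} (h₁ : HomZero X W) (h₃ : HomZero Z W) : HomZero Y W := fun a => by
  obtain ⟨b, rfl⟩ := T.desc₂ a (h₁ _)
  rw [h₃ b, comp_zero]

lemma homZero₂_right {W : C} (h₁ : HomZero W X) (h₃ : HomZero W Z) : HomZero W Y := fun a => by
  obtain ⟨b, rfl⟩ := T.lift₂ a (h₃ _)
  rw [h₁ b, zero_comp]

lemma homZero₂_right_shift {W : C} (n : ℤ) (h₁ : HomZero W (X⟦n⟧)) (h₃ : HomZero W (Z⟦n⟧)) :
    HomZero W (Y⟦n⟧) := by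
  obtain ⟨h', T'⟩ := T.shift n
  exact T'.homZero₂_right h₁ h₃

lemma homZero₁_right_shift {W : C} (n n' : ℤ) (hn : n + 1 = n') (h₃ : HomZero W (Z⟦n⟧))
    (h₂ : HomZero W (Y⟦n'⟧)) : HomZero W (X⟦n'⟧) := by
  obtain ⟨h', T'⟩ := T.shift n
  refine HomZero.congr_right ((shiftFunctorAdd' C n 1 n' hn).app X).symm fun a => ?_
  obtain ⟨b, rfl⟩ := T'.lift₁ a (h₂.congr_right ((shiftFunctorAdd' C n 1 n' hn).app Y) _)
  rw [h₃ b, zero_comp]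

lemma homZero₃_left {W : C} (h₁ : HomZero (X⟦(1 : ℤ)⟧) W) (h₂ : HomZero Y W) : HomZero Z W :=
  T.rot.homZero₂_left h₂ h₁

end Dist

end Triangles

/-! ### Idempotents and Fitting's lemma -/

section Fitting

/-- Fitting's lemma: a finite-dimensional algebra without nontrivial idempotents is local. For `n`
large, the algebra is the direct sum of the kernel and the range of left multiplication by `aⁿ`. -/
lemma isUnit_or_isNilpotent {k : Type*} {R : Type*} [Field k] [Ring R] [Algebra k R]
    [Module.Finite k R] (hR : ∀ e : R, e * e = e → e = 0 ∨ e = 1) (a : R) :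
    IsUnit a ∨ IsNilpotent a := by
  obtain ⟨n, hn⟩ := Filter.eventually_atTop.1
    (LinearMap.eventually_isCompl_ker_pow_range_pow (LinearMap.mulLeft k a))
  replace hn := hn (n + 1) (by omega)
  rw [LinearMap.pow_mulLeft] at hn
  obtain ⟨⟨x, hx⟩, ⟨y, hy⟩, hxy⟩ := Submodule.codisjoint_iff_exists_add_eq.1 hn.codisjoint 1 |>.elim
    fun x h => h.elim fun y h => (⟨⟨x, h.1⟩, ⟨y, h.2.1⟩, h.2.2⟩ :
      ∃ (x : LinearMap.ker (LinearMap.mulLeft k (a ^ (n + 1))))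
        (y : LinearMap.range (LinearMap.mulLeft k (a ^ (n + 1)))), (x : R) + y = 1)
  dsimp at hxy
  obtain ⟨z, hz⟩ := hy
  simp only [LinearMap.mem_ker, LinearMap.mulLeft_apply] at hx hz
  -- the kernel and the range of left multiplication are right ideals
  have hxy0 : x * y = 0 := by
    refine (Submodule.disjoint_def.1 hn.disjoint) _ ?_ ⟨z - z * y, ?_⟩
    · simp [← mul_assoc, hx]
    · simp only [LinearMap.mulLeft_apply, mul_sub, ← mul_assoc, hz]
      rw [eq_sub_of_add_eq hxy]; noncomm_ring
  have hyy : y * y = y := by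
    conv_rhs => rw [← one_mul y, ← hxy, add_mul, hxy0, zero_add]
  rcases hR y hyy with h | h
  · right
    refine ⟨n + 1, ?_⟩
    rw [h, add_zero] at hxy
    rwa [hxy, mul_one] at hx
  · left
    rw [h] at hz
    refine (isUnit_pow_iff (n := n + 1) (by omega)).1 ⟨⟨a ^ (n + 1), z, hz, ?_⟩, rfl⟩
    have : z * a ^ (n + 1) - 1 = 0 := by
      refine (Submodule.disjoint_def.1 hn.disjoint) _ ?_ ⟨z * (z * a ^ (n + 1) - 1), ?_⟩
      · simp [mul_sub, ← mul_assoc, hz]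
      · simp [← mul_assoc, hz]
    exact sub_eq_zero.1 this

variable {C : Type u} [Category.{v} C] [Preadditive C]

/-- An object all of whose idempotent endomorphisms are trivial. -/
def TrivialIdempotents (M : C) : Prop := ∀ e : M ⟶ M, e ≫ e = e → e = 0 ∨ e = 𝟙 M

variable {k : Type y} [Field k] [Linear k C]

lemma TrivialIdempotents.isIso_or_isNilpotent {M : C} [Module.Finite k (M ⟶ M)]
    (hM : TrivialIdempotents M) (a : M ⟶ M) : IsIso a ∨ IsNilpotent (show End M from a) := by
  have : Module.Finite k (End M) := ‹_›
  rcases isUnit_or_isNilpotent (k := k) (R := End M) (fun e he => hM e he) a with h | h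
  · exact Or.inl ((isUnit_iff_isIso a).1 h)
  · exact Or.inr h

/-- An endomorphism fixing a nonzero morphism is not nilpotent. -/
lemma TrivialIdempotents.isIso_of_comp_eq {M : C} [Module.Finite k (M ⟶ M)]
    (hM : TrivialIdempotents M) {X : C} (α : X ⟶ M) (hα : α ≠ 0) (a : M ⟶ M) (ha : α ≫ a = α) :
    IsIso a := by
  rcases hM.isIso_or_isNilpotent (k := k) a with h | ⟨n, hn⟩
  · exact h
  · have : ∀ n : ℕ, α ≫ (show M ⟶ M from (show End M from a) ^ n) = α := by
      intro n
      induction n with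
      | zero => exact Category.comp_id α
      | succ n ih =>
        rw [pow_succ']
        change α ≫ (show M ⟶ M from (show End M from a) ^ n) ≫ a = α
        rw [← Category.assoc, ih, ha]
    refine (hα ?_).elim
    rw [← this n, hn]; exact comp_zero

lemma indecomposable_of_trivialIdempotents [HasBinaryBiproducts C] {M : C} (h0 : ¬ IsZero M)
    (hM : TrivialIdempotents M) : Indecomposable M := by
  refine ⟨h0, fun Y Z a => ?_⟩
  rcases hM (a.hom ≫ biprod.fst ≫ biprod.inl ≫ a.inv) (by simp) with h | h
  · left
    rw [IsZero.iff_id_eq_zero]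
    have : biprod.inl ≫ a.inv ≫ (a.hom ≫ biprod.fst ≫ biprod.inl ≫ a.inv) ≫ a.hom ≫ biprod.fst
      = 𝟙 Y := by simp
    rw [← this, h]; simp
  · right
    rw [IsZero.iff_id_eq_zero]
    have : biprod.inr ≫ a.inv ≫ (a.hom ≫ biprod.fst ≫ biprod.inl ≫ a.inv) ≫ a.hom ≫ biprod.snd
      = 0 := by simp
    rw [h] at this
    simpa using this

lemma trivialIdempotents_of_indecomposable [HasBinaryBiproducts C] [IsIdempotentComplete C]
    {M : C} (hM : Indecomposable M) : TrivialIdempotents M := by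
  intro e he
  obtain ⟨Y, i, p, hip, hpi⟩ := IsIdempotentComplete.idempotents_split M e he
  obtain ⟨Z, j, q, hjq, hqj⟩ := IsIdempotentComplete.idempotents_split M (𝟙 M - e) (by
    simp [Preadditive.comp_sub, Preadditive.sub_comp, he])
  have hiq : i ≫ q = 0 := by
    have : i ≫ q = (i ≫ p) ≫ i ≫ (q ≫ j) ≫ q := by simp [hip, hjq]
    rw [this, hqj]
    have : (i ≫ p) ≫ i ≫ (𝟙 M - e) ≫ q = i ≫ (e ≫ (𝟙 M - e)) ≫ q := by simp [← hpi]
    rw [this, Preadditive.comp_sub, he]; simp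
  have hjp : j ≫ p = 0 := by
    have : j ≫ p = (j ≫ q) ≫ j ≫ (p ≫ i) ≫ p := by simp [hip, hjq]
    rw [this, hpi]
    have : (j ≫ q) ≫ j ≫ e ≫ p = j ≫ ((𝟙 M - e) ≫ e) ≫ p := by simp [← hqj]
    rw [this, Preadditive.sub_comp, he]; simp
  rcases hM.2 Y Z ⟨biprod.lift p q, biprod.desc i j, by
    rw [biprod.lift_desc, hpi, hqj]; abel, by
    ext <;> simp [hip, hjq, hiq, hjp]⟩ with h | h
  · left
    rw [← hpi, h.eq_of_src i 0, comp_zero]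
  · right
    have := hqj.symm
    rw [h.eq_of_src j 0, comp_zero, sub_eq_zero] at this
    exact this.symm

/-- A splitting of an idempotent. -/
def Splits {M : C} (e : M ⟶ M) : Prop :=
  ∃ (Y : C) (i : Y ⟶ M) (p : M ⟶ Y), i ≫ p = 𝟙 Y ∧ p ≫ i = e

/-- Idempotents whose difference has square zero are conjugate. -/
lemma Splits.of_sub_comp_sub_eq_zero {M : C} {p p' : M ⟶ M} (hp : p ≫ p = p) (hp' : p' ≫ p' = p')
    (h : (p - p') ≫ (p - p') = 0) (hs : Splits p') : Splits p := by
  obtain ⟨Y, i, q, hiq, hqi⟩ := hs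
  -- `w` intertwines `p` and `p'`, with inverse `w'`
  let w : M ⟶ M := p ≫ p' + (𝟙 M - p) ≫ (𝟙 M - p')
  let w' : M ⟶ M := p' ≫ p + (𝟙 M - p') ≫ (𝟙 M - p)
  have h1 : w' ≫ w = 𝟙 M - (p - p') ≫ (p - p') := by
    simp only [w, w', Preadditive.comp_sub, Preadditive.sub_comp, Preadditive.comp_add,
      Preadditive.add_comp, Category.assoc, hp, hp', reassoc_of% hp,
      Category.comp_id, Category.id_comp]
    abel
  have h2 : p ≫ w = w ≫ p' := by
    simp only [w, Preadditive.comp_sub, Preadditive.sub_comp, Preadditive.comp_add,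
      Preadditive.add_comp, Category.assoc, hp, hp', reassoc_of% hp,
      Category.comp_id, Category.id_comp]
    abel
  have h3 : w ≫ w' = 𝟙 M - (p - p') ≫ (p - p') := by
    simp only [w, w', Preadditive.comp_sub, Preadditive.sub_comp, Preadditive.comp_add,
      Preadditive.add_comp, Category.assoc, hp, hp', reassoc_of% hp',
      Category.comp_id, Category.id_comp]
    abel
  rw [h, sub_zero] at h1 h3
  refine ⟨Y, i ≫ w', w ≫ q, ?_, ?_⟩
  · rw [Category.assoc, reassoc_of% h1, hiq]
  · rw [Category.assoc, reassoc_of% hqi, ← reassoc_of% h2, h3, Category.comp_id]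

/-- If the outer terms of a distinguished triangle `X ⟶ M ⟶ Y ⟶ X⟦1⟧` without morphisms
from `X` and `X⟦1⟧` to `Y` have split idempotents, then so has the middle term. -/
lemma splits_of_dist [HasZeroObject C] [HasShift C ℤ]
    [∀ n : ℤ, (shiftFunctor C n).Additive] [Pretriangulated C]
    {X M Y : C} {f : X ⟶ M} {g : M ⟶ Y} {h : Y ⟶ X⟦(1 : ℤ)⟧} (T : Dist f g h)
    (h₀ : ∀ f : X ⟶ Y, f = 0) (h₁ : ∀ f : X⟦(1 : ℤ)⟧ ⟶ Y, f = 0)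
    (hX : ∀ e : X ⟶ X, e ≫ e = e → Splits e)
    (hY : ∀ e : Y ⟶ Y, e ≫ e = e → Splits e)
    (p : M ⟶ M) (hp : p ≫ p = p) : Splits p := by
  -- `p` induces an endomorphism `(a, p, c)` of the triangle
  obtain ⟨a, ha⟩ := T.lift₂ (f ≫ p) (h₀ _)
  obtain ⟨c, hc, hac⟩ := T.complete₃ T a p ha
  have hc_inj : ∀ u : Y ⟶ Y, g ≫ u = 0 → u = 0 := fun u hu => by
    obtain ⟨v, rfl⟩ := T.desc₃ u hu
    rw [h₁ v, comp_zero]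
  have ha_inj : ∀ u : X ⟶ X, u ≫ f = 0 → u = 0 := fun u hu => by
    apply (shiftFunctor C (1 : ℤ)).map_injective
    obtain ⟨v, hv⟩ := T.lift₁ (u⟦(1 : ℤ)⟧') (by rw [← Functor.map_comp, hu, Functor.map_zero])
    rw [hv, h₁ v, zero_comp, Functor.map_zero]
  have haa : a ≫ a = a := by
    rw [← sub_eq_zero]
    apply ha_inj
    rw [Preadditive.sub_comp, Category.assoc, ← ha, ← Category.assoc, ← ha, Category.assoc, hp,
      sub_self]
  have hcc : c ≫ c = c := by
    rw [← sub_eq_zero]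
    apply hc_inj
    rw [Preadditive.comp_sub, ← Category.assoc, hc, Category.assoc, hc, ← Category.assoc, hp,
      sub_self]
  obtain ⟨X₁, i, r, hir, hri⟩ := hX a haa
  obtain ⟨Y₁, j, q, hjq, hqj⟩ := hY c hcc
  -- the triangle on the images of `a` and `c`
  obtain ⟨M₁, f₁, g₁, T₁⟩ := Dist.exists_middle (j ≫ h ≫ r⟦(1 : ℤ)⟧')
  have hri' : r⟦(1 : ℤ)⟧' ≫ i⟦(1 : ℤ)⟧' = a⟦(1 : ℤ)⟧' := by rw [← Functor.map_comp, hri]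
  have hir' : i⟦(1 : ℤ)⟧' ≫ r⟦(1 : ℤ)⟧' = 𝟙 _ := by
    rw [← Functor.map_comp, hir, CategoryTheory.Functor.map_id]
  obtain ⟨s, hs₁, hs₂⟩ := T₁.complete₂ T i j (by
    rw [Category.assoc, Category.assoc, hri', hac, ← hqj]
    simp only [Category.assoc, reassoc_of% hjq])
  obtain ⟨t, ht₁, ht₂⟩ := T.complete₂ T₁ r q (by
    rw [reassoc_of% hqj, ← reassoc_of% hac, ← hri, Functor.map_comp, Category.assoc, hir',
      Category.comp_id])
  have hst₁ : f₁ ≫ s ≫ t = f₁ := by rw [reassoc_of% hs₁, ht₁, reassoc_of% hir]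
  have hst₂ : (s ≫ t) ≫ g₁ = g₁ := by
    rw [Category.assoc, ← ht₂, ← reassoc_of% hs₂, hjq, Category.comp_id]
  have : IsIso (s ≫ t) := T₁.isIso₂ T₁ (a := 𝟙 _) (c := 𝟙 _) (by simpa using hst₁)
    (by simpa using hst₂.symm) (by simp)
  -- a split idempotent inducing `a` and `c`
  let p' := t ≫ inv (s ≫ t) ≫ s
  have e1 : f₁ ≫ inv (s ≫ t) = f₁ := by rw [IsIso.comp_inv_eq, hst₁]
  have e2 : inv (s ≫ t) ≫ g₁ = g₁ := by rw [IsIso.inv_comp_eq, hst₂]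
  have e3 : s ≫ t ≫ inv (s ≫ t) = 𝟙 _ := by rw [← Category.assoc, IsIso.hom_inv_id]
  have hp1 : f ≫ p' = a ≫ f := by
    simp only [p']
    rw [reassoc_of% ht₁, reassoc_of% e1, hs₁, reassoc_of% hri]
  have hp2 : p' ≫ g = g ≫ c := by
    simp only [p', Category.assoc]
    rw [← hs₂, reassoc_of% e2, ← reassoc_of% ht₂, hqj]
  refine Splits.of_sub_comp_sub_eq_zero hp (p' := p') ?_ ?_ ⟨M₁, s, t ≫ inv (s ≫ t), e3, by
    simp [p']⟩
  · simp only [p', Category.assoc, reassoc_of% e3]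
  · -- `p - p'` vanishes on `X` and has zero image in `Y`, so that its square is zero
    obtain ⟨d, hd⟩ := T.desc₂ (p - p') (by
      rw [Preadditive.comp_sub, ha, hp1, sub_self])
    nth_rw 2 [hd]
    rw [← Category.assoc, Preadditive.sub_comp, hp2, hc, sub_self, zero_comp]

end Fitting

/-! ### Bounded objects of the derived category -/

section Derived

open DerivedCategory

variable {A : Type u} [Category.{v} A] [Abelian A] [HasDerivedCategory.{w} A]

/-- An object of `A` as an object of the derived category, in degree `0`. -/
noncomputable abbrev sg (X : A) : DerivedCategory A := (singleFunctor A 0).obj X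

/-- The cohomology objects of an object of the derived category. -/
noncomputable abbrev coh (j : ℤ) (M : DerivedCategory A) : A := (homologyFunctor A j).obj M

/-- The cohomologically bounded objects. -/
def Bdd (M : DerivedCategory A) : Prop :=
  (TStructure.t : Triangulated.TStructure (DerivedCategory A)).bounded M

lemma bdd_iff (M : DerivedCategory A) : Bdd M ↔ ∃ a b : ℤ, M.IsGE a ∧ M.IsLE b :=
  ⟨fun h => ⟨_, _, h.1.choose_spec, h.2.choose_spec⟩,
    fun ⟨a, b, h₁, h₂⟩ => ⟨⟨a, h₁⟩, ⟨b, h₂⟩⟩⟩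

instance : ObjectProperty.IsTriangulated (Bdd : ObjectProperty (DerivedCategory A)) :=
  inferInstanceAs
    (TStructure.t : Triangulated.TStructure (DerivedCategory A)).bounded.IsTriangulated

instance : ObjectProperty.IsClosedUnderIsomorphisms (Bdd : ObjectProperty (DerivedCategory A)) :=
  inferInstanceAs
    (TStructure.t : Triangulated.TStructure (DerivedCategory A)).bounded.IsClosedUnderIsomorphisms

lemma bdd_sg (X : A) : Bdd (sg X) :=
  (bdd_iff _).2 ⟨0, 0, inferInstance, inferInstance⟩

lemma dist_of_shortExact {S : ShortComplex A} (hS : S.ShortExact) :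
    Dist ((singleFunctor A 0).map S.f) ((singleFunctor A 0).map S.g) hS.singleδ :=
  hS.singleTriangle_distinguished

lemma isZero_of_coh {M : DerivedCategory A} (h : ∀ j, IsZero (coh j M)) : IsZero M := by
  have : IsIso (0 : M ⟶ M) := by
    rw [isIso_iff]
    intro n
    exact (h n).isIso (h n) _
  rw [IsZero.iff_id_eq_zero, ← IsIso.hom_inv_id (0 : M ⟶ M), zero_comp]

section Truncation

variable {X M Y : DerivedCategory A} {f : X ⟶ M} {g : M ⟶ Y} {h : Y ⟶ X⟦(1 : ℤ)⟧}
  (T : Dist f g h)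

include T

lemma coh_exact₂ (j : ℤ) : (ShortComplex.mk ((homologyFunctor A j).map f)
    ((homologyFunctor A j).map g) (by rw [← Functor.map_comp, T.comp₁₂, Functor.map_zero])).Exact :=
  HomologySequence.exact₂ _ T j

lemma isZero_coh₂ (j : ℤ) (h₁ : IsZero (coh j X)) (h₃ : IsZero (coh j Y)) : IsZero (coh j M) :=
  (coh_exact₂ T j).isZero_of_both_zeros (h₁.eq_of_src _ _) (h₃.eq_of_tgt _ _)

lemma isIso_coh_map_of_isZero₃ (j : ℤ) (h₀ : IsZero (coh (j - 1) Y)) (h₁ : IsZero (coh j Y)) :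
    IsIso ((homologyFunctor A j).map f) := by
  have : Mono ((homologyFunctor A j).map f) :=
    (HomologySequence.mono_homologyMap_mor₁_iff _ T (j - 1) j (by lia)).2 (h₀.eq_of_src _ _)
  have : Epi ((homologyFunctor A j).map f) :=
    (HomologySequence.epi_homologyMap_mor₁_iff _ T j).2 (h₁.eq_of_tgt _ _)
  exact isIso_of_mono_of_epi _

lemma isIso_coh_map_of_isZero₁ (j : ℤ) (h₀ : IsZero (coh j X)) (h₁ : IsZero (coh (j + 1) X)) :
    IsIso ((homologyFunctor A j).map g) := by
  have : Mono ((homologyFunctor A j).map g) :=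
    (HomologySequence.mono_homologyMap_mor₂_iff _ T j).2 (h₀.eq_of_src _ _)
  have : Epi ((homologyFunctor A j).map g) :=
    (HomologySequence.epi_homologyMap_mor₂_iff _ T j (j + 1) (by lia)).2 (h₁.eq_of_tgt _ _)
  exact isIso_of_mono_of_epi _

variable {n : ℤ}

lemma isIso_coh_map_of_le (hY : Y.IsGE (n + 1)) {j : ℤ} (hj : j ≤ n) :
    IsIso ((homologyFunctor A j).map f) :=
  isIso_coh_map_of_isZero₃ T j (Y.isZero_of_isGE (n + 1) _ (by lia))
    (Y.isZero_of_isGE (n + 1) _ (by lia))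

lemma isIso_coh_map_of_lt (hX : X.IsLE n) {j : ℤ} (hj : n < j) :
    IsIso ((homologyFunctor A j).map g) :=
  isIso_coh_map_of_isZero₁ T j (X.isZero_of_isLE n _ (by lia)) (X.isZero_of_isLE n _ (by lia))

end Truncation

/-- The truncation triangle `τ≤n M ⟶ M ⟶ τ>n M ⟶`. -/
lemma exists_trunc (M : DerivedCategory A) (n : ℤ) :
    ∃ (X Y : DerivedCategory A) (f : X ⟶ M) (g : M ⟶ Y) (h : Y ⟶ X⟦(1 : ℤ)⟧),
      Dist f g h ∧ X.IsLE n ∧ Y.IsGE (n + 1) := by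
  obtain ⟨X, Y, hX, hY, f, g, h, T⟩ :=
    (TStructure.t : Triangulated.TStructure (DerivedCategory A)).exists_triangle M n (n + 1) rfl
  exact ⟨X, Y, f, g, h, T, ⟨hX⟩, ⟨hY⟩⟩

/-- Reduction of a statement on bounded objects to their cohomology objects, through the
truncation triangles. -/
lemma bounded_induction_trunc (P : ObjectProperty (DerivedCategory A))
    [P.IsClosedUnderIsomorphisms] (hzero : ∀ X, IsZero X → P X)
    (hext : ∀ {X Y Z : DerivedCategory A} {f : X ⟶ Y} {g : Y ⟶ Z} {h : Z ⟶ X⟦(1 : ℤ)⟧},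
      Dist f g h → ∀ n : ℤ, X.IsLE n → Z.IsGE (n + 1) → P X → P Z → P Y)
    {M : DerivedCategory A} (hM : Bdd M) (hs : ∀ j : ℤ, P ((singleFunctor A j).obj (coh j M))) :
    P M := by
  obtain ⟨a, b, ha, hb⟩ := (bdd_iff M).1 hM
  obtain ⟨N, hN⟩ : ∃ N : ℕ, b < a + N := ⟨(b - a + 1).toNat, by lia⟩
  replace hb : M.IsLE (a + N - 1) :=
    (isLE_iff _ _).2 fun i hi => M.isZero_of_isLE b i (by lia)
  clear hN hM
  induction N generalizing M with
  | zero =>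
    refine hzero _ (isZero_of_coh fun j => ?_)
    by_cases hj : j < a
    · exact M.isZero_of_isGE a j hj
    · exact M.isZero_of_isLE (a + (0 : ℕ) - 1) j (by lia)
  | succ N ih =>
    obtain ⟨X, Y, f, g, h, T, hX, hY⟩ := exists_trunc M (a + N - 1)
    have hzs : ∀ (j : ℤ) (Z : A), IsZero Z → P ((singleFunctor A j).obj Z) := fun j Z hZ =>
      hzero _ (Functor.map_isZero _ hZ)
    refine hext T (a + N - 1) hX hY (ih (fun j => ?_) ?_ hX) ?_
    · by_cases hj : j ≤ a + N - 1
      · have := isIso_coh_map_of_le T hY hj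
        exact P.prop_of_iso ((singleFunctor A j).mapIso
          (asIso ((homologyFunctor A j).map f)).symm) (hs j)
      · exact hzs _ _ (X.isZero_of_isLE (a + N - 1) j (by lia))
    · rw [isGE_iff]
      intro j hj
      by_cases hj' : j ≤ a + N - 1
      · have := isIso_coh_map_of_le T hY hj'
        exact (M.isZero_of_isGE a j hj).of_iso (asIso ((homologyFunctor A j).map f))
      · exact X.isZero_of_isLE (a + N - 1) j (by lia)
    · have : Y.IsGE (a + N) :=
        (isGE_iff _ _).2 fun j hj => Y.isZero_of_isGE (a + N - 1 + 1) j (by lia)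
      have : Y.IsLE (a + N) := (isLE_iff _ _).2 fun j hj => by
        have := isIso_coh_map_of_lt T hX (j := j) (by lia)
        exact (M.isZero_of_isLE (a + (N + 1 : ℕ) - 1) j (by push_cast; lia)).of_iso
          (asIso ((homologyFunctor A j).map g)).symm
      obtain ⟨Z, ⟨e⟩⟩ := exists_iso_singleFunctor_obj_of_isGE_of_isLE Y (a + N)
      have := isIso_coh_map_of_lt T hX (j := a + N) (by lia)
      let e' : coh (a + N) M ≅ Z := asIso ((homologyFunctor A (a + N)).map g) ≪≫
        (homologyFunctor A (a + N)).mapIso e ≪≫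
          (singleFunctorCompHomologyFunctorIso A (a + N)).app Z
      exact P.prop_of_iso ((singleFunctor A (a + N)).mapIso e' ≪≫ e.symm) (hs _)

/-- Reduction of a statement on bounded objects to their cohomology objects. -/
lemma bounded_induction (P : ObjectProperty (DerivedCategory A)) [P.IsClosedUnderIsomorphisms]
    (hzero : ∀ X, IsZero X → P X)
    (hext : ∀ {X Y Z : DerivedCategory A} {f : X ⟶ Y} {g : Y ⟶ Z} {h : Z ⟶ X⟦(1 : ℤ)⟧},
      Dist f g h → P X → P Z → P Y)
    {M : DerivedCategory A} (hM : Bdd M) (hs : ∀ j : ℤ, P ((singleFunctor A j).obj (coh j M))) :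
    P M :=
  bounded_induction_trunc P hzero (fun T _ _ _ h₁ h₃ => hext T h₁ h₃) hM hs

/-- `X⟦-j⟧` is the object `X` placed in degree `j`. -/
noncomputable def sgShiftIso (X : A) (j : ℤ) : (sg X)⟦-j⟧ ≅ (singleFunctor A j).obj X :=
  ((singleFunctors A).shiftIso (-j) j 0 (by lia)).app X

/-- `Hom(W, Y[c])` vanishes as soon as the terms `Hom(W, Hʲ(Y)[c - j])` of the spectral
sequence do. -/
lemma homZero_of_coh_right {W Y : DerivedCategory A} (hY : Bdd Y) (c : ℤ)
    (h : ∀ j, HomZero W ((sg (coh j Y))⟦c - j⟧)) : HomZero W (Y⟦c⟧) := by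
  let P : ObjectProperty (DerivedCategory A) := fun Y => HomZero W (Y⟦c⟧)
  have : P.IsClosedUnderIsomorphisms :=
    ⟨fun e h => HomZero.congr_right ((shiftFunctor _ c).mapIso e) h⟩
  refine bounded_induction P (fun X hX => HomZero.of_isZero_right (Functor.map_isZero _ hX))
    (fun T h₁ h₃ => T.homZero₂_right_shift c h₁ h₃) hY (fun j => ?_)
  exact (h j).congr_right ((shiftFunctorAdd' _ (-j) c (c - j) (by lia)).app _ ≪≫
    (shiftFunctor _ c).mapIso (sgShiftIso _ j))

/-- `Hom(Y, W)` vanishes as soon as the terms `Hom(Hʲ(Y), W[j])` of the spectral sequence do. -/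
lemma homZero_of_coh_left {W Y : DerivedCategory A} (hY : Bdd Y)
    (h : ∀ j, HomZero (sg (coh j Y)) (W⟦j⟧)) : HomZero Y W := by
  let P : ObjectProperty (DerivedCategory A) := fun Y => HomZero Y W
  have : P.IsClosedUnderIsomorphisms := ⟨fun e h => HomZero.congr_left e h⟩
  refine bounded_induction P (fun X hX => HomZero.of_isZero_left hX)
    (fun T h₁ h₃ => T.homZero₂_left h₁ h₃) hY (fun j => ?_)
  exact ((homZero_shift_left_iff j (by lia)).2 (h j)).congr_left (sgShiftIso _ j)

/-- On the heart of the `t`-structure, the functor `H⁰` is fully faithful. -/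
lemma heart_hom_bijective (E F : DerivedCategory A) [E.IsGE 0] [E.IsLE 0] [F.IsGE 0] [F.IsLE 0] :
    Function.Bijective (fun f : E ⟶ F => (homologyFunctor A 0).map f) := by
  obtain ⟨X, ⟨e⟩⟩ := exists_iso_singleFunctor_obj_of_isGE_of_isLE E 0
  obtain ⟨Y, ⟨e'⟩⟩ := exists_iso_singleFunctor_obj_of_isGE_of_isLE F 0
  let i := singleFunctorCompHomologyFunctorIso A 0
  let H := homologyFunctor A 0
  have key : ∀ φ : X ⟶ Y, H.map (e.hom ≫ (singleFunctor A 0).map φ ≫ e'.inv) =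
      H.map e.hom ≫ i.hom.app X ≫ φ ≫ i.inv.app Y ≫ H.map e'.inv := fun φ => by
    have h : H.map ((singleFunctor A 0).map φ) = i.hom.app X ≫ φ ≫ i.inv.app Y :=
      (NatIso.naturality_2 i φ).symm
    rw [H.map_comp, H.map_comp, h]
    simp only [Category.assoc]
  have hsurj : ∀ f : E ⟶ F, ∃ φ : X ⟶ Y, e.hom ≫ (singleFunctor A 0).map φ ≫ e'.inv = f :=
    fun f => by
      obtain ⟨φ, hφ⟩ := (singleFunctor A 0).map_surjective (e.inv ≫ f ≫ e'.hom)
      exact ⟨φ, by rw [hφ]; simp⟩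
  constructor
  · intro f f' hff
    obtain ⟨φ, rfl⟩ := hsurj f
    obtain ⟨φ', rfl⟩ := hsurj f'
    dsimp only at hff
    change H.map _ = H.map _ at hff
    rw [key, key, cancel_epi, cancel_epi, ← Category.assoc, ← Category.assoc, cancel_mono,
      cancel_mono] at hff
    rw [hff]
  · intro g
    refine ⟨e.hom ≫ (singleFunctor A 0).map (i.inv.app X ≫ H.map e.inv ≫ g ≫ H.map e'.hom ≫
      i.hom.app Y) ≫ e'.inv, ?_⟩
    change H.map _ = _
    rw [key]
    simp only [Category.assoc, Iso.hom_inv_id_app_assoc, Functor.comp_obj, Functor.id_obj]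
    simp only [← Functor.map_comp, ← Functor.map_comp_assoc, Iso.hom_inv_id,
      CategoryTheory.Functor.map_id, Category.id_comp]
    exact Category.comp_id _

section ProjectiveLike

variable (P : A) {M : DerivedCategory A} (hM : Bdd M)
  (hP : ∀ j m : ℤ, m ≠ 0 → HomZero (sg P) ((sg (coh j M))⟦m⟧))

include hM hP

/-- If `P` has no higher extensions by the cohomology objects of `M`, then `M` may be replaced by
`E = H⁰(M)` in `Hom(P, M)`, through `X = τ≤0 M`. -/
lemma exists_heart_right : ∃ (X E : DerivedCategory A) (i : X ⟶ M) (q : X ⟶ E),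
    E.IsGE 0 ∧ E.IsLE 0 ∧ IsIso ((homologyFunctor A 0).map i) ∧
    IsIso ((homologyFunctor A 0).map q) ∧
    Function.Bijective (fun f : sg P ⟶ X => f ≫ i) ∧
    Function.Bijective (fun f : sg P ⟶ X => f ≫ q) := by
  obtain ⟨X, Y, f, g, h, T, hX, hY⟩ := exists_trunc M 0
  obtain ⟨X', E, f', g', h', T', hX', hE⟩ := exists_trunc X (-1)
  obtain ⟨a, b, ha, hb⟩ := (bdd_iff M).1 hM
  -- the cohomology objects of the truncations are those of `M`, or zero
  have hjX : ∀ j, j ≤ 0 → Nonempty (coh j X ≅ coh j M) := fun j hj => by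
    have := isIso_coh_map_of_le T hY hj
    exact ⟨asIso ((homologyFunctor A j).map f)⟩
  have hjX' : ∀ j, j ≤ -1 → Nonempty (coh j X' ≅ coh j M) := fun j hj => by
    have := isIso_coh_map_of_le T' hE hj
    obtain ⟨e⟩ := hjX j (by lia)
    exact ⟨asIso ((homologyFunctor A j).map f') ≪≫ e⟩
  have hjY : ∀ j, 1 ≤ j → Nonempty (coh j Y ≅ coh j M) := fun j hj => by
    have := isIso_coh_map_of_lt T hX (j := j) (by lia)
    exact ⟨(asIso ((homologyFunctor A j).map g)).symm⟩
  have hYb : Bdd Y := (bdd_iff _).2 ⟨1, max b 1, hY, (isLE_iff _ _).2 fun i hi => by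
    obtain ⟨e⟩ := hjY i (by lia)
    exact (M.isZero_of_isLE b i (by lia)).of_iso e⟩
  have hXb : Bdd X' := (bdd_iff _).2 ⟨min a 0, -1, (isGE_iff _ _).2 fun i hi => by
    obtain ⟨e⟩ := hjX' i (by lia)
    exact (M.isZero_of_isGE a i (by lia)).of_iso e, hX'⟩
  -- the terms `Hom(P, Hʲ(M)[c - j])` which could contribute have `c - j ≠ 0`
  have vY : ∀ c : ℤ, c ≤ 0 → HomZero (sg P) (Y⟦c⟧) := fun c hc =>
    homZero_of_coh_right hYb c fun j => by
      by_cases hj : 1 ≤ j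
      · obtain ⟨e⟩ := hjY j hj
        exact (hP j (c - j) (by lia)).congr_right
          ((shiftFunctor _ _).mapIso ((singleFunctor A 0).mapIso e.symm))
      · exact HomZero.of_isZero_right (Functor.map_isZero _ (Functor.map_isZero _
          (Y.isZero_of_isGE (0 + 1) j (by lia))))
  have vX : ∀ c : ℤ, 0 ≤ c → HomZero (sg P) (X'⟦c⟧) := fun c hc =>
    homZero_of_coh_right hXb c fun j => by
      by_cases hj : j ≤ -1
      · obtain ⟨e⟩ := hjX' j hj
        exact (hP j (c - j) (by lia)).congr_right
          ((shiftFunctor _ _).mapIso ((singleFunctor A 0).mapIso e.symm))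
      · exact HomZero.of_isZero_right (Functor.map_isZero _ (Functor.map_isZero _
          (X'.isZero_of_isLE (-1) j (by lia))))
  refine ⟨X, E, f, g', hE, (isLE_iff _ _).2 fun i hi => ?_, isIso_coh_map_of_le T hY le_rfl,
    isIso_coh_map_of_lt T' hX' (by lia), ⟨fun u u' hu => ?_, fun u => ?_⟩,
    ⟨fun u u' hu => ?_, fun u => ?_⟩⟩
  · have := isIso_coh_map_of_lt T' hX' (j := i) (by lia)
    exact (X.isZero_of_isLE 0 i hi).of_iso (asIso ((homologyFunctor A i).map g')).symm
  · rw [← sub_eq_zero]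
    obtain ⟨v, hv⟩ := T.inv_rot.lift₂ (u - u') (by
      rw [Preadditive.sub_comp, sub_eq_zero]; exact hu)
    rw [hv, vY (-1) (by lia) v, zero_comp]
  · obtain ⟨v, hv⟩ := T.lift₂ u (homZero_shift_zero_iff.1 (vY 0 le_rfl) _)
    exact ⟨v, hv.symm⟩
  · rw [← sub_eq_zero]
    obtain ⟨v, hv⟩ := T'.lift₂ (u - u') (by
      rw [Preadditive.sub_comp, sub_eq_zero]; exact hu)
    rw [hv, homZero_shift_zero_iff.1 (vX 0 le_rfl) v, zero_comp]
  · obtain ⟨v, hv⟩ := T'.lift₃ u (vX 1 (by lia) _)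
    exact ⟨v, hv.symm⟩

/-- If `P` has no higher extensions by the cohomology objects of `M`, then morphisms from `P`
to `M` are the same as morphisms from `P` to the degree `0` cohomology object. -/
lemma coh_map_bijective_of_source :
    Function.Bijective (fun f : sg P ⟶ M => (homologyFunctor A 0).map f) := by
  obtain ⟨X, E, i, q, hE, hE', hi, hq, bi, bq⟩ := exists_heart_right P hM hP
  have bE := heart_hom_bijective (sg P) E
  constructor
  · intro f f' hff
    obtain ⟨u, rfl⟩ := bi.2 f
    obtain ⟨u', rfl⟩ := bi.2 f'
    dsimp only at hff ⊢
    rw [Functor.map_comp, Functor.map_comp, cancel_mono] at hff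
    congr 1
    apply bq.1
    apply bE.1
    dsimp only
    rw [Functor.map_comp, Functor.map_comp, hff]
  · intro g
    obtain ⟨f₀, hf₀⟩ := bE.2 (g ≫ inv ((homologyFunctor A 0).map i) ≫ (homologyFunctor A 0).map q)
    obtain ⟨u, rfl⟩ := bq.2 f₀
    refine ⟨u ≫ i, ?_⟩
    dsimp only at hf₀ ⊢
    rw [Functor.map_comp, ← Category.assoc, cancel_mono, IsIso.eq_comp_inv] at hf₀
    rw [Functor.map_comp, hf₀]

end ProjectiveLike

/-- If `I` has no higher extensions with the cohomology objects of `M`, then every morphism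
from the degree `0` cohomology object of `M` to `I` lifts to a morphism from `M`. -/
lemma coh_map_surjective_of_target (I : A) {M : DerivedCategory A} (hM : Bdd M)
    (hI : ∀ j m : ℤ, m ≠ 0 → HomZero (sg (coh j M)) ((sg I)⟦m⟧)) :
    Function.Surjective (fun f : M ⟶ sg I => (homologyFunctor A 0).map f) := by
  -- `Y = τ≥0 M`, of which `E = H⁰(M)` is the truncation in degree `0`
  obtain ⟨X, Y, f, g, h, T, hX, hY⟩ := exists_trunc M (-1)
  obtain ⟨E, Y', f', g', h', T', hE, hY'⟩ := exists_trunc Y 0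
  obtain ⟨a, b, ha, hb⟩ := (bdd_iff M).1 hM
  have hjY : ∀ j, 0 ≤ j → Nonempty (coh j Y ≅ coh j M) := fun j hj => by
    have := isIso_coh_map_of_lt T hX (j := j) (by lia)
    exact ⟨(asIso ((homologyFunctor A j).map g)).symm⟩
  have hjY' : ∀ j, 1 ≤ j → Nonempty (coh j Y' ≅ coh j M) := fun j hj => by
    have := isIso_coh_map_of_lt T' hE (j := j) (by lia)
    obtain ⟨e⟩ := hjY j (by lia)
    exact ⟨(asIso ((homologyFunctor A j).map g')).symm ≪≫ e⟩
  have hjX : ∀ j, j ≤ -1 → Nonempty (coh j X ≅ coh j M) := fun j hj => by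
    have := isIso_coh_map_of_le T hY hj
    exact ⟨asIso ((homologyFunctor A j).map f)⟩
  have hYb : Bdd Y' := (bdd_iff _).2 ⟨1, max b 1, hY', (isLE_iff _ _).2 fun i hi => by
    obtain ⟨e⟩ := hjY' i (by lia)
    exact (M.isZero_of_isLE b i (by lia)).of_iso e⟩
  have hXb : Bdd X := (bdd_iff _).2 ⟨min a 0, -1, (isGE_iff _ _).2 fun i hi => by
    obtain ⟨e⟩ := hjX i (by lia)
    exact (M.isZero_of_isGE a i (by lia)).of_iso e, hX⟩
  have vY : HomZero Y' ((sg I)⟦(1 : ℤ)⟧) := homZero_of_coh_left hYb fun j => by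
    by_cases hj : 1 ≤ j
    · obtain ⟨e⟩ := hjY' j hj
      exact ((hI j (1 + j) (by lia)).congr_left ((singleFunctor A 0).mapIso e.symm)).congr_right
        ((shiftFunctorAdd _ (1 : ℤ) j).app _)
    · exact HomZero.of_isZero_left (Functor.map_isZero _ (Y'.isZero_of_isGE (0 + 1) j (by lia)))
  have : E.IsLE 0 := hE
  have : IsIso ((homologyFunctor A 0).map f') := isIso_coh_map_of_le T' hY' le_rfl
  have : IsIso ((homologyFunctor A 0).map g) := isIso_coh_map_of_lt T hX (by lia)
  have : E.IsGE 0 := (isGE_iff _ _).2 fun i hi => by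
    have := isIso_coh_map_of_le T' hY' (j := i) (by lia)
    exact (Y.isZero_of_isGE (-1 + 1) i (by lia)).of_iso (asIso ((homologyFunctor A i).map f'))
  -- a morphism from `E` to `I` extends to `Y` since the obstruction lies in `Hom(Y', I[1])`
  intro β
  obtain ⟨β₀, hβ₀⟩ := (heart_hom_bijective E (sg I)).2
    ((homologyFunctor A 0).map f' ≫ inv ((homologyFunctor A 0).map g) ≫ β)
  obtain ⟨b, rfl⟩ := T'.desc₁ β₀ (vY _)
  refine ⟨g ≫ b, ?_⟩
  dsimp only at hβ₀ ⊢
  rw [Functor.map_comp, cancel_epi, IsIso.eq_inv_comp] at hβ₀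
  rw [Functor.map_comp, hβ₀]

/-- Idempotents of bounded objects split: they do so in `A`, and splittings can be glued along the
truncation triangles. -/
lemma splits_of_bdd {M : DerivedCategory A} (hM : Bdd M) (p : M ⟶ M) (hp : p ≫ p = p) :
    Splits p := by
  let P : ObjectProperty (DerivedCategory A) := fun M => ∀ p : M ⟶ M, p ≫ p = p → Splits p
  have : P.IsClosedUnderIsomorphisms := ⟨fun {X Y} e h p hp => by
    obtain ⟨Z, i, q, hiq, hqi⟩ := h (e.hom ≫ p ≫ e.inv) (by simp [reassoc_of% hp])
    exact ⟨Z, i ≫ e.hom, e.inv ≫ q, by simpa using hiq, by simp [reassoc_of% hqi]⟩⟩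
  refine bounded_induction_trunc P (fun X hX p _ => ⟨X, 𝟙 X, p, hX.eq_of_src _ _, by simp⟩)
    (fun {X Y Z f g h} T n hX hZ h₁ h₃ => splits_of_dist T (fun f => ?_) (fun f => ?_) h₁ h₃)
    hM (fun j p hp => ?_) p hp
  · have := hX; have := hZ
    exact TStructure.t.zero f n (n + 1)
  · have := hX; have := hZ
    have : TStructure.t.IsLE (X⟦(1 : ℤ)⟧) (n - 1) := TStructure.t.isLE_shift X n 1 (n - 1) (by lia)
    exact TStructure.t.zero f (n - 1) (n + 1)
  · obtain ⟨φ, rfl⟩ := (singleFunctor A j).map_surjective p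
    obtain ⟨Y, i, q, hiq, hqi⟩ := IsIdempotentComplete.idempotents_split _ φ
      ((singleFunctor A j).map_injective (by rw [Functor.map_comp, hp]))
    exact ⟨_, (singleFunctor A j).map i, (singleFunctor A j).map q,
      by rw [← Functor.map_comp, hiq, CategoryTheory.Functor.map_id],
      by rw [← Functor.map_comp, hqi]⟩

end Derived

/-! ### Extensions and morphisms between shifted objects of the heart -/

section Heart

open DerivedCategory Triangulated

variable {A : Type u} [Category.{v} A] [Abelian A] [HasDerivedCategory.{w} A]

lemma homZero_neg (X Y : A) {c : ℤ} (hc : c < 0) : HomZero (sg X) ((sg Y)⟦c⟧) := fun f => by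
  have : TStructure.t.IsLE (sg X) 0 := inferInstanceAs (IsLE (sg X) 0)
  have : TStructure.t.IsGE (sg Y) 0 := inferInstanceAs (IsGE (sg Y) 0)
  have := TStructure.t.isGE_shift (sg Y) 0 c (-c)
  exact TStructure.t.zero f 0 (-c)

lemma homZero_sg_iff {X Y : A} : HomZero (sg X) (sg Y) ↔ HomZero (C := A) X Y :=
  homZero_map_iff (singleFunctor A 0)

lemma homZero_sg_shift_zero {X Y : A} (h : HomZero X Y) : HomZero (sg X) ((sg Y)⟦(0 : ℤ)⟧) :=
  homZero_shift_zero_iff.2 (homZero_sg_iff.2 h)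

lemma ExtClosure.homZero_right {G : ObjectProperty A} {Y : A} (hY : ExtClosure G Y)
    {M : DerivedCategory A} {c : ℤ} (hG : ∀ X, G X → HomZero M ((sg X)⟦c⟧)) :
    HomZero M ((sg Y)⟦c⟧) := by
  induction hY with
  | of h => exact hG _ h
  | zero h => exact .of_isZero_right (Functor.map_isZero _ (Functor.map_isZero _ h))
  | ext hS _ _ h₁ h₃ => exact (dist_of_shortExact hS).homZero₂_right_shift c h₁ h₃

lemma ExtClosure.homZero_left {G : ObjectProperty A} {X : A} (hX : ExtClosure G X)
    {M : DerivedCategory A} (hG : ∀ Y, G Y → HomZero (sg Y) M) : HomZero (sg X) M := by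
  induction hX with
  | of h => exact hG _ h
  | zero h => exact .of_isZero_left (Functor.map_isZero _ h)
  | ext hS _ _ h₁ h₃ => exact (dist_of_shortExact hS).homZero₂_left h₁ h₃

/-- A morphism `X ⟶ Y⟦1⟧` between objects of the heart is the class of an extension. -/
lemma exists_extension {X Y : A} (ξ : sg X ⟶ (sg Y)⟦(1 : ℤ)⟧) :
    ∃ (E : A) (f : Y ⟶ E) (g : E ⟶ X) (w : f ≫ g = 0),
      (ShortComplex.mk f g w).ShortExact ∧ (singleFunctor A 0).map g ≫ ξ = 0 := by
  -- the middle term of the triangle defined by `ξ` lies in the heart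
  obtain ⟨N, f, g, T⟩ := Dist.exists_middle ξ
  have : N.IsGE 0 := (isGE_iff _ _).2 fun j hj =>
    isZero_coh₂ T j ((sg Y).isZero_of_isGE 0 j hj) ((sg X).isZero_of_isGE 0 j hj)
  have : N.IsLE 0 := (isLE_iff _ _).2 fun j hj =>
    isZero_coh₂ T j ((sg Y).isZero_of_isLE 0 j hj) ((sg X).isZero_of_isLE 0 j hj)
  obtain ⟨E, ⟨e⟩⟩ := exists_iso_singleFunctor_obj_of_isGE_of_isLE N 0
  obtain ⟨f', hf'⟩ := (singleFunctor A 0).map_surjective (f ≫ e.hom)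
  obtain ⟨g', hg'⟩ := (singleFunctor A 0).map_surjective (e.inv ≫ g)
  have hw : f' ≫ g' = 0 := (singleFunctor A 0).map_injective (by
    rw [Functor.map_comp, hf', hg', Functor.map_zero, Category.assoc, e.hom_inv_id_assoc, T.comp₁₂])
  have hmono : Mono f' := Preadditive.mono_of_cancel_zero _ fun {Z} a ha => by
    apply (singleFunctor A 0).map_injective
    have h0 : (singleFunctor A 0).map a ≫ f = 0 := by
      rw [← cancel_mono e.hom, Category.assoc, ← hf', ← Functor.map_comp, ha, Functor.map_zero,
        zero_comp]
    obtain ⟨b, hb⟩ := T.inv_rot.lift₂ _ h0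
    rw [hb, homZero_neg Z X (c := -1) (by lia) b, zero_comp, Functor.map_zero]
  have hepi : Epi g' := Preadditive.epi_of_cancel_zero _ fun {Z} a ha => by
    apply (singleFunctor A 0).map_injective
    have h0 : g ≫ (singleFunctor A 0).map a = 0 := by
      rw [← cancel_epi e.inv, ← Category.assoc, ← hg', ← Functor.map_comp, ha, Functor.map_zero,
        comp_zero]
    obtain ⟨b, hb⟩ := T.desc₃ _ h0
    rw [hb, (homZero_shift_left_iff (-1) (by lia)).2 (homZero_neg Y Z (by lia)) b, comp_zero,
      Functor.map_zero]
  refine ⟨E, f', g', hw, ⟨ShortComplex.exact_of_f_is_kernel _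
    (KernelFork.IsLimit.ofι' _ _ fun {Z} a ha => ?_)⟩, ?_⟩
  · have h0 : ((singleFunctor A 0).map a ≫ e.inv) ≫ g = 0 := by
      dsimp at ha
      rw [Category.assoc, ← hg', ← Functor.map_comp, ha, Functor.map_zero]
    have ex : ∃ b : Z ⟶ Y, b ≫ f' = a := by
      obtain ⟨b, hb⟩ := T.lift₂ _ h0
      obtain ⟨b, rfl⟩ := (singleFunctor A 0).map_surjective b
      refine ⟨b, (singleFunctor A 0).map_injective ?_⟩
      rw [Functor.map_comp, hf', ← Category.assoc, ← hb, Category.assoc, e.inv_hom_id,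
        Category.comp_id]
    exact ⟨ex.choose, ex.choose_spec⟩
  · rw [hg', Category.assoc, T.comp₂₃, comp_zero]

lemma epi_map_of_natIso {C : Type u} [Category.{v} C] {D : Type u'} [Category.{v'} D] {F G : C ⥤ D}
    (e : F ≅ G) {X Y : C} (f : X ⟶ Y) (h : Epi (F.map f)) : Epi (G.map f) :=
  ((MorphismProperty.epimorphisms D).arrow_mk_iso_iff
    (Arrow.isoMk (e.app X) (e.app Y) (e.hom.naturality f).symm)).1 h

lemma epi_of_epi_coh_map {X Y : A} (g : X ⟶ Y)
    (h : Epi ((homologyFunctor A 0).map ((singleFunctor A 0).map g))) : Epi g :=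
  epi_map_of_natIso (singleFunctorCompHomologyFunctorIso A 0) g h

/-- An object of nonpositive cohomological amplitude receives a morphism from an object of the
heart which is an epimorphism on the cohomology of degree `0`. -/
lemma exists_epi_coh_zero (N : DerivedCategory A) [N.IsLE 0] :
    ∃ (W : A) (φ : sg W ⟶ N), Epi ((homologyFunctor A 0).map φ) := by
  -- if `N` is represented by a complex `K` in nonpositive degrees, take `W = K⁰`
  obtain ⟨K, hK, ⟨e⟩⟩ := N.exists_iso_Q_obj_of_isLE 0
  have hd : ∀ j, K.d 0 j = 0 := fun j => by
    by_cases hj : 0 + 1 = j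
    · exact (K.isZero_of_isStrictlyLE 0 j (by lia)).eq_of_tgt _ _
    · exact K.shape _ _ hj
  let ψ : (HomologicalComplex.single A (ComplexShape.up ℤ) 0).obj (K.X 0) ⟶ K :=
    HomologicalComplex.mkHomFromSingle (𝟙 (K.X 0)) (fun j _ => by rw [hd, comp_zero])
  have hψ : Epi (HomologicalComplex.homologyMap ψ 0) := by
    have h1 : Epi (HomologicalComplex.cyclesMap ψ 0) := by
      have : IsIso (K.iCycles 0) := K.isIso_iCycles 0 1 (by simp) (hd 1)
      have h2 : Epi (HomologicalComplex.cyclesMap ψ 0 ≫ K.iCycles 0) := by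
        rw [HomologicalComplex.cyclesMap_i, HomologicalComplex.mkHomFromSingle_f]
        have : IsIso (HomologicalComplex.iCycles
            ((HomologicalComplex.single A (ComplexShape.up ℤ) 0).obj (K.X 0)) 0) :=
          HomologicalComplex.isIso_iCycles _ 0 1 (by simp) (by simp)
        infer_instance
      exact ((MorphismProperty.epimorphisms A).cancel_right_of_respectsIso _ (K.iCycles 0)).1 h2
    exact ShortComplex.epi_homologyMap_of_epi_cyclesMap' _ h1
  refine ⟨K.X 0, (singleFunctorIsoCompQ A 0).hom.app _ ≫ Q.map ψ ≫ e.inv, ?_⟩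
  have h3 : Epi ((homologyFunctor A 0).map (Q.map ψ)) :=
    epi_map_of_natIso (homologyFunctorFactors A 0).symm ψ hψ
  rw [Functor.map_comp, Functor.map_comp]
  have h4 : Epi ((homologyFunctor A 0).map (Q.map ψ) ≫ (homologyFunctor A 0).map e.inv) :=
    epi_comp' h3 inferInstance
  exact epi_comp' inferInstance h4

/-- Morphisms of positive degree between objects of the heart are effaceable. -/
lemma exists_epi_comp_eq_zero {X Y : A} {m : ℤ} (hm : 1 ≤ m) (ξ : sg X ⟶ (sg Y)⟦m⟧) :
    ∃ (W : A) (p : W ⟶ X), Epi p ∧ (singleFunctor A 0).map p ≫ ξ = 0 := by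
  -- the fibre `Z⟦-1⟧` of `ξ` has nonpositive amplitude, and `H⁰(Z⟦-1⟧) ⟶ X` is an epimorphism
  obtain ⟨Z, g, h, T⟩ := Dist.exists_cone ξ
  have hX : TStructure.t.IsLE (sg X) 0 := inferInstanceAs (IsLE (sg X) 0)
  have hY : TStructure.t.IsLE (sg Y) 0 := inferInstanceAs (IsLE (sg Y) 0)
  have hX' := TStructure.t.isLE_shift (sg X) 0 1 (-1)
  have hY' := TStructure.t.isLE_shift (sg Y) 0 m (-m)
  have hY'' := TStructure.t.isLE_of_le ((sg Y)⟦m⟧) (-m) (-1)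
  have hZ : IsLE Z (-1) := (isLE_iff _ _).2 fun j hj =>
    isZero_coh₂ T.rot j (isZero_of_isLE (hX := hY'') _ (-1) _ hj)
      (isZero_of_isLE (hX := hX') _ (-1) _ hj)
  have : IsLE (Z⟦(-1 : ℤ)⟧) 0 := by
    have : TStructure.t.IsLE Z (-1) := hZ
    exact TStructure.t.isLE_shift Z (-1) (-1) 0
  obtain ⟨W, φ, hφ⟩ := exists_epi_coh_zero (Z⟦(-1 : ℤ)⟧)
  have T' := T.inv_rot
  generalize hu : -h⟦(-1 : ℤ)⟧' ≫
    (shiftEquiv (DerivedCategory A) (1 : ℤ)).unitIso.inv.app (sg X) = u at T'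
  have hu' : Epi ((homologyFunctor A 0).map u) :=
    (HomologySequence.epi_homologyMap_mor₁_iff _ T' 0).2
      ((isZero_of_isLE (hX := hY'') _ (-1) 0 (by lia)).eq_of_tgt _ _)
  obtain ⟨p, hp⟩ := (singleFunctor A 0).map_surjective (φ ≫ u)
  refine ⟨W, p, epi_of_epi_coh_map p ?_, ?_⟩
  · rw [hp, Functor.map_comp]
    infer_instance
  · rw [hp, Category.assoc, T'.comp₁₂, comp_zero]

end Heart

/-! ### Highest weight categories: vanishing of extensions -/

section HW

variable {A : Type u} [Category.{v} A] [Abelian A] {Λ : Type x} {S : Type y}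

/-- The iterated extensions of the simple objects `L μ` with `wt μ ∈ T`. -/
def WeightData.filt (W : WeightData A Λ) (wt : Λ → S) (T : Set S) : A → Prop :=
  ExtClosure (fun X => ∃ μ, wt μ ∈ T ∧ X = W.L μ)

/-- The iterated extensions of the standard objects `Δ μ` with `wt μ ∈ T`. -/
def WeightData.stdFilt (W : WeightData A Λ) (wt : Λ → S) (T : Set S) : A → Prop :=
  ExtClosure (fun X => ∃ μ, wt μ ∈ T ∧ X = W.std μ)

/-- The axioms of a highest weight category which only involve `Hom` and `Ext¹`. The set `Λ`
indexes the simple objects; the order is on a poset `S` of weights, and `wt : Λ → S` need not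
be injective (for a graded category, `Λ = S × ℤ`). The axioms `std_split` and `costd_split` say that
`Ext¹(Δ l, L m)` and `Ext¹(L m, ∇ l)` vanish unless `wt l < wt m`. -/
structure IsHW [PartialOrder S] (k : Type w') [Field k] [Linear k A] (W : WeightData A Λ)
    (wt : Λ → S) : Prop where
  finite_Iic : ∀ s : S, (Set.Iic s).Finite
  simple : ∀ l, Simple (W.L l)
  hom_simple : ∀ l m, l ≠ m → HomZero (W.L l) (W.L m)
  end_simple : ∀ l (f : W.L l ⟶ W.L l), ∃ c : k, f = c • 𝟙 _
  epi_π : ∀ l, Epi (W.π l)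
  mono_i : ∀ l, Mono (W.i l)
  kernel_mem : ∀ l, W.filt wt (Set.Iio (wt l)) (kernel (W.π l))
  cokernel_mem : ∀ l, W.filt wt (Set.Iio (wt l)) (cokernel (W.i l))
  hom_std : ∀ l m, l ≠ m → HomZero (W.std l) (W.L m)
  hom_costd : ∀ l m, l ≠ m → HomZero (W.L m) (W.costd l)
  std_split : ∀ l m, ¬ wt l < wt m → ∀ {E : A} (f : W.L m ⟶ E) (g : E ⟶ W.std l)
    (w : f ≫ g = 0), (ShortComplex.mk f g w).ShortExact → ∃ s, s ≫ g = 𝟙 _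
  costd_split : ∀ l m, ¬ wt l < wt m → ∀ {E : A} (f : W.costd l ⟶ E) (g : E ⟶ W.L m)
    (w : f ≫ g = 0), (ShortComplex.mk f g w).ShortExact → ∃ s, s ≫ g = 𝟙 _
  filt_univ : ∀ X : A, W.filt wt Set.univ X

/-- An epimorphism which is a composition of epimorphisms whose kernels are standard objects
with weight in `T`. -/
inductive Cov (W : WeightData A Λ) (wt : Λ → S) (T : Set S) : ∀ {P Q : A}, (P ⟶ Q) → Prop
  | id (Q : A) : Cov W wt T (𝟙 Q)
  | step {l : Λ} (hl : wt l ∈ T) {P' P Q : A} (i : W.std l ⟶ P') (q : P' ⟶ P) (p : P ⟶ Q)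
      (w : i ≫ q = 0) (hS : (ShortComplex.mk i q w).ShortExact) (hp : Cov W wt T p) :
      Cov W wt T (q ≫ p)

/-- Every epimorphism from an object of `A_T` to a standard object of `A_T` is refined by an
epimorphism whose kernel has a filtration by standard objects of `A_T`. -/
def Refines (W : WeightData A Λ) (wt : Λ → S) (T : Set S) : Prop :=
  ∀ l, wt l ∈ T → ∀ {X : A} (f : X ⟶ W.std l), Epi f → W.filt wt T X →
    ∃ (P : A) (p : P ⟶ W.std l) (v : P ⟶ X), Cov W wt T p ∧ v ≫ f = p

section

variable {W : WeightData A Λ} {wt : Λ → S} {T : Set S}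

lemma WeightData.filt_mono {T T' : Set S} (h : T ⊆ T') {X : A} (hX : W.filt wt T X) :
    W.filt wt T' X :=
  ExtClosure.mono (fun _ ⟨μ, hμ, e⟩ => .of ⟨μ, h hμ, e⟩) hX

lemma Cov.comp {P Q : A} {p : P ⟶ Q} (hp : Cov W wt T p) {R : A} {q : Q ⟶ R} (hq : Cov W wt T q) :
    Cov W wt T (p ≫ q) := by
  induction hp with
  | id Q => rwa [Category.id_comp]
  | step hl i r p w hS hp ih =>
    rw [Category.assoc]
    exact .step hl i r _ w hS (ih hq)

lemma Cov.stdFilt {P Q : A} {p : P ⟶ Q} (hp : Cov W wt T p) (hQ : W.stdFilt wt T Q) :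
    W.stdFilt wt T P := by
  induction hp with
  | id Q => exact hQ
  | step hl i q p w hS hp ih => exact .ext hS (.of ⟨_, hl, rfl⟩) (ih hQ)

section

variable [HasDerivedCategory.{w} A]

open DerivedCategory

/-- Morphisms from `W.stdFilt wt T` to `N` are effaceable by the epimorphisms `Cov`. -/
def Eff (W : WeightData A Λ) (wt : Λ → S) (T : Set S) (N : DerivedCategory A) : Prop :=
  ∀ ⦃Q : A⦄, W.stdFilt wt T Q → ∀ η : sg Q ⟶ N,
    ∃ (P : A) (p : P ⟶ Q), Cov W wt T p ∧ (singleFunctor A 0).map p ≫ η = 0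

lemma Eff.of_dist {X Y Z : DerivedCategory A} {f : X ⟶ Y} {g : Y ⟶ Z} {h : Z ⟶ X⟦(1 : ℤ)⟧}
    (D : Dist f g h) (hX : Eff W wt T X) (hZ : Eff W wt T Z) : Eff W wt T Y := by
  intro Q hQ η
  obtain ⟨P, p, hp, h0⟩ := hZ hQ (η ≫ g)
  obtain ⟨b, hb⟩ := D.lift₂ ((singleFunctor A 0).map p ≫ η) (by rw [Category.assoc, h0])
  obtain ⟨P', p', hp', h1⟩ := hX (hp.stdFilt hQ) b
  refine ⟨P', p' ≫ p, hp'.comp hp, ?_⟩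
  rw [Functor.map_comp, Category.assoc, hb, reassoc_of% h1, zero_comp]

lemma Eff.of_homZero {N : DerivedCategory A} (h : ∀ Q, W.stdFilt wt T Q → HomZero (sg Q) N) :
    Eff W wt T N :=
  fun Q hQ η => ⟨Q, 𝟙 Q, .id Q, by rw [h Q hQ η, comp_zero]⟩

/-- If the standard objects have no morphisms to `N`, then a morphism `Q ⟶ N⟦1⟧` which vanishes
on a covering of `Q` is zero: it factors through the shifts of the kernels. -/
lemma Cov.eq_zero {P Q : A}
    {p : P ⟶ Q} (hp : Cov W wt T p) {N : DerivedCategory A}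
    (hN : ∀ l, HomZero (sg (W.std l)) N) (ξ : sg Q ⟶ N⟦(1 : ℤ)⟧)
    (h : (singleFunctor A 0).map p ≫ ξ = 0) : ξ = 0 := by
  induction hp with
  | id Q => rwa [CategoryTheory.Functor.map_id, Category.id_comp] at h
  | step hl i q p w hS hp ih =>
    refine ih ξ ?_
    rw [Functor.map_comp, Category.assoc] at h
    obtain ⟨b, hb⟩ := (dist_of_shortExact hS).desc₃ _ h
    rw [hb, (homZero_map_iff (shiftFunctor _ (1 : ℤ))).2 (hN _) b, comp_zero]

end

end

namespace IsHW

variable [PartialOrder S] {k : Type w'} [Field k] [Linear k A] {W : WeightData A Λ} {wt : Λ → S}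
  (H : IsHW k W wt)

include H

lemma filt_std (l : Λ) : W.filt wt (Set.Iic (wt l)) (W.std l) := by
  have := H.epi_π l
  exact .ext (shortExact_kernel (W.π l))
    (WeightData.filt_mono Set.Iio_subset_Iic_self (H.kernel_mem l)) (.of ⟨l, le_rfl, rfl⟩)

lemma filt_costd (l : Λ) : W.filt wt (Set.Iic (wt l)) (W.costd l) := by
  have := H.mono_i l
  exact .ext (shortExact_cokernel (W.i l)) (.of ⟨l, le_rfl, rfl⟩)
    (WeightData.filt_mono Set.Iio_subset_Iic_self (H.cokernel_mem l))

lemma wellFoundedLT : WellFoundedLT S := by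
  refine ⟨Subrelation.wf (r := InvImage (· < ·) fun s : S => (Set.Iic s).ncard) ?_
    (InvImage.wf _ wellFounded_lt)⟩
  intro a b hab
  exact Set.ncard_lt_ncard (Set.Iic_ssubset_Iic.2 hab) (H.finite_Iic b)

lemma isSerreClass_filt (T : Set S) :
    ObjectProperty.IsSerreClass (W.filt wt T : ObjectProperty A) :=
  isSerreClass_extClosure (by rintro _ ⟨μ, -, rfl⟩; exact H.simple μ)

lemma filt_of_mono {T : Set S} {X Y : A} (f : X ⟶ Y) [Mono f] (hY : W.filt wt T Y) :
    W.filt wt T X :=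
  ExtClosure.prop_of_mono (by rintro _ ⟨μ, -, rfl⟩; exact H.simple μ) hY f

section

variable [HasDerivedCategory.{w} A]

open DerivedCategory

lemma ext_one_std_simple {l m : Λ} (h : ¬ wt l < wt m) :
    HomZero (sg (W.std l)) ((sg (W.L m))⟦(1 : ℤ)⟧) := fun ξ => by
  obtain ⟨E, f, g, hfg, hS, h0⟩ := exists_extension ξ
  obtain ⟨s, hs⟩ := H.std_split l m h f g hfg hS
  rw [← Category.id_comp ξ, ← CategoryTheory.Functor.map_id, ← hs, Functor.map_comp,
    Category.assoc, h0, comp_zero]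

lemma ext_one_simple_costd {l m : Λ} (h : ¬ wt l < wt m) :
    HomZero (sg (W.L m)) ((sg (W.costd l))⟦(1 : ℤ)⟧) := fun ξ => by
  obtain ⟨E, f, g, hfg, hS, h0⟩ := exists_extension ξ
  obtain ⟨s, hs⟩ := H.costd_split l m h f g hfg hS
  rw [← Category.id_comp ξ, ← CategoryTheory.Functor.map_id, ← hs, Functor.map_comp,
    Category.assoc, h0, comp_zero]

/-- Extensions of `Δ l` by `∇ m` vanish: if `wt l < wt m`, by looking at the composition factors
of `Δ l`, and otherwise by looking at those of `∇ m`. -/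
lemma ext_one_std_costd (l m : Λ) : HomZero (sg (W.std l)) ((sg (W.costd m))⟦(1 : ℤ)⟧) := by
  by_cases h : wt l < wt m
  · refine (H.filt_std l).homZero_left ?_
    rintro _ ⟨ν, hν, rfl⟩
    exact H.ext_one_simple_costd fun h' => absurd (h.trans (h'.trans_le hν)) (lt_irrefl _)
  · refine (H.filt_costd m).homZero_right ?_
    rintro _ ⟨ν, hν, rfl⟩
    exact H.ext_one_std_simple fun h' => h (h'.trans_le hν)

/-- Effaceability of extensions of degrees `1` and `2`, by induction on weights: for a simple
object `L l`, the degree `1` case reduces to the kernel of `Δ l ⟶ L l` in degree `2`, and the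
degree `2` case to the cokernel of `L l ⟶ ∇ l` in degree `1`. -/
lemma eff_filt (h₂ : ∀ l m, HomZero (sg (W.std l)) ((sg (W.costd m))⟦(2 : ℤ)⟧)) {T : Set S}
    (hT : IsLowerSet T) {X : A} (hX : W.filt wt T X) :
    Eff W wt T ((sg X)⟦(1 : ℤ)⟧) ∧ Eff W wt T (((sg X)⟦(1 : ℤ)⟧)⟦(1 : ℤ)⟧) := by
  have hfilt : ∀ {T' : Set S}, (∀ l, wt l ∈ T' → Eff W wt T ((sg (W.L l))⟦(1 : ℤ)⟧) ∧
      Eff W wt T (((sg (W.L l))⟦(1 : ℤ)⟧)⟦(1 : ℤ)⟧)) → ∀ X : A, W.filt wt T' X →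
      Eff W wt T ((sg X)⟦(1 : ℤ)⟧) ∧ Eff W wt T (((sg X)⟦(1 : ℤ)⟧)⟦(1 : ℤ)⟧) := by
    intro T' hT' X hX
    induction hX with
    | of h => obtain ⟨l, hl, rfl⟩ := h; exact hT' l hl
    | zero h =>
      exact ⟨.of_homZero fun Q _ =>
          .of_isZero_right (Functor.map_isZero _ (Functor.map_isZero _ h)),
        .of_homZero fun Q _ => .of_isZero_right
          (Functor.map_isZero _ (Functor.map_isZero _ (Functor.map_isZero _ h)))⟩
    | ext hS _ _ h₁ h₃ =>
      obtain ⟨h', T'⟩ := (dist_of_shortExact hS).shift 1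
      obtain ⟨h'', T''⟩ := T'.shift 1
      exact ⟨.of_dist T' h₁.1 h₃.1, .of_dist T'' h₁.2 h₃.2⟩
  have := H.wellFoundedLT
  refine hfilt ?_ X hX
  suffices ∀ s : S, s ∈ T → ∀ l, wt l = s → Eff W wt T ((sg (W.L l))⟦(1 : ℤ)⟧) ∧
      Eff W wt T (((sg (W.L l))⟦(1 : ℤ)⟧)⟦(1 : ℤ)⟧) from fun l hl => this _ hl l rfl
  intro s
  induction s using WellFoundedLT.induction with
  | _ s ih =>
    rintro hs l rfl
    have ih' := hfilt (T' := Set.Iio (wt l)) fun m hm => ih (wt m) hm (hT hm.le hs) m rfl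
    constructor
    · intro Q hQ η
      have := H.epi_π l
      obtain ⟨h', D⟩ := (dist_of_shortExact (shortExact_kernel (W.π l))).shift 1
      obtain ⟨P, p, hp, h0⟩ := (ih' _ (H.kernel_mem l)).2 hQ (η ≫ h')
      obtain ⟨b, hb⟩ := D.lift₃ ((singleFunctor A 0).map p ≫ η) (by rw [Category.assoc, h0])
      -- `η` comes from a morphism `b : P ⟶ Δ l⟦1⟧`, which vanishes on the corresponding
      -- extension of `P` by `Δ l`
      obtain ⟨E, f, g, hfg, hS, h1⟩ := exists_extension b
      refine ⟨E, g ≫ p, .step hs f g p hfg hS hp, ?_⟩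
      rw [Functor.map_comp, Category.assoc, hb, reassoc_of% h1, zero_comp]
    · intro Q hQ η
      have := H.mono_i l
      obtain ⟨h', D⟩ := (dist_of_shortExact (shortExact_cokernel (W.i l))).shift 1
      -- since `Ext²(Q, ∇ l) = 0`, the class `η` comes from `Ext¹(Q, ∇ l / L l)`
      have hz : HomZero (sg Q) (((sg (W.costd l))⟦(1 : ℤ)⟧)⟦(1 : ℤ)⟧) := by
        refine ExtClosure.homZero_left hQ ?_
        rintro _ ⟨m, -, rfl⟩
        exact (h₂ m l).congr_right ((shiftFunctorAdd' _ (1 : ℤ) (1 : ℤ) 2 (by lia)).app _)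
      obtain ⟨b, hb⟩ := D.lift₁ η (hz _)
      obtain ⟨P, p, hp, h0⟩ := (ih' _ (H.cokernel_mem l)).1 hQ b
      exact ⟨P, p, hp, by rw [hb, reassoc_of% h0, zero_comp]⟩

/-- If `Ext²` between standard and costandard objects vanishes, then the class of the extension
given by an epimorphism `X ⟶ Δ l` is killed by an epimorphism `P ⟶ Δ l` as in `Cov`, which
therefore lifts to `X`. For a lower set `T`, no object outside `A_T` is needed. -/
lemma refines (h₂ : ∀ l m, HomZero (sg (W.std l)) ((sg (W.costd m))⟦(2 : ℤ)⟧)) {T : Set S}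
    (hT : IsLowerSet T) : Refines W wt T := by
  intro l hl X f _ hX
  obtain ⟨P, p, hp, h0⟩ := (H.eff_filt h₂ hT (H.filt_of_mono (kernel.ι f) hX)).1
    (ExtClosure.of ⟨l, hl, rfl⟩) (shortExact_kernel f).singleδ
  obtain ⟨b, hb⟩ := (dist_of_shortExact (shortExact_kernel f)).lift₃ _ h0
  obtain ⟨v, rfl⟩ := (singleFunctor A 0).map_surjective b
  exact ⟨P, p, v, hp, (singleFunctor A 0).map_injective (by rw [Functor.map_comp]; exact hb.symm)⟩

end

end IsHW

section

variable [PartialOrder S] {k : Type w'} [Field k] [Linear k A] {W : WeightData A Λ} {wt : Λ → S}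
  (H : IsHW k W wt) (R : Refines W wt Set.univ) [HasDerivedCategory.{w} A]

namespace IsHW

open DerivedCategory

include H R

/-- `Extⁿ(Δ l, ∇ m) = 0` for `n ≠ 0`. A class of degree `n + 1 ≥ 2` vanishes on some epimorphism to
`Δ l`, hence on one whose kernel is filtered by standard objects; by induction, these have no
extensions of degree `n` by `∇ m`, so that the class is zero. -/
lemma ext_std_costd (l m : Λ) {n : ℤ} (hn : n ≠ 0) :
    HomZero (sg (W.std l)) ((sg (W.costd m))⟦n⟧) := by
  rcases hn.lt_or_gt with hn' | hn'
  · exact homZero_neg _ _ hn'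
  · obtain ⟨n, rfl⟩ : ∃ n' : ℕ, n = n' + 1 := ⟨(n - 1).toNat, by lia⟩
    clear hn hn'
    induction n generalizing l m with
    | zero => exact H.ext_one_std_costd l m
    | succ n ih =>
      intro ξ
      obtain ⟨X, f, hf, h0⟩ := exists_epi_comp_eq_zero (by lia) ξ
      obtain ⟨P, p, v, hp, rfl⟩ := R l trivial f hf (H.filt_univ X)
      have e := (shiftFunctorAdd' (DerivedCategory A) (n + 1 : ℤ) 1 ((n + 1 : ℕ) + 1) (by lia)).app
        (sg (W.costd m))
      rw [← cancel_mono e.hom, zero_comp]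
      refine hp.eq_zero (fun l => ih l m) _ ?_
      rw [Functor.map_comp, Category.assoc, reassoc_of% h0, zero_comp, comp_zero]

/-- `Extⁿ(Δ l, L m) = 0` for `n ≠ 0`, unless `wt l < wt m`. -/
lemma ext_std_simple {l m : Λ} (h : ¬ wt l < wt m) {n : ℤ} (hn : n ≠ 0) :
    HomZero (sg (W.std l)) ((sg (W.L m))⟦n⟧) := by
  rcases hn.lt_or_gt with hn' | hn'
  · exact homZero_neg _ _ hn'
  · obtain ⟨n, rfl⟩ : ∃ n' : ℕ, n = n' + 1 := ⟨(n - 1).toNat, by lia⟩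
    clear hn hn'
    induction n generalizing l m with
    | zero => exact H.ext_one_std_simple h
    | succ n ih =>
      have := H.mono_i m
      refine (dist_of_shortExact (shortExact_cokernel (W.i m))).homZero₁_right_shift (n + 1) _
        (by lia) ?_ (H.ext_std_costd R l m (by lia))
      refine (H.cokernel_mem m).homZero_right ?_
      rintro _ ⟨ν, hν, rfl⟩
      exact ih fun h' => h (h'.trans hν)

/-- `Extⁿ(L m, ∇ l) = 0` for `n ≠ 0`, unless `wt l < wt m`. -/
lemma ext_simple_costd {l m : Λ} (h : ¬ wt l < wt m) {n : ℤ} (hn : n ≠ 0) :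
    HomZero (sg (W.L m)) ((sg (W.costd l))⟦n⟧) := by
  rcases hn.lt_or_gt with hn' | hn'
  · exact homZero_neg _ _ hn'
  · obtain ⟨n, rfl⟩ : ∃ n' : ℕ, n = n' + 1 := ⟨(n - 1).toNat, by lia⟩
    clear hn hn'
    induction n generalizing m with
    | zero => exact H.ext_one_simple_costd h
    | succ n ih =>
      have := H.epi_π m
      refine (dist_of_shortExact (shortExact_kernel (W.π m))).homZero₃_left
        ((homZero_shift_iff (n + 1) (by lia)).2 ?_) (H.ext_std_costd R m l (by lia))
      refine (H.kernel_mem m).homZero_left ?_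
      rintro _ ⟨ν, hν, rfl⟩
      exact ih fun h' => h (h'.trans hν)

/-- `Extⁿ(Δ l, Δ m) = 0` unless `wt l < wt m`, or `l = m` and `n = 0`. -/
lemma ext_std_std {l m : Λ} (h : ¬ wt l < wt m) {n : ℤ} (hn : l ≠ m ∨ n ≠ 0) :
    HomZero (sg (W.std l)) ((sg (W.std m))⟦n⟧) := by
  have aux : ∀ ν, ¬ wt l < wt ν → (l ≠ ν ∨ n ≠ 0) →
      HomZero (sg (W.std l)) ((sg (W.L ν))⟦n⟧) := fun ν hν hn => by
    by_cases h0 : n = 0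
    · subst h0
      exact homZero_sg_shift_zero (H.hom_std l ν (by simpa using hn))
    · exact H.ext_std_simple R hν h0
  have := H.epi_π m
  refine (dist_of_shortExact (shortExact_kernel (W.π m))).homZero₂_right_shift n ?_ (aux m h hn)
  refine (H.kernel_mem m).homZero_right ?_
  rintro _ ⟨ν, hν, rfl⟩
  refine aux ν (fun h' => h (h'.trans hν)) (or_iff_not_imp_left.2 fun e => ?_)
  rw [not_not] at e
  subst e
  exact absurd hν h

end IsHW

end

namespace IsHW

variable [PartialOrder S] {k : Type w'} [Field k] [Linear k A] {W : WeightData A Λ} {wt : Λ → S}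
  (H : IsHW k W wt)

include H

lemma hom_std_of_filt {l : Λ} {T : Set S} (hl : wt l ∉ T) {X : A} (hX : W.filt wt T X) :
    HomZero (W.std l) X := by
  induction hX with
  | of h =>
    obtain ⟨m, hm, rfl⟩ := h
    exact H.hom_std l m fun e => hl (e ▸ hm)
  | zero h => exact .of_isZero_right h
  | @ext S' hS _ _ h₁ h₃ =>
    intro f
    have := hS.mono_f
    have e : f ≫ S'.g = 0 := h₃ _
    rw [← hS.exact.lift_f f e, h₁ (hS.exact.lift f e), zero_comp]

lemma hom_costd_of_filt {l : Λ} {T : Set S} (hl : wt l ∉ T) {X : A} (hX : W.filt wt T X) :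
    HomZero X (W.costd l) := by
  induction hX with
  | of h =>
    obtain ⟨m, hm, rfl⟩ := h
    exact H.hom_costd l m fun e => hl (e ▸ hm)
  | zero h => exact .of_isZero_left h
  | @ext S' hS _ _ h₁ h₃ =>
    intro f
    have := hS.epi_g
    have e : S'.f ≫ f = 0 := h₁ _
    rw [← hS.exact.g_desc f e, h₃ (hS.exact.desc f e), comp_zero]

lemma hom_filt_simple {l : Λ} {T : Set S} (hl : wt l ∉ T) {X : A} (hX : W.filt wt T X) :
    HomZero X (W.L l) := by
  have := H.mono_i l
  intro f
  rw [← cancel_mono (W.i l), H.hom_costd_of_filt hl hX (f ≫ W.i l), zero_comp]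

lemma hom_std_simple_eq (l : Λ) (f : W.std l ⟶ W.L l) : ∃ c : k, f = c • W.π l := by
  have := H.epi_π l
  obtain ⟨g, hg⟩ : ∃ g : W.L l ⟶ W.L l, W.π l ≫ g = f :=
    ⟨_, (shortExact_kernel (W.π l)).exact.g_desc f
      (H.hom_filt_simple (show wt l ∉ Set.Iio (wt l) from lt_irrefl _) (H.kernel_mem l) _)⟩
  obtain ⟨c, rfl⟩ := H.end_simple l g
  exact ⟨c, by rw [← hg, Linear.comp_smul, Category.comp_id]⟩

/-- A nonzero morphism `Δ l ⟶ ∇ m` would factor through the top `L l` of the source or through the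
socle `L m` of the target, according to which of the two weights is not the larger one. -/
lemma hom_std_costd (l m : Λ) (h : l ≠ m) : HomZero (W.std l) (W.costd m) := by
  intro f
  have := H.mono_i m
  by_cases hlm : wt l < wt m
  · have := H.epi_π l
    obtain ⟨g, hg⟩ : ∃ g : W.L l ⟶ W.costd m, W.π l ≫ g = f :=
      ⟨_, (shortExact_kernel (W.π l)).exact.g_desc f (H.hom_costd_of_filt
        (show wt m ∉ Set.Iio (wt l) from fun h' => lt_irrefl _ (hlm.trans h')) (H.kernel_mem l) _)⟩
    rw [← hg, H.hom_costd m l h.symm g, comp_zero]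
  · obtain ⟨g, hg⟩ : ∃ g : W.std l ⟶ W.L m, g ≫ W.i m = f :=
      ⟨_, (shortExact_cokernel (W.i m)).exact.lift_f f
        (H.hom_std_of_filt (show wt l ∉ Set.Iio (wt m) from hlm) (H.cokernel_mem m) _)⟩
    rw [← hg, H.hom_std l m h g, zero_comp]

lemma hom_std_costd_eq (l : Λ) (f : W.std l ⟶ W.costd l) : ∃ c : k, f = c • (W.π l ≫ W.i l) := by
  have := H.mono_i l
  obtain ⟨g, hg⟩ : ∃ g : W.std l ⟶ W.L l, g ≫ W.i l = f :=
    ⟨_, (shortExact_cokernel (W.i l)).exact.lift_f f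
      (H.hom_std_of_filt (show wt l ∉ Set.Iio (wt l) from lt_irrefl _) (H.cokernel_mem l) _)⟩
  obtain ⟨c, rfl⟩ := H.hom_std_simple_eq l g
  exact ⟨c, by rw [← hg, Linear.smul_comp]⟩

lemma π_comp_i_ne_zero (l : Λ) : W.π l ≫ W.i l ≠ 0 := by
  have := H.mono_i l
  have := H.epi_π l
  have := H.simple l
  intro h
  apply id_nonzero (W.L l)
  rw [← cancel_mono (W.i l), ← cancel_epi (W.π l)]
  simpa using h

lemma end_std (l : Λ) (f : W.std l ⟶ W.std l) : ∃ c : k, f = c • 𝟙 _ := by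
  have := H.epi_π l
  obtain ⟨c, hc⟩ := H.hom_std_simple_eq l (f ≫ W.π l)
  refine ⟨c, sub_eq_zero.1 ?_⟩
  have h0 : (f - c • 𝟙 _) ≫ W.π l = 0 := by
    rw [Preadditive.sub_comp, hc, Linear.smul_comp, Category.id_comp, sub_self]
  have h1 := H.hom_std_of_filt (show wt l ∉ Set.Iio (wt l) from lt_irrefl _) (H.kernel_mem l)
    (kernel.lift _ _ h0)
  rw [← kernel.lift_ι _ _ h0, h1, zero_comp]

end IsHW

end HW

/-! ### Dévissage in the bounded derived category of a highest weight category -/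

section TriangulatedProperty

open Pretriangulated

variable {C : Type u} [Category.{v} C] [Preadditive C] [HasZeroObject C] [HasShift C ℤ]
  [∀ n : ℤ, (shiftFunctor C n).Additive] [Pretriangulated C]

/-- A property of objects which defines a strictly full triangulated subcategory. -/
structure IsTri (P : C → Prop) : Prop where
  zero : ∀ X, IsZero X → P X
  of_iso : ∀ {X Y : C}, (X ≅ Y) → P X → P Y
  shift : ∀ (n : ℤ) (X : C), P X → P (X⟦n⟧)
  ext : ∀ {X Y Z : C} {f : X ⟶ Y} {g : Y ⟶ Z} {h : Z ⟶ X⟦(1 : ℤ)⟧}, Dist f g h → P X → P Z → P Y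

namespace IsTri

variable {P : C → Prop} (hP : IsTri P)
  {X Y Z : C} {f : X ⟶ Y} {g : Y ⟶ Z} {h : Z ⟶ X⟦(1 : ℤ)⟧} (T : Dist f g h)

include hP T

lemma third (h₁ : P X) (h₂ : P Y) : P Z := hP.ext T.rot h₂ (hP.shift 1 _ h₁)

lemma first (h₂ : P Y) (h₃ : P Z) : P X := hP.ext T.inv_rot (hP.shift (-1) _ h₃) h₂

end IsTri

lemma IsTri.isClosedUnderIsomorphisms {P : C → Prop} (hP : IsTri P) :
    ObjectProperty.IsClosedUnderIsomorphisms (P : ObjectProperty C) :=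
  ⟨fun e h => hP.of_iso e h⟩

lemma IsTri.homFinite_left (k : Type y) [Field k] [Linear k C]
    [∀ n : ℤ, (shiftFunctor C n).Linear k] (N : C) :
    IsTri (fun M : C => ∀ n : ℤ, Module.Finite k (M⟦n⟧ ⟶ N)) where
  zero X hX n := by
    have : Subsingleton (X⟦n⟧ ⟶ N) := ⟨fun f g => (Functor.map_isZero _ hX).eq_of_src f g⟩
    infer_instance
  of_iso e h n := by
    have := h n
    exact Module.Finite.equiv (Linear.homCongr k ((shiftFunctor C n).mapIso e) (Iso.refl N))
  shift n X h m := by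
    have := h (n + m)
    exact Module.Finite.equiv (Linear.homCongr k ((shiftFunctorAdd C n m).app X) (Iso.refl N))
  ext {X Y Z f g h} T h₁ h₃ n := by
    have := h₁ n
    have := h₃ n
    obtain ⟨h', T'⟩ := T.shift n
    have : IsNoetherian k (Y⟦n⟧ ⟶ N) := isNoetherian_of_range_eq_ker
      (Linear.leftComp k N (n.negOnePow • g⟦n⟧')) (Linear.leftComp k N (n.negOnePow • f⟦n⟧')) (by
        ext a
        simp only [LinearMap.mem_range, LinearMap.mem_ker, Linear.leftComp_apply]
        refine ⟨?_, fun h => ?_⟩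
        · rintro ⟨b, rfl⟩
          rw [← Category.assoc, T'.comp₁₂, zero_comp]
        · obtain ⟨b, rfl⟩ := T'.desc₂ a h
          exact ⟨b, rfl⟩)
    infer_instance

lemma IsTri.homFinite_right (k : Type y) [Field k] [Linear k C]
    [∀ n : ℤ, (shiftFunctor C n).Linear k] (M : C) :
    IsTri (fun N : C => ∀ n : ℤ, Module.Finite k (M ⟶ N⟦n⟧)) where
  zero X hX n := by
    have : Subsingleton (M ⟶ X⟦n⟧) := ⟨fun f g => (Functor.map_isZero _ hX).eq_of_tgt f g⟩
    infer_instance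
  of_iso e h n := by
    have := h n
    exact Module.Finite.equiv (Linear.homCongr k (Iso.refl M) ((shiftFunctor C n).mapIso e))
  shift n X h m := by
    have := h (n + m)
    exact Module.Finite.equiv (Linear.homCongr k (Iso.refl M) ((shiftFunctorAdd C n m).app X))
  ext {X Y Z f g h} T h₁ h₃ n := by
    have := h₁ n
    have := h₃ n
    obtain ⟨h', T'⟩ := T.shift n
    have : IsNoetherian k (M ⟶ Y⟦n⟧) := isNoetherian_of_range_eq_ker
      (Linear.rightComp k M (n.negOnePow • f⟦n⟧')) (Linear.rightComp k M (n.negOnePow • g⟦n⟧')) (by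
        ext a
        simp only [LinearMap.mem_range, LinearMap.mem_ker, Linear.rightComp_apply]
        refine ⟨?_, fun h => ?_⟩
        · rintro ⟨b, rfl⟩
          rw [Category.assoc, T'.comp₁₂, comp_zero]
        · obtain ⟨b, rfl⟩ := T'.lift₂ a h
          exact ⟨b, rfl⟩)
    infer_instance

/-- The objects with nonzero morphisms from only finitely many of the shifts `X l⟦m⟧`. -/
lemma IsTri.finite_hom {Λ : Type x} (X : Λ → C) :
    IsTri (fun M : C => {p : Λ × ℤ | ¬ HomZero ((X p.1)⟦p.2⟧) M}.Finite) where
  zero M hM := by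
    convert Set.finite_empty
    ext p
    simpa using! HomZero.of_isZero_right hM
  of_iso e h := h.subset fun p hp hp' => hp (hp'.congr_right e)
  shift n M h := by
    refine (h.image (fun p => (p.1, p.2 + n))).subset fun p hp =>
      ⟨(p.1, p.2 - n), fun hz => hp ?_, by simp⟩
    exact (((homZero_map_iff (shiftFunctor C n)).2 hz)).congr_left
      ((shiftFunctorAdd' C (p.2 - n) n p.2 (by lia)).app _).symm
  ext T h₁ h₃ := by
    refine (h₁.union h₃).subset fun p hp => ?_
    by_contra hn
    rw [Set.mem_union, not_or] at hn
    simp only [Set.mem_ofPred_eq, not_not] at hn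
    exact hp (T.homZero₂_right hn.1 hn.2)

end TriangulatedProperty

section Support

open DerivedCategory

variable {A : Type u} [Category.{v} A] [Abelian A] [HasDerivedCategory.{w} A] {Λ : Type x}
  {S : Type y}

/-- The composition factors of the cohomology objects of `M` have their weights in `T`. -/
def WeightData.Supp (W : WeightData A Λ) (wt : Λ → S) (T : Set S) (M : DerivedCategory A) : Prop :=
  ∀ j, W.filt wt T (coh j M)

lemma bdd_isTri : IsTri (Bdd : DerivedCategory A → Prop) where
  zero X hX := (bdd_iff X).2 ⟨0, 0, (isGE_iff _ _).2 fun _ _ => Functor.map_isZero _ hX,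
    (isLE_iff _ _).2 fun _ _ => Functor.map_isZero _ hX⟩
  of_iso e h := ObjectProperty.prop_of_iso Bdd e h
  shift n X h := ObjectProperty.le_shift Bdd n X h
  ext T h₁ h₃ := ObjectProperty.ext_of_isTriangulatedClosed₂ Bdd _ T h₁ h₃

lemma WeightData.supp_sg {W : WeightData A Λ} {wt : Λ → S} {T : Set S} {X : A}
    (hX : W.filt wt T X) : W.Supp wt T (sg X) := fun j => by
  by_cases hj : j = 0
  · subst hj
    exact hX.of_iso ((singleFunctorCompHomologyFunctorIso A 0).app X).symm
  · rcases lt_or_gt_of_ne hj with hj | hj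
    · exact .zero ((sg X).isZero_of_isGE 0 j hj)
    · exact .zero ((sg X).isZero_of_isLE 0 j hj)

lemma WeightData.isZero_of_supp_empty {W : WeightData A Λ} {wt : Λ → S} {M : DerivedCategory A}
    (hM : W.Supp wt ∅ M) : IsZero M := by
  refine isZero_of_coh fun j => ?_
  have hz : ∀ X : A, W.filt wt ∅ X → IsZero X := fun X hX => by
    induction hX with
    | of h => obtain ⟨_, h, _⟩ := h; exact h.elim
    | zero h => exact h
    | ext hS _ _ h₁ h₃ =>
      exact hS.exact.isZero_of_both_zeros (h₁.eq_of_src _ _) (h₃.eq_of_tgt _ _)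
  exact hz _ (hM j)

namespace IsHW

variable [PartialOrder S] {k : Type w'} [Field k] [Linear k A] {W : WeightData A Λ} {wt : Λ → S}
  (H : IsHW k W wt)

include H

lemma supp_isTri (T : Set S) : IsTri (W.Supp wt T) where
  zero X hX j := .zero (Functor.map_isZero _ hX)
  of_iso e h j := (h j).of_iso ((homologyFunctor A j).mapIso e)
  shift n X h j := (h (n + j)).of_iso
    (((homologyFunctor A 0).shiftIso n j (n + j) rfl).app X).symm
  ext D h₁ h₃ j := by
    have := H.isSerreClass_filt T
    exact ObjectProperty.prop_X₂_of_exact (W.filt wt T) (coh_exact₂ D j) (h₁ j) (h₃ j)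

lemma supp_univ (M : DerivedCategory A) : W.Supp wt Set.univ M := fun _ => H.filt_univ _

/-- A triangulated subcategory containing the standard objects with weights in a lower set `T`
contains all the bounded objects supported on `T`. -/
lemma of_std {P : DerivedCategory A → Prop} (hP : IsTri P) {T : Set S} (hT : IsLowerSet T)
    (h : ∀ l, wt l ∈ T → P (sg (W.std l))) {M : DerivedCategory A} (hM : Bdd M)
    (hMT : W.Supp wt T M) : P M := by
  have hfilt : ∀ {T' : Set S}, (∀ l, wt l ∈ T' → P (sg (W.L l))) → ∀ X : A, W.filt wt T' X →
      P (sg X) := by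
    intro T' hT' X hX
    induction hX with
    | of h => obtain ⟨l, hl, rfl⟩ := h; exact hT' l hl
    | zero h => exact hP.zero _ (Functor.map_isZero _ h)
    | ext hS _ _ h₁ h₃ => exact hP.ext (dist_of_shortExact hS) h₁ h₃
  have hL : ∀ s : S, s ∈ T → ∀ l, wt l = s → P (sg (W.L l)) := by
    have := H.wellFoundedLT
    intro s
    induction s using WellFoundedLT.induction with
    | _ s ih =>
      rintro hs l rfl
      have := H.epi_π l
      exact hP.third (dist_of_shortExact (shortExact_kernel (W.π l)))
        (hfilt (fun m hm => ih (wt m) hm (hT hm.le hs) m rfl) _ (H.kernel_mem l)) (h l hs)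
  have := hP.isClosedUnderIsomorphisms
  refine bounded_induction P hP.zero hP.ext hM fun j => hP.of_iso (sgShiftIso _ j) (hP.shift _ _ ?_)
  exact hfilt (fun l hl => hL _ hl l rfl) _ (hMT j)

/-- A triangulated subcategory containing the costandard objects with weights in a lower set `T`
contains all the bounded objects supported on `T`. -/
lemma of_costd {P : DerivedCategory A → Prop} (hP : IsTri P) {T : Set S} (hT : IsLowerSet T)
    (h : ∀ l, wt l ∈ T → P (sg (W.costd l))) {M : DerivedCategory A} (hM : Bdd M)
    (hMT : W.Supp wt T M) : P M := by
  have hfilt : ∀ {T' : Set S}, (∀ l, wt l ∈ T' → P (sg (W.L l))) → ∀ X : A, W.filt wt T' X →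
      P (sg X) := by
    intro T' hT' X hX
    induction hX with
    | of h => obtain ⟨l, hl, rfl⟩ := h; exact hT' l hl
    | zero h => exact hP.zero _ (Functor.map_isZero _ h)
    | ext hS _ _ h₁ h₃ => exact hP.ext (dist_of_shortExact hS) h₁ h₃
  have hL : ∀ s : S, s ∈ T → ∀ l, wt l = s → P (sg (W.L l)) := by
    have := H.wellFoundedLT
    intro s
    induction s using WellFoundedLT.induction with
    | _ s ih =>
      rintro hs l rfl
      have := H.mono_i l
      exact hP.first (dist_of_shortExact (shortExact_cokernel (W.i l))) (h l hs)
        (hfilt (fun m hm => ih (wt m) hm (hT hm.le hs) m rfl) _ (H.cokernel_mem l))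
  have := hP.isClosedUnderIsomorphisms
  refine bounded_induction P hP.zero hP.ext hM fun j => hP.of_iso (sgShiftIso _ j) (hP.shift _ _ ?_)
  exact hfilt (fun l hl => hL _ hl l rfl) _ (hMT j)

/-- Every bounded object is supported on a finite lower set. -/
lemma exists_finite_supp {M : DerivedCategory A} (hM : Bdd M) :
    ∃ T : Set S, T.Finite ∧ IsLowerSet T ∧ W.Supp wt T M := by
  refine H.of_std (P := fun M => ∃ T : Set S, T.Finite ∧ IsLowerSet T ∧ W.Supp wt T M) ?_
    isLowerSet_univ (fun l _ => ⟨Set.Iic (wt l), H.finite_Iic _, isLowerSet_Iic _,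
      WeightData.supp_sg (H.filt_std l)⟩) hM (H.supp_univ M)
  have mono : ∀ {T T' : Set S} (_ : T ⊆ T') {M : DerivedCategory A}, W.Supp wt T M →
    W.Supp wt T' M := fun h M hM j => WeightData.filt_mono h (hM j)
  exact
    { zero := fun X hX => ⟨∅, Set.finite_empty, isLowerSet_empty, (H.supp_isTri _).zero X hX⟩
      of_iso := fun e ⟨T, h, h', h''⟩ => ⟨T, h, h', (H.supp_isTri _).of_iso e h''⟩
      shift := fun n X ⟨T, h, h', h''⟩ => ⟨T, h, h', (H.supp_isTri _).shift n X h''⟩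
      ext := fun D ⟨T, h, h', h''⟩ ⟨T₁, h₁, h₁', h₁''⟩ => ⟨T ∪ T₁, h.union h₁, h'.union h₁',
        (H.supp_isTri _).ext D (mono Set.subset_union_left h'')
          (mono Set.subset_union_right h₁'')⟩ }

variable (R : Refines W wt Set.univ)

/-- `Hom(Δ l⟦a⟧, ∇ m⟦b⟧) = 0` unless `l = m` and `a = b`. -/
lemma hom_std_costd_shift (R : Refines W wt Set.univ) {l m : Λ} {a b : ℤ} (h : l ≠ m ∨ a ≠ b) :
    HomZero ((sg (W.std l))⟦a⟧) ((sg (W.costd m))⟦b⟧) := by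
  refine (homZero_shift_iff (b - a) (by lia)).2 ?_
  by_cases hab : b - a = 0
  · rw [hab]
    exact homZero_sg_shift_zero (H.hom_std_costd l m (h.resolve_right (by lia)))
  · exact H.ext_std_costd R l m hab

/-- `Hom(Δ l⟦a⟧, ∇ l⟦a⟧)` is one-dimensional. -/
lemma hom_std_costd_smul (l : Λ) (a : ℤ) (f g : (sg (W.std l))⟦a⟧ ⟶ (sg (W.costd l))⟦a⟧)
    (hf : f ≠ 0) : ∃ c : k, g = c • f := by
  have key : ∀ f : (sg (W.std l))⟦a⟧ ⟶ (sg (W.costd l))⟦a⟧,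
      ∃ c : k, f = c • ((singleFunctor A 0).map (W.π l ≫ W.i l))⟦a⟧' := fun f => by
    obtain ⟨f, rfl⟩ := (shiftFunctor (DerivedCategory A) a).map_surjective f
    obtain ⟨f, rfl⟩ := (singleFunctor A 0).map_surjective f
    obtain ⟨c, rfl⟩ := H.hom_std_costd_eq l f
    exact ⟨c, by rw [Functor.map_smul, Functor.map_smul]⟩
  obtain ⟨c, rfl⟩ := key f
  obtain ⟨d, rfl⟩ := key g
  have hc : c ≠ 0 := by rintro rfl; simp at hf
  exact ⟨d * c⁻¹, by rw [smul_smul, mul_assoc, inv_mul_cancel₀ hc, mul_one]⟩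

lemma end_std_shift (l : Λ) (a : ℤ) (f : (sg (W.std l))⟦a⟧ ⟶ (sg (W.std l))⟦a⟧) :
    ∃ c : k, f = c • 𝟙 _ := by
  obtain ⟨f, rfl⟩ := (shiftFunctor (DerivedCategory A) a).map_surjective f
  obtain ⟨f, rfl⟩ := (singleFunctor A 0).map_surjective f
  obtain ⟨c, rfl⟩ := H.end_std l f
  exact ⟨c, by rw [Functor.map_smul, Functor.map_smul, CategoryTheory.Functor.map_id,
    CategoryTheory.Functor.map_id]⟩

include R

lemma hom_std_std_shift {l m : Λ} {a b : ℤ} (hlm : ¬ wt l < wt m) (h : l ≠ m ∨ a ≠ b) :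
    HomZero ((sg (W.std l))⟦a⟧) ((sg (W.std m))⟦b⟧) :=
  (homZero_shift_iff (b - a) (by lia)).2 (H.ext_std_std R hlm (h.imp_right fun h => by lia))

/-- The bounded derived category is `Hom`-finite, by dévissage to `Hom(Δ l, ∇ m⟦n⟧)`. -/
lemma homFinite {M N : DerivedCategory A} (hM : Bdd M) (hN : Bdd N) : Module.Finite k (M ⟶ N) := by
  have h1 : ∀ l m n, Module.Finite k (sg (W.std l) ⟶ (sg (W.costd m))⟦(n : ℤ)⟧) := fun l m n => by
    have e : Module.Finite k ((sg (W.std l))⟦(0 : ℤ)⟧ ⟶ (sg (W.costd m))⟦(n : ℤ)⟧) := by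
      by_cases h : l ≠ m ∨ 0 ≠ n
      · have : Subsingleton ((sg (W.std l))⟦(0 : ℤ)⟧ ⟶ (sg (W.costd m))⟦(n : ℤ)⟧) :=
          ⟨fun f g => (H.hom_std_costd_shift R h f).trans (H.hom_std_costd_shift R h g).symm⟩
        infer_instance
      · obtain ⟨rfl, rfl⟩ : l = m ∧ 0 = n := by simpa [not_or] using h
        by_cases h0 : ∃ f : (sg (W.std l))⟦(0 : ℤ)⟧ ⟶ (sg (W.costd l))⟦(0 : ℤ)⟧, f ≠ 0
        · obtain ⟨f, hf⟩ := h0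
          refine Module.Finite.of_surjective (LinearMap.toSpanSingleton k _ f) fun g => ?_
          obtain ⟨c, rfl⟩ := H.hom_std_costd_smul l 0 f g hf
          exact ⟨c, rfl⟩
        · push Not at h0
          have : Subsingleton ((sg (W.std l))⟦(0 : ℤ)⟧ ⟶ (sg (W.costd l))⟦(0 : ℤ)⟧) :=
            ⟨fun f g => (h0 f).trans (h0 g).symm⟩
          infer_instance
    exact Module.Finite.equiv (Linear.homCongr k ((shiftFunctorZero _ ℤ).app (sg (W.std l)))
      (Iso.refl ((sg (W.costd m))⟦n⟧)))
  have h2 : ∀ l, ∀ n : ℤ, Module.Finite k (sg (W.std l) ⟶ N⟦n⟧) := fun l =>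
    H.of_costd (IsTri.homFinite_right k (sg (W.std l))) isLowerSet_univ
      (fun m _ n => h1 l m n) hN (H.supp_univ N)
  have h3 : ∀ n : ℤ, Module.Finite k (M⟦n⟧ ⟶ N) := by
    refine H.of_std (IsTri.homFinite_left k N) isLowerSet_univ (fun l _ n => ?_) hM (H.supp_univ M)
    have := h2 l (-n)
    let i : N⟦-n⟧⟦n⟧ ≅ N := (shiftFunctorCompIsoId (DerivedCategory A) (-n) n (by lia)).app N
    have : Module.Finite k ((sg (W.std l))⟦n⟧ ⟶ N⟦-n⟧⟦n⟧) :=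
      Module.Finite.of_surjective ((shiftFunctor (DerivedCategory A) n).mapLinearMap k)
        (shiftFunctor (DerivedCategory A) n).map_surjective
    exact Module.Finite.equiv (Linear.homCongr k (Iso.refl _) i)
  have := h3 0
  exact Module.Finite.equiv (Linear.homCongr k ((shiftFunctorZero _ ℤ).app M) (Iso.refl N))

/-- Only finitely many of the objects `Δ l⟦m⟧` have nonzero morphisms to a given bounded object. -/
lemma finite_hom_std {M : DerivedCategory A} (hM : Bdd M) :
    {p : Λ × ℤ | ¬ HomZero ((sg (W.std p.1))⟦p.2⟧) M}.Finite := by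
  refine H.of_costd (IsTri.finite_hom fun l => sg (W.std l)) isLowerSet_univ (fun l _ => ?_) hM
    (H.supp_univ M)
  refine (Set.finite_singleton (l, (0 : ℤ))).subset fun p hp => ?_
  by_contra hne
  refine hp ((H.hom_std_costd_shift R (a := p.2) (b := 0) (l := p.1) (m := l) ?_).congr_right
    ((shiftFunctorZero _ ℤ).app _))
  by_contra h
  push Not at h
  exact hne (Prod.ext h.1 h.2)

end IsHW

end Support

/-! ### Pure objects -/

section Pure

lemma finrank_lt_of_surjective {k : Type*} [Field k] {V V' : Type*} [AddCommGroup V] [Module k V]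
    [AddCommGroup V'] [Module k V'] [Module.Finite k V] (φ : V →ₗ[k] V')
    (hφ : Function.Surjective φ) (x : V) (hx : x ≠ 0) (h : φ x = 0) :
    Module.finrank k V' < Module.finrank k V := by
  have h1 := φ.finrank_range_add_finrank_ker
  rw [LinearMap.range_eq_top.2 hφ, finrank_top] at h1
  have : Nontrivial (LinearMap.ker φ) := ⟨⟨x, h⟩, 0, fun e => hx (congrArg Subtype.val e)⟩
  have := Module.finrank_pos (R := k) (M := LinearMap.ker φ)
  lia

open DerivedCategory

variable {A : Type u} [Category.{v} A] [Abelian A] {Λ : Type x} {S : Type y}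

namespace IsHW

section

variable [PartialOrder S] {k : Type w'} [Field k] [Linear k A] {W : WeightData A Λ} {wt : Λ → S}
  (H : IsHW k W wt) [HasDerivedCategory.{w} A] {T : Set S} {l : Λ} (hl : ∀ t ∈ T, ¬ wt l < t)

include H hl

lemma ext_one_std_filt {X : A} (hX : W.filt wt T X) : HomZero (sg (W.std l)) ((sg X)⟦(1 : ℤ)⟧) := by
  refine hX.homZero_right ?_
  rintro _ ⟨ν, hν, rfl⟩
  exact H.ext_one_std_simple (hl _ hν)

lemma ext_one_filt_costd {X : A} (hX : W.filt wt T X) :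
    HomZero (sg X) ((sg (W.costd l))⟦(1 : ℤ)⟧) := by
  refine hX.homZero_left ?_
  rintro _ ⟨ν, hν, rfl⟩
  exact H.ext_one_simple_costd (hl _ hν)

omit hl in
/-- If `s` is maximal in `T` and `X` receives no morphisms from the `Δ l` of weight `s`, then no
`L l` of weight `s` is a composition factor of `X`, since `Hom(Δ l, -)` is exact on `A_T`. -/
lemma filt_diff {s : S} (hs : ∀ t ∈ T, ¬ s < t) {X : A} (hX : W.filt wt T X)
    (h : ∀ l, wt l = s → HomZero (W.std l) X) : W.filt wt (T \ {s}) X := by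
  induction hX with
  | of hμ =>
    obtain ⟨μ, hμ, rfl⟩ := hμ
    refine .of ⟨μ, ⟨hμ, fun e => ?_⟩, rfl⟩
    have := H.epi_π μ
    have := H.simple μ
    apply id_nonzero (W.L μ)
    rw [← cancel_epi (W.π μ), Category.comp_id, comp_zero, h μ e (W.π μ)]
  | zero hz => exact .zero hz
  | @ext S' hS h₁ _ ih₁ ih₃ =>
    have := hS.mono_f
    refine .ext hS (ih₁ fun l hl f => ?_) (ih₃ fun l hl f => ?_)
    · rw [← cancel_mono S'.f, h l hl (f ≫ S'.f), zero_comp]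
    · obtain ⟨b, hb⟩ := (dist_of_shortExact hS).lift₃ ((singleFunctor A 0).map f)
        (H.ext_one_std_filt (by rwa [hl]) h₁ _)
      obtain ⟨b, rfl⟩ := (singleFunctor A 0).map_surjective b
      rw [h l hl b, Functor.map_zero, zero_comp] at hb
      exact (singleFunctor A 0).map_injective (by rw [hb, Functor.map_zero])

/-- A nonzero morphism from `Δ l` to an object in which the weight of `l` is maximal can be
composed with a morphism to `∇ l` to a nonzero morphism. -/
lemma exists_hom_costd {X : A} (hX : W.filt wt T X) (a : W.std l ⟶ X) (ha : a ≠ 0) :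
    ∃ b : X ⟶ W.costd l, a ≫ b ≠ 0 := by
  have := H.epi_π l
  have := H.simple l
  by_cases h0 : kernel.ι a ≫ W.π l = 0
  · -- `Δ l ⟶ L l ⟶ ∇ l` descends to the image of `a`, and then extends to `X`
    obtain ⟨j, hj⟩ : ∃ j : image a ⟶ W.costd l, factorThruImage a ≫ j = W.π l ≫ W.i l :=
      ⟨_, (shortExact_kernel_image a).exact.g_desc (W.π l ≫ W.i l) (by
        dsimp
        rw [← Category.assoc, h0, zero_comp])⟩
    have := H.isSerreClass_filt T
    have hc : W.filt wt T (cokernel (image.ι a)) :=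
      ObjectProperty.prop_of_epi (W.filt wt T) (cokernel.π (image.ι a)) hX
    obtain ⟨b, hb⟩ := (dist_of_shortExact (shortExact_cokernel (image.ι a))).desc₁
      ((singleFunctor A 0).map j) (H.ext_one_filt_costd hl hc _)
    obtain ⟨b, rfl⟩ := (singleFunctor A 0).map_surjective b
    refine ⟨b, ?_⟩
    have hb' : j = image.ι a ≫ b := (singleFunctor A 0).map_injective (by
      rw [Functor.map_comp]; exact hb)
    rw [← image.fac a, Category.assoc, ← hb', hj]
    exact H.π_comp_i_ne_zero l
  · -- otherwise the image of `a` has no composition factor `L l`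
    refine (ha ?_).elim
    have : Epi (kernel.ι a ≫ W.π l) := epi_of_nonzero_to_simple h0
    let c := kernel.ι (W.π l) ≫ a
    have h1 : a ≫ cokernel.π c = 0 := by
      obtain ⟨u, hu⟩ : ∃ u : W.L l ⟶ cokernel c, W.π l ≫ u = a ≫ cokernel.π c :=
        ⟨_, (shortExact_kernel (W.π l)).exact.g_desc (a ≫ cokernel.π c) (by
          dsimp
          rw [← Category.assoc]
          exact cokernel.condition c)⟩
      have hu0 : u = 0 := by
        rw [← cancel_epi (kernel.ι a ≫ W.π l), Category.assoc, hu, kernel.condition_assoc,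
          zero_comp, comp_zero]
      rw [← hu, hu0, comp_zero]
    have := H.isSerreClass_filt (Set.Iio (wt l))
    have h2 : W.filt wt (Set.Iio (wt l)) (image c) :=
      ObjectProperty.prop_of_epi (W.filt wt (Set.Iio (wt l))) (factorThruImage c) (H.kernel_mem l)
    have h3 := (shortExact_image_cokernel c).exact.lift_f a h1
    rw [← h3, H.hom_std_of_filt (show wt l ∉ Set.Iio (wt l) from lt_irrefl _) h2
      ((shortExact_image_cokernel c).exact.lift a h1), zero_comp]

end

section

variable [PartialOrder S] {k : Type w'} [Field k] [Linear k A] {W : WeightData A Λ} {wt : Λ → S}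
  (H : IsHW k W wt) (R : Refines W wt Set.univ) [HasDerivedCategory.{w} A]

include H R

section

variable {T : Set S} {M : DerivedCategory A} (hM : Bdd M) (hMT : W.Supp wt T M)

include hMT

lemma hom_std_coh {l : Λ} (hl : ∀ t ∈ T, ¬ wt l < t) (j n : ℤ) (hn : n ≠ 0) :
    HomZero (sg (W.std l)) ((sg (coh j M))⟦n⟧) := by
  refine (hMT j).homZero_right ?_
  rintro _ ⟨ν, hν, rfl⟩
  exact H.ext_std_simple R (hl _ hν) hn

lemma hom_coh_costd {l : Λ} (hl : ∀ t ∈ T, ¬ wt l < t) (j n : ℤ) (hn : n ≠ 0) :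
    HomZero (sg (coh j M)) ((sg (W.costd l))⟦n⟧) := by
  refine (hMT j).homZero_left ?_
  rintro _ ⟨ν, hν, rfl⟩
  exact H.ext_simple_costd R (hl _ hν) hn

include hM

/-- An object supported on `T` without morphisms from the shifts of the `Δ l` of maximal
weight `s` is supported on `T \ {s}`. -/
lemma supp_diff {s : S} (hs : ∀ t ∈ T, ¬ s < t)
    (h : ∀ l, wt l = s → ∀ m : ℤ, HomZero ((sg (W.std l))⟦m⟧) M) : W.Supp wt (T \ {s}) M := by
  intro j
  refine H.filt_diff hs (hMT j) fun l hl f => ?_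
  subst hl
  have hMT' := (H.supp_isTri T).shift j M hMT
  have hb := coh_map_bijective_of_source (W.std l) (bdd_isTri.shift j M hM)
    (fun i m hm => H.hom_std_coh R hMT' hs i m hm)
  let e : coh 0 (M⟦j⟧) ≅ coh j M := ((homologyFunctor A 0).shiftIso j 0 j (by lia)).app M
  let i : coh 0 (sg (W.std l)) ≅ W.std l := (singleFunctorCompHomologyFunctorIso A 0).app _
  obtain ⟨g, hg⟩ := hb.2 (i.hom ≫ f ≫ e.inv)
  have hg0 : g = 0 := (homZero_shift_left_iff j (by lia)).1 (h l rfl (-j)) g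
  rw [hg0] at hg
  dsimp only at hg
  rw [Functor.map_zero] at hg
  rw [← cancel_epi i.hom, ← cancel_mono e.inv, Category.assoc, ← hg, comp_zero, zero_comp]

lemma exists_costd_of_std_zero {l : Λ} (hl : ∀ t ∈ T, ¬ wt l < t) (a : sg (W.std l) ⟶ M)
    (ha : a ≠ 0) : ∃ b : M ⟶ sg (W.costd l), a ≫ b ≠ 0 := by
  have hb := coh_map_bijective_of_source (W.std l) hM (fun i m hm => H.hom_std_coh R hMT hl i m hm)
  let i := (singleFunctorCompHomologyFunctorIso A 0).app (W.std l)
  let i' := (singleFunctorCompHomologyFunctorIso A 0).app (W.costd l)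
  have ha' : i.inv ≫ (homologyFunctor A 0).map a ≠ 0 := fun h0 => ha (hb.1 (by
    dsimp only
    rw [← cancel_epi i.inv, h0, Functor.map_zero, comp_zero]))
  obtain ⟨b, hb⟩ := H.exists_hom_costd hl (hMT 0) _ ha'
  obtain ⟨β, hβ⟩ := coh_map_surjective_of_target (W.costd l) hM
    (fun i m hm => H.hom_coh_costd R hMT hl i m hm) (b ≫ i'.inv)
  refine ⟨β, fun h0 => hb ?_⟩
  have h1 : (homologyFunctor A 0).map a ≫ b ≫ i'.inv = 0 := by
    rw [← hβ, ← Functor.map_comp, h0, Functor.map_zero]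
  rw [Category.assoc, ← cancel_mono i'.inv, Category.assoc, Category.assoc, h1, comp_zero,
    zero_comp]

/-- The derived version of `exists_hom_costd`: if the weight of `l` is maximal in the support of
`M`, then `Hom(Δ l⟦m⟧, M)` and `Hom(M, ∇ l⟦m⟧)` only involve one cohomology object of `M`. -/
lemma exists_costd_of_std {l : Λ} (hl : ∀ t ∈ T, ¬ wt l < t) {m : ℤ}
    (a : (sg (W.std l))⟦m⟧ ⟶ M) (ha : a ≠ 0) :
    ∃ b : M ⟶ (sg (W.costd l))⟦m⟧, a ≫ b ≠ 0 := by
  let i : M⟦-m⟧⟦m⟧ ≅ M := (shiftFunctorCompIsoId (DerivedCategory A) (-m) m (by lia)).app M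
  obtain ⟨a₀, h₀⟩ := (shiftFunctor (DerivedCategory A) m).map_surjective (a ≫ i.inv)
  obtain ⟨b₀, hb₀⟩ := H.exists_costd_of_std_zero R (bdd_isTri.shift (-m) M hM)
    ((H.supp_isTri T).shift (-m) M hMT) hl a₀ (by
      rintro rfl
      apply ha
      rw [← cancel_mono i.inv, ← h₀, Functor.map_zero, zero_comp])
  refine ⟨i.inv ≫ b₀⟦m⟧', fun h1 => hb₀ ((shiftFunctor (DerivedCategory A) m).map_injective ?_)⟩
  rw [Functor.map_comp, h₀, Category.assoc, h1, Functor.map_zero]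

end

/-- Objects supported on `{t | t ≤ s}` only have morphisms to the `∇ l` with weight `≤ s`. -/
lemma le_of_hom_costd {s : S} {M : DerivedCategory A} (hM : Bdd M)
    (hMT : W.Supp wt (Set.Iic s) M) {l : Λ} {m : ℤ} (h : ¬ HomZero M ((sg (W.costd l))⟦m⟧)) :
    wt l ≤ s := by
  by_contra hl
  refine h (homZero_of_coh_left hM fun j => ?_)
  refine (hMT j).homZero_left ?_
  rintro _ ⟨ν, hν, rfl⟩
  refine HomZero.congr_right ((shiftFunctorAdd _ m j).app _) ?_
  by_cases h0 : m + j = 0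
  · rw [h0]
    exact homZero_sg_shift_zero (H.hom_costd l ν (by rintro rfl; exact hl hν))
  · exact H.ext_simple_costd R (fun h' => hl (h'.le.trans hν)) h0

/-- Objects supported on `{t | t ≤ s}` only receive morphisms from the `Δ l` with weight `≤ s`. -/
lemma le_of_hom_std {s : S} {M : DerivedCategory A} (hM : Bdd M)
    (hMT : W.Supp wt (Set.Iic s) M) {l : Λ} {m : ℤ} (h : ¬ HomZero ((sg (W.std l))⟦m⟧) M) :
    wt l ≤ s := by
  by_contra hl
  refine h ((homZero_shift_left_iff (-m) (by lia)).2 (homZero_of_coh_right hM _ fun j => ?_))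
  refine (hMT j).homZero_right ?_
  rintro _ ⟨ν, hν, rfl⟩
  by_cases h0 : -m - j = 0
  · rw [h0]
    exact homZero_sg_shift_zero (H.hom_std l ν (by rintro rfl; exact hl hν))
  · exact H.ext_std_simple R (fun h' => hl (h'.le.trans hν)) h0

section Cone

variable {l : Λ} {m : ℤ} {M C : DerivedCategory A} {a : (sg (W.std l))⟦m⟧ ⟶ M} {g : M ⟶ C}
  {h : C ⟶ (sg (W.std l))⟦m⟧⟦(1 : ℤ)⟧} (D : Dist a g h)

include D

/-- If `a : Δ l⟦m⟧ ⟶ M` is nonzero, then morphisms from `Δ l'⟦m'⟧` to the cone of `a` lift to `M`,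
unless `l'` has smaller weight than `l`. -/
lemma lift_cone (ha : a ≠ 0) {l' : Λ} {m' : ℤ} (hl : ¬ wt l' < wt l)
    (c : (sg (W.std l'))⟦m'⟧ ⟶ C) : ∃ b : (sg (W.std l'))⟦m'⟧ ⟶ M, c = b ≫ g := by
  -- the obstruction `c ≫ h` lies in `Hom(Δ l'⟦m'⟧, Δ l⟦m + 1⟧)`, which consists of scalars or is
  -- zero, and it is killed by the nonzero morphism `a⟦1⟧`
  refine D.lift₃ c ?_
  let i := (shiftFunctorAdd' (DerivedCategory A) m 1 (m + 1) rfl).app (sg (W.std l))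
  rw [← cancel_mono i.inv, zero_comp]
  by_cases hne : l' ≠ l ∨ m' ≠ m + 1
  · exact H.hom_std_std_shift R hl hne _
  · obtain ⟨rfl, rfl⟩ : l' = l ∧ m' = m + 1 := by simpa [not_or] using hne
    obtain ⟨d, hd⟩ := H.end_std_shift l' (m + 1) ((c ≫ h) ≫ i.inv)
    by_cases h0 : d = 0
    · rw [hd, h0, zero_smul]
    · refine (ha ((shiftFunctor (DerivedCategory A) (1 : ℤ)).map_injective ?_)).elim
      have h1 : ((c ≫ h) ≫ i.inv) ≫ i.hom ≫ a⟦(1 : ℤ)⟧' = 0 := by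
        rw [Category.assoc, i.inv_hom_id_assoc, Category.assoc, D.comp₃₁, comp_zero]
      rw [hd, Linear.smul_comp, Category.id_comp, smul_eq_zero_iff_right h0] at h1
      rw [Functor.map_zero, ← cancel_epi i.hom, h1, comp_zero]

end Cone

end

end IsHW

section

variable [HasDerivedCategory.{w} A]

/-- Purity with respect to the costandard objects: the nonzero morphisms to the shifts of `∇ l`
are in degree `e l`. -/
def WeightData.StarPure (W : WeightData A Λ) (e : Λ → ℤ) (M : DerivedCategory A) : Prop :=
  ∀ (l : Λ) (m : ℤ), ¬ HomZero M ((sg (W.costd l))⟦m⟧) → m = e l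

/-- Purity with respect to the standard objects: the nonzero morphisms from the shifts of `Δ l`
are in degree `e l`. -/
def WeightData.ShriekPure (W : WeightData A Λ) (e : Λ → ℤ) (M : DerivedCategory A) : Prop :=
  ∀ (l : Λ) (m : ℤ), ¬ HomZero ((sg (W.std l))⟦m⟧) M → m = e l

namespace IsHW

variable [PartialOrder S] {k : Type w'} [Field k] [Linear k A] {W : WeightData A Λ} {wt : Λ → S}
  (H : IsHW k W wt) (R : Refines W wt Set.univ) {e : Λ → ℤ}

include H R

/-- Let `a : Δ l⟦m⟧ ⟶ M` be nonzero on the top of `Δ l⟦m⟧`, in the sense that it has a nonzero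
composition with some `b : M ⟶ ∇ l⟦m⟧`. Then every morphism from the cone of `a` to a costandard
object is determined by its restriction to `M`, and the cone inherits `*`-purity from `M`. -/
lemma starPure_cone {l : Λ} {m : ℤ} {M C : DerivedCategory A} {a : (sg (W.std l))⟦m⟧ ⟶ M}
    {g : M ⟶ C} {h : C ⟶ (sg (W.std l))⟦m⟧⟦(1 : ℤ)⟧} (D : Dist a g h) (hM : W.StarPure e M)
    (b : M ⟶ (sg (W.costd l))⟦m⟧) (hab : a ≫ b ≠ 0) : W.StarPure e C := by
  intro μ n hφ
  obtain ⟨φ, hφ⟩ : ∃ φ : C ⟶ (sg (W.costd μ))⟦n⟧, φ ≠ 0 := by simpa [HomZero] using hφ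
  by_cases h0 : g ≫ φ = 0
  · refine (hφ ?_).elim
    -- then `φ = h ≫ ψ`, where `ψ` is zero or a multiple of `(a ≫ b)⟦1⟧`, and `h ≫ a⟦1⟧ = 0`
    obtain ⟨ψ, rfl⟩ := D.desc₃ φ h0
    have i := (shiftFunctorAdd' (DerivedCategory A) m 1 (m + 1) rfl).app (sg (W.std l))
    by_cases hne : l ≠ μ ∨ m + 1 ≠ n
    · rw [(H.hom_std_costd_shift R hne).congr_left i ψ, comp_zero]
    · obtain ⟨rfl, rfl⟩ : l = μ ∧ m + 1 = n := by simpa [not_or] using hne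
      let i' := (shiftFunctorAdd' (DerivedCategory A) m 1 (m + 1) rfl).app (sg (W.costd l))
      obtain ⟨ψ₀, hψ₀⟩ := (shiftFunctor (DerivedCategory A) (1 : ℤ)).map_surjective (ψ ≫ i'.hom)
      obtain ⟨c, rfl⟩ := H.hom_std_costd_smul l m _ ψ₀ hab
      rw [← cancel_mono i'.hom, Category.assoc, ← hψ₀, Functor.map_smul, Linear.comp_smul,
        Functor.map_comp, reassoc_of% D.comp₃₁, zero_comp, zero_comp, smul_zero]
  · exact hM μ n fun h' => h0 (h' _)

/-- There are no morphisms of degree `1` from a `*`-pure object to a `!`-pure object of the same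
weights: split off the standard objects from the first one, by decreasing weights. -/
lemma hom_shift_one {M N : DerivedCategory A} (hMb : Bdd M) (hM : W.StarPure e M)
    (hN : W.ShriekPure e N) : HomZero M (N⟦(1 : ℤ)⟧) := by
  obtain ⟨T, hT, hTl, hMT⟩ := H.exists_finite_supp hMb
  -- induction on the number of weights in the support, and then on the total dimension of the
  -- spaces of morphisms from the standard objects of a maximal weight `s`
  induction hn : T.ncard using Nat.strong_induction_on generalizing T M with
  | _ n ih =>
  rcases T.eq_empty_or_nonempty with rfl | hne
  · exact .of_isZero_left (WeightData.isZero_of_supp_empty hMT)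
  obtain ⟨s, hs⟩ := hT.exists_maximal hne
  have hs' : ∀ t ∈ T, ¬ s < t := fun t ht h => (hs.2 ht h.le).not_gt h
  have hfin : {p : Λ × ℤ | wt p.1 = s ∧ ¬ HomZero ((sg (W.std p.1))⟦p.2⟧) M}.Finite :=
    (H.finite_hom_std R hMb).subset fun p hp => hp.2
  -- the finitely many `(l, m)` with `wt l = s` such that `Δ l⟦m⟧` has a nonzero morphism to `M`;
  -- only the consequences `hF` and `hMF` are kept, since they pass to the cones below
  let F := hfin.toFinset
  have hF : ∀ p ∈ F, wt p.1 = s := fun p hp => (hfin.mem_toFinset.1 hp).1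
  have hMF : ∀ p : Λ × ℤ, wt p.1 = s → p ∉ F → HomZero ((sg (W.std p.1))⟦p.2⟧) M :=
    fun p hp hpF => by
      by_contra h
      exact hpF (hfin.mem_toFinset.2 ⟨hp, h⟩)
  clear_value F
  clear hfin
  induction hd : ∑ p ∈ F, Module.finrank k ((sg (W.std p.1))⟦p.2⟧ ⟶ M) using
    Nat.strong_induction_on generalizing M with
  | _ d ih' =>
  by_cases h0 : ∀ l, wt l = s → ∀ m : ℤ, HomZero ((sg (W.std l))⟦m⟧) M
  · refine ih _ ?_ hMb hM (T \ {s}) hT.sdiff (fun a b hab ha => ⟨hTl hab ha.1, ?_⟩)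
      (H.supp_diff R hMb hMT hs' h0) rfl
    · rw [← hn]
      exact Set.ncard_sdiff_singleton_lt_of_mem hs.1 hT
    · rintro rfl
      exact (hs' a ha.1) (lt_of_le_of_ne hab fun e => ha.2 e.symm)
  · push Not at h0
    obtain ⟨l, rfl, m, h0⟩ := h0
    obtain ⟨a, ha⟩ : ∃ a : (sg (W.std l))⟦m⟧ ⟶ M, a ≠ 0 := by simpa [HomZero] using h0
    obtain ⟨b, hab⟩ := H.exists_costd_of_std R hMb hMT hs' a ha
    have hb : b ≠ 0 := by rintro rfl; exact hab comp_zero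
    have hme : m = e l := hM l m fun h => hb (h b)
    obtain ⟨C, g, h, D⟩ := Dist.exists_cone a
    have hsT : Set.Iic (wt l) ⊆ T := fun t ht => hTl ht hs.1
    have hCb : Bdd C := bdd_isTri.third D (bdd_isTri.shift _ _ (bdd_sg _)) hMb
    have hCT : W.Supp wt T C := (H.supp_isTri T).third D ((H.supp_isTri T).shift _ _
      (WeightData.supp_sg (WeightData.filt_mono hsT (H.filt_std l)))) hMT
    have hsurj : ∀ p : Λ × ℤ, wt p.1 = wt l →
        Function.Surjective (Linear.rightComp k ((sg (W.std p.1))⟦p.2⟧) g) := fun p hp c => by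
      obtain ⟨b, rfl⟩ := H.lift_cone R D ha (by rw [hp]; exact lt_irrefl _) c
      exact ⟨b, rfl⟩
    have hfin : ∀ p : Λ × ℤ, Module.Finite k ((sg (W.std p.1))⟦p.2⟧ ⟶ M) := fun p =>
      H.homFinite R (bdd_isTri.shift _ _ (bdd_sg _)) hMb
    refine D.homZero₂_left ?_ (ih' _ ?_ hCb (H.starPure_cone R D hM b hab) hCT (fun p hp hpF => ?_)
      rfl)
    · -- `Hom(Δ l⟦m⟧, N⟦1⟧) = Hom(Δ l⟦m - 1⟧, N)` vanishes since `m - 1 ≠ e l`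
      refine (homZero_shift_iff (-m + 1) (by lia)).2 ?_
      refine (homZero_shift_iff (a := m - 1) (b := 0) (-m + 1) (by lia)).1
        (HomZero.congr_right ((shiftFunctorZero _ ℤ).app N).symm ?_)
      by_contra h'
      have := hN l _ h'
      lia
    · rw [← hd]
      have hmem : (l, m) ∈ F := by
        by_contra hlF
        exact ha (hMF (l, m) rfl hlF a)
      refine Finset.sum_lt_sum (fun p hp => ?_) ⟨(l, m), hmem, ?_⟩
      · have := hfin p
        exact LinearMap.finrank_le_finrank_of_surjective (hsurj p (hF p hp))
      · have := hfin (l, m)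
        exact finrank_lt_of_surjective _ (hsurj (l, m) rfl) a ha D.comp₁₂
    · intro c
      obtain ⟨b, rfl⟩ := hsurj p hp c
      rw [hMF p hp hpF b, map_zero]

end IsHW

end

end Pure

/-! ### Classification of the indecomposable pure objects -/

section PureClassification

open DerivedCategory

variable {A : Type u} [Category.{v} A] [Abelian A] {Λ : Type x} {S : Type y}
  [HasDerivedCategory.{w} A]

namespace IsHW

variable [PartialOrder S] {k : Type w'} [Field k] [Linear k A] {W : WeightData A Λ} {wt : Λ → S}
  (H : IsHW k W wt) (R : Refines W wt Set.univ) {e : Λ → ℤ}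

include H R

/-- Morphisms from `Δ l⟦m⟧` to a `!`-pure object extend along morphisms `a : Δ l⟦m⟧ ⟶ M` to
`*`-pure objects, if `a` is nonzero on the top of `Δ l⟦m⟧`. -/
lemma exists_extend {M N : DerivedCategory A} (hMb : Bdd M) (hM : W.StarPure e M)
    (hN : W.ShriekPure e N) {l : Λ} {m : ℤ} (a : (sg (W.std l))⟦m⟧ ⟶ M)
    (b : M ⟶ (sg (W.costd l))⟦m⟧) (hab : a ≫ b ≠ 0) (c : (sg (W.std l))⟦m⟧ ⟶ N) :
    ∃ f : M ⟶ N, c = a ≫ f := by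
  obtain ⟨C, g, h, D⟩ := Dist.exists_cone a
  exact D.desc₁ c (H.hom_shift_one R (bdd_isTri.third D (bdd_isTri.shift _ _ (bdd_sg _)) hMb)
    (H.starPure_cone R D hM b hab) hN _)

/-- Two indecomposable pure objects supported on weights `≤ wt l`, both of which receive nonzero
morphisms from `Δ l⟦m⟧`, are isomorphic: these morphisms extend along each other, and both
compositions of the extensions fix a nonzero morphism, hence are invertible. -/
lemma nonempty_iso_of_pure {M N : DerivedCategory A} (hMb : Bdd M) (hNb : Bdd N)
    (hMi : TrivialIdempotents M) (hNi : TrivialIdempotents N)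
    (hM : W.StarPure e M) (hM' : W.ShriekPure e M) (hN : W.StarPure e N) (hN' : W.ShriekPure e N)
    {l : Λ} (hMT : W.Supp wt (Set.Iic (wt l)) M) (hNT : W.Supp wt (Set.Iic (wt l)) N) {m : ℤ}
    (a : (sg (W.std l))⟦m⟧ ⟶ M) (ha : a ≠ 0) (a' : (sg (W.std l))⟦m⟧ ⟶ N) (ha' : a' ≠ 0) :
    Nonempty (M ≅ N) := by
  obtain ⟨b, hb⟩ := H.exists_costd_of_std R hMb hMT (fun t ht => not_lt_of_ge ht) a ha
  obtain ⟨b', hb'⟩ := H.exists_costd_of_std R hNb hNT (fun t ht => not_lt_of_ge ht) a' ha'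
  obtain ⟨f, hf⟩ := H.exists_extend R hMb hM hN' a b hb a'
  obtain ⟨g, hg⟩ := H.exists_extend R hNb hN hM' a' b' hb' a
  have := H.homFinite R hMb hMb
  have := H.homFinite R hNb hNb
  have h1 : IsIso (f ≫ g) := hMi.isIso_of_comp_eq (k := k) a ha _ (by
    rw [← Category.assoc, ← hf, ← hg])
  have h2 : IsIso (g ≫ f) := hNi.isIso_of_comp_eq (k := k) a' ha' _ (by
    rw [← Category.assoc, ← hg, ← hf])
  have : IsIso f := by
    have : Mono f := mono_of_mono f g
    have : IsSplitEpi f := ⟨⟨⟨inv (g ≫ f) ≫ g, by simp⟩⟩⟩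
    exact isIso_of_mono_of_isSplitEpi f
  exact ⟨asIso f⟩

/-- The support of an indecomposable pure object `M` has a unique maximal weight, and all the
morphisms to `M` from standard objects of this weight factor through a single one. Otherwise,
there would be an endomorphism of `M` which fixes one such morphism and kills another one. -/
lemma exists_leading {M : DerivedCategory A} (hMb : Bdd M) (h0 : ¬ IsZero M)
    (hMi : TrivialIdempotents M) (hM : W.StarPure e M) (hM' : W.ShriekPure e M) :
    ∃ l, W.Supp wt (Set.Iic (wt l)) M ∧ ∃ a : (sg (W.std l))⟦e l⟧ ⟶ M, a ≠ 0 ∧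
      ∀ (l' : Λ) (m : ℤ), wt l' = wt l → ∀ a' : (sg (W.std l'))⟦m⟧ ⟶ M, ∃ u, a' = u ≫ a := by
  -- a lower set of minimal cardinality supporting `M`
  obtain ⟨T, ⟨hT, hTl, hMT⟩, hmin⟩ := exists_minimalFor_of_wellFoundedLT
    (fun T : Set S => T.Finite ∧ IsLowerSet T ∧ W.Supp wt T M) Set.ncard
    (H.exists_finite_supp hMb)
  have hmax : ∀ s ∈ T, (∀ t ∈ T, ¬ s < t) → ∃ l, wt l = s ∧ ∃ (m : ℤ)
      (a : (sg (W.std l))⟦m⟧ ⟶ M), a ≠ 0 := by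
    intro s hs hs'
    by_contra hcon
    have hz : ∀ l, wt l = s → ∀ m : ℤ, HomZero ((sg (W.std l))⟦m⟧) M := fun l hl m a => by
      by_contra ha
      exact hcon ⟨l, hl, m, a, ha⟩
    have := hmin (j := T \ {s}) ⟨hT.sdiff, fun a b hab ha => ⟨hTl hab ha.1, by
      rintro rfl
      exact hs' a ha.1 (lt_of_le_of_ne hab fun e => ha.2 e.symm)⟩,
      H.supp_diff R hMb hMT hs' hz⟩ (Set.ncard_sdiff_singleton_lt_of_mem hs hT).le
    exact (Set.ncard_sdiff_singleton_lt_of_mem hs hT).not_ge this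
  have hne : T.Nonempty := by
    by_contra h
    rw [Set.not_nonempty_iff_eq_empty] at h
    subst h
    exact h0 (WeightData.isZero_of_supp_empty hMT)
  obtain ⟨s, hs⟩ := hT.exists_maximal hne
  have hs' : ∀ t ∈ T, ¬ s < t := fun t ht h => (hs.2 ht h.le).not_gt h
  obtain ⟨l, rfl, m, a, ha⟩ := hmax s hs.1 hs'
  obtain rfl : m = e l := hM' l m fun h => ha (h a)
  obtain ⟨b, hab⟩ := H.exists_costd_of_std R hMb hMT hs' a ha
  -- a morphism not factoring through `a` gives a forbidden endomorphism
  have key : ∀ (l' : Λ) (m : ℤ), wt l' ∈ T → (∀ t ∈ T, ¬ wt l' < t) →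
      ∀ a' : (sg (W.std l'))⟦m⟧ ⟶ M, ∃ u, a' = u ≫ a := by
    intro l' m hl' hl'max a'
    obtain ⟨C, g, h, D⟩ := Dist.exists_cone a
    by_cases hz : a' ≫ g = 0
    · exact D.lift₂ a' hz
    have hsT : Set.Iic (wt l) ⊆ T := fun t ht => hTl ht hs.1
    have hCb : Bdd C := bdd_isTri.third D (bdd_isTri.shift _ _ (bdd_sg _)) hMb
    have hCT : W.Supp wt T C := (H.supp_isTri T).third D ((H.supp_isTri T).shift _ _
      (WeightData.supp_sg (WeightData.filt_mono hsT (H.filt_std l)))) hMT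
    obtain ⟨b', hb'⟩ := H.exists_costd_of_std R hCb hCT hl'max (a' ≫ g) hz
    obtain ⟨f, hf⟩ := H.exists_extend R hCb (H.starPure_cone R D hM b hab) hM' _ b' hb' a'
    have := H.homFinite R hMb hMb
    have : IsIso (g ≫ f) := hMi.isIso_of_comp_eq (k := k) a' (by rintro rfl; simp at hz) _ (by
      rw [← Category.assoc, ← hf])
    refine (ha ?_).elim
    rw [← cancel_mono (g ≫ f), ← Category.assoc, D.comp₁₂, zero_comp, zero_comp]
  have huniq : ∀ (l' : Λ) (m : ℤ) (u : (sg (W.std l'))⟦m⟧ ⟶ (sg (W.std l))⟦e l⟧), wt l' ∈ T →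
      (∀ t ∈ T, ¬ wt l' < t) → u ≫ a ≠ 0 → l' = l := fun l' m u hl' hl'max hu => by
    by_contra hne
    rw [H.hom_std_std_shift R (hl'max _ hs.1) (Or.inl hne) u, zero_comp] at hu
    exact hu rfl
  refine ⟨l, fun j => WeightData.filt_mono (fun t ht => ?_) (hMT j), a, ha, fun l' m hl' a' =>
    key l' m (hl' ▸ hs.1) (by rw [hl']; exact hs') a'⟩
  -- every element of `T` lies below a maximal one, which is the weight of `l`
  obtain ⟨t', htt', ht'⟩ := hT.exists_le_maximal ht
  have ht'' : ∀ t ∈ T, ¬ t' < t := fun t ht h => (ht'.2 ht h.le).not_gt h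
  obtain ⟨l', rfl, m, a', ha'⟩ := hmax t' ht'.1 ht''
  obtain ⟨u, rfl⟩ := key l' m ht'.1 ht'' a'
  rw [huniq l' m u ht'.1 ht'' ha'] at htt'
  exact htt'

/-- If all the morphisms to `M` from the standard objects of maximal weight factor through the
nonzero morphism `a`, then the cone of `a` is supported on smaller weights. -/
lemma supp_cone {l : Λ} {m : ℤ} {M C : DerivedCategory A} (hMb : Bdd M)
    (hMT : W.Supp wt (Set.Iic (wt l)) M) {a : (sg (W.std l))⟦m⟧ ⟶ M}
    {g : M ⟶ C} {h : C ⟶ (sg (W.std l))⟦m⟧⟦(1 : ℤ)⟧} (D : Dist a g h) (ha : a ≠ 0)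
    (huniv : ∀ (l' : Λ) (m : ℤ), wt l' = wt l → ∀ a' : (sg (W.std l'))⟦m⟧ ⟶ M, ∃ u, a' = u ≫ a) :
    W.Supp wt (Set.Iio (wt l)) C := by
  have hCb : Bdd C := bdd_isTri.third D (bdd_isTri.shift _ _ (bdd_sg _)) hMb
  have hCT : W.Supp wt (Set.Iic (wt l)) C := (H.supp_isTri _).third D ((H.supp_isTri _).shift _ _
    (WeightData.supp_sg (H.filt_std l))) hMT
  rw [← Set.Iic_sdiff_right]
  refine H.supp_diff R hCb hCT (fun t ht => not_lt_of_ge ht) fun l' hl' m' c => ?_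
  obtain ⟨b, rfl⟩ := H.lift_cone R D ha (by rw [hl']; exact lt_irrefl _) c
  obtain ⟨u, rfl⟩ := huniv l' m' hl' b
  rw [Category.assoc, D.comp₁₂, comp_zero]

end IsHW

end PureClassification

/-! ### Functors between derived categories -/

section BijHom

variable {C : Type u} [Category.{v} C] {D : Type u'} [Category.{v'} D] (G : C ⥤ D)

/-- `G` induces a bijection on the morphisms from `X` to `Y`. -/
def BijHom (X Y : C) : Prop := Function.Bijective (fun f : X ⟶ Y => G.map f)

variable {G}

lemma BijHom.congr {X Y X' Y' : C} (e : X ≅ X') (e' : Y ≅ Y') (h : BijHom G X Y) :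
    BijHom G X' Y' := by
  constructor
  · intro f f' hf
    dsimp only at hf
    have := h.1 (a₁ := e.hom ≫ f ≫ e'.inv) (a₂ := e.hom ≫ f' ≫ e'.inv) (by simp [hf])
    simpa using this
  · intro g
    obtain ⟨f, hf⟩ := h.2 (G.map e.hom ≫ g ≫ G.map e'.inv)
    dsimp only at hf
    exact ⟨e.inv ≫ f ≫ e'.hom, by
      dsimp only
      rw [G.map_comp, G.map_comp, hf]
      simp only [Category.assoc, ← G.map_comp, ← G.map_comp_assoc, Iso.inv_hom_id,
        CategoryTheory.Functor.map_id, Category.id_comp, Category.comp_id]⟩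

variable [Preadditive C] [Preadditive D] [G.Additive]

lemma BijHom.of_homZero {X Y : C} (h : HomZero X Y) (h' : HomZero (G.obj X) (G.obj Y)) :
    BijHom G X Y :=
  ⟨fun f f' _ => (h f).trans (h f').symm, fun g => ⟨0, by dsimp only; rw [G.map_zero, h' g]⟩⟩

lemma BijHom.homZero_iff {X Y : C} (h : BijHom G X Y) :
    HomZero (G.obj X) (G.obj Y) ↔ HomZero X Y :=
  ⟨fun h' f => h.1 (by dsimp only; rw [h' (G.map f), G.map_zero]), fun h' g => by
    obtain ⟨f, rfl⟩ := h.2 g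
    dsimp only
    rw [h' f, G.map_zero]⟩

end BijHom

section TriangulatedFunctor

open Pretriangulated

variable {C : Type u} [Category.{v} C] [Preadditive C] [HasZeroObject C] [HasShift C ℤ]
  [∀ n : ℤ, (shiftFunctor C n).Additive] [Pretriangulated C]
  {D : Type u'} [Category.{v'} D] [Preadditive D] [HasZeroObject D] [HasShift D ℤ]
  [∀ n : ℤ, (shiftFunctor D n).Additive] [Pretriangulated D]
  (G : C ⥤ D) [G.CommShift ℤ] [G.IsTriangulated]

lemma Dist.map {X Y Z : C} {f : X ⟶ Y} {g : Y ⟶ Z} {h : Z ⟶ X⟦(1 : ℤ)⟧} (T : Dist f g h) :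
    Dist (G.map f) (G.map g) (G.map h ≫ (G.commShiftIso (1 : ℤ)).hom.app X) :=
  G.map_distinguished _ T

lemma IsTri.comap {P : D → Prop} (hP : IsTri P) : IsTri (fun X => P (G.obj X)) where
  zero _ hX := hP.zero _ (Functor.map_isZero G hX)
  of_iso e h := hP.of_iso (G.mapIso e) h
  shift n _ h := hP.of_iso ((G.commShiftIso n).app _).symm (hP.shift n _ h)
  ext T h₁ h₃ := hP.ext (T.map G) h₁ h₃

variable {G}

omit [HasZeroObject C] [Pretriangulated C] [HasZeroObject D] [Pretriangulated D]
  [G.IsTriangulated] [Preadditive C] [∀ n : ℤ, (shiftFunctor C n).Additive] [Preadditive D]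
  [∀ n : ℤ, (shiftFunctor D n).Additive] in
lemma BijHom.shift {X Y : C} (h : BijHom G X Y) (n : ℤ) : BijHom G (X⟦n⟧) (Y⟦n⟧) := by
  have key : ∀ f : X ⟶ Y, G.map (f⟦n⟧') = (G.commShiftIso n).hom.app X ≫ (G.map f)⟦n⟧' ≫
      (G.commShiftIso n).inv.app Y := fun f =>
    (NatIso.naturality_2 (G.commShiftIso n) f).symm
  constructor
  · intro f f' hf
    obtain ⟨f, rfl⟩ := (shiftFunctor C n).map_surjective f
    obtain ⟨f', rfl⟩ := (shiftFunctor C n).map_surjective f'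
    dsimp only at hf
    rw [key, key, cancel_epi, cancel_mono] at hf
    rw [h.1 ((shiftFunctor D n).map_injective hf)]
  · intro g
    obtain ⟨g', hg'⟩ := (shiftFunctor D n).map_surjective
      ((G.commShiftIso n).inv.app X ≫ g ≫ (G.commShiftIso n).hom.app Y)
    obtain ⟨f, rfl⟩ := h.2 g'
    exact ⟨f⟦n⟧', by dsimp only at hg' ⊢; rw [key, hg']; simp⟩

section

variable {X Y Z : C} {f : X ⟶ Y} {g : Y ⟶ Z} {h : Z ⟶ X⟦(1 : ℤ)⟧} (T : Dist f g h)

include T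

lemma BijHom.of_dist_left {N : C} (h₁ : BijHom G X N) (h₃ : BijHom G Z N)
    (h₁' : BijHom G (X⟦(1 : ℤ)⟧) N) (h₃' : BijHom G (Z⟦(-1 : ℤ)⟧) N) : BijHom G Y N := by
  constructor
  · refine (injective_iff_map_eq_zero (G.mapAddHom (X := Y) (Y := N))).2 fun a ha => ?_
    replace ha : G.map a = 0 := ha
    obtain ⟨b, rfl⟩ := T.desc₂ a (h₁.1 (by dsimp only; rw [G.map_comp, ha, comp_zero, G.map_zero]))
    rw [G.map_comp] at ha
    obtain ⟨ψ, hψ⟩ := (T.map G).desc₃ _ ha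
    obtain ⟨χ, hχ⟩ := h₁'.2 ((G.commShiftIso (1 : ℤ)).hom.app X ≫ ψ)
    dsimp only at hχ
    have hb : b = h ≫ χ := h₃.1 (by dsimp only; rw [hψ, G.map_comp, hχ, Category.assoc])
    rw [hb, ← Category.assoc, T.comp₂₃, zero_comp]
  · intro y
    obtain ⟨x, hx⟩ := h₁.2 (G.map f ≫ y)
    dsimp only at hx
    obtain ⟨y', rfl⟩ := T.inv_rot.desc₂ x (h₃'.1 (by
      dsimp only
      rw [G.map_comp, hx, ← Category.assoc, ← G.map_comp, T.inv_rot.comp₁₂, G.map_zero, G.map_zero,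
        zero_comp]))
    obtain ⟨z, hz⟩ := (T.map G).desc₂ (y - G.map y') (by
      rw [Preadditive.comp_sub, ← hx, G.map_comp, sub_self])
    obtain ⟨z, rfl⟩ := h₃.2 z
    refine ⟨y' + g ≫ z, ?_⟩
    dsimp only
    rw [G.map_add, G.map_comp, ← hz]
    abel

lemma BijHom.of_dist_right {N : C} (h₁ : BijHom G N X) (h₃ : BijHom G N Z)
    (h₁' : BijHom G N (X⟦(1 : ℤ)⟧)) (h₃' : BijHom G N (Z⟦(-1 : ℤ)⟧)) : BijHom G N Y := by
  constructor
  · refine (injective_iff_map_eq_zero (G.mapAddHom (X := N) (Y := Y))).2 fun a ha => ?_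
    replace ha : G.map a = 0 := ha
    obtain ⟨b, rfl⟩ := T.lift₂ a (h₃.1 (by dsimp only; rw [G.map_comp, ha, zero_comp, G.map_zero]))
    rw [G.map_comp] at ha
    obtain ⟨ψ, hψ⟩ := (T.inv_rot.map G).lift₂ _ ha
    obtain ⟨χ, rfl⟩ := h₃'.2 ψ
    dsimp only at hψ
    rw [← G.map_comp] at hψ
    rw [h₁.1 hψ, Category.assoc, T.inv_rot.comp₁₂, comp_zero]
  · intro y
    obtain ⟨z, hz⟩ := h₃.2 (y ≫ G.map g)
    dsimp only at hz
    obtain ⟨y', rfl⟩ := T.lift₃ z (h₁'.1 (by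
      dsimp only
      rw [G.map_comp, hz, Category.assoc, ← G.map_comp, T.comp₂₃, G.map_zero, G.map_zero,
        comp_zero]))
    obtain ⟨x, hx⟩ := (T.map G).lift₂ (y - G.map y') (by
      rw [Preadditive.sub_comp, ← hz, G.map_comp, sub_self])
    obtain ⟨x, rfl⟩ := h₁.2 x
    refine ⟨y' + x ≫ f, ?_⟩
    dsimp only
    rw [G.map_add, G.map_comp, ← hx]
    abel

end

/-- Dévissage for full faithfulness in the first variable. -/
lemma isTri_bijHom_left (N : C) : IsTri (fun M : C => ∀ n : ℤ, BijHom G (M⟦n⟧) N) where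
  zero X hX n := .of_homZero (.of_isZero_left (Functor.map_isZero _ hX))
    (.of_isZero_left (Functor.map_isZero _ (Functor.map_isZero _ hX)))
  of_iso e h n := (h n).congr ((shiftFunctor C n).mapIso e) (Iso.refl _)
  shift n X h m := (h (n + m)).congr ((shiftFunctorAdd C n m).app X) (Iso.refl _)
  ext T h₁ h₃ n := by
    obtain ⟨h', T'⟩ := T.shift n
    exact .of_dist_left T' (h₁ n) (h₃ n)
      ((h₁ (n + 1)).congr ((shiftFunctorAdd C n 1).app _) (Iso.refl _))
      ((h₃ (n + -1)).congr ((shiftFunctorAdd C n (-1)).app _) (Iso.refl _))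

/-- Dévissage for full faithfulness in the second variable. -/
lemma isTri_bijHom_right (M : C) : IsTri (fun N : C => ∀ n : ℤ, BijHom G M (N⟦n⟧)) where
  zero X hX n := .of_homZero (.of_isZero_right (Functor.map_isZero _ hX))
    (.of_isZero_right (Functor.map_isZero _ (Functor.map_isZero _ hX)))
  of_iso e h n := (h n).congr (Iso.refl _) ((shiftFunctor C n).mapIso e)
  shift n X h m := (h (n + m)).congr (Iso.refl _) ((shiftFunctorAdd C n m).app X)
  ext T h₁ h₃ n := by
    obtain ⟨h', T'⟩ := T.shift n
    exact .of_dist_right T' (h₁ n) (h₃ n)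
      ((h₁ (n + 1)).congr (Iso.refl _) ((shiftFunctorAdd C n 1).app _))
      ((h₃ (n + -1)).congr (Iso.refl _) ((shiftFunctorAdd C n (-1)).app _))

end TriangulatedFunctor

section MapDerivedCategory

open DerivedCategory

variable {A : Type u} [Category.{v} A] [Abelian A] [HasDerivedCategory.{w} A]
  {B : Type u'} [Category.{v'} B] [Abelian B] [HasDerivedCategory.{w'} B]
  (F : B ⥤ A) [F.Additive] [PreservesFiniteLimits F] [PreservesFiniteColimits F]

/-- The image of an object of the heart is the object given by the exact functor. -/
noncomputable def mapSgIso (X : B) : F.mapDerivedCategory.obj (sg X) ≅ sg (F.obj X) :=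
  (F.mapDerivedCategorySingleFunctor 0).app X

/-- The image of a shifted object of the heart. -/
noncomputable def mapSgShiftIso (X : B) (n : ℤ) :
    F.mapDerivedCategory.obj ((sg X)⟦n⟧) ≅ (sg (F.obj X))⟦n⟧ :=
  (F.mapDerivedCategory.commShiftIso n).app _ ≪≫ (shiftFunctor _ n).mapIso (mapSgIso F X)

variable {F}

lemma bijHom_sg {X Y : B} (h : Function.Bijective (fun f : X ⟶ Y => F.map f)) :
    BijHom F.mapDerivedCategory (sg X) (sg Y) := by
  have key : ∀ f : X ⟶ Y, F.mapDerivedCategory.map ((singleFunctor B 0).map f) =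
      (mapSgIso F X).hom ≫ (singleFunctor A 0).map (F.map f) ≫ (mapSgIso F Y).inv := fun f =>
    (NatIso.naturality_2 (F.mapDerivedCategorySingleFunctor 0) f).symm
  constructor
  · intro f f' hf
    obtain ⟨f, rfl⟩ := (singleFunctor B 0).map_surjective f
    obtain ⟨f', rfl⟩ := (singleFunctor B 0).map_surjective f'
    dsimp only at hf
    rw [key, key, cancel_epi, cancel_mono] at hf
    rw [h.1 ((singleFunctor A 0).map_injective hf)]
  · intro g
    obtain ⟨g', hg'⟩ :=
      (singleFunctor A 0).map_surjective ((mapSgIso F X).inv ≫ g ≫ (mapSgIso F Y).hom)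
    obtain ⟨f, rfl⟩ := h.2 g'
    exact ⟨(singleFunctor B 0).map f, by dsimp only at hg' ⊢; rw [key, hg']; simp⟩

lemma bijHom_sg_shift {X Y : B} (h : Function.Bijective (fun f : X ⟶ Y => F.map f))
    (h' : ∀ n : ℤ, n ≠ 0 → HomZero (sg X) ((sg Y)⟦n⟧))
    (h'' : ∀ n : ℤ, n ≠ 0 → HomZero (sg (F.obj X)) ((sg (F.obj Y))⟦n⟧)) (n : ℤ) :
    BijHom F.mapDerivedCategory (sg X) ((sg Y)⟦n⟧) := by
  by_cases hn : n = 0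
  · subst hn
    exact (bijHom_sg h).congr (Iso.refl _) ((shiftFunctorZero _ ℤ).app _).symm
  · exact .of_homZero (h' n hn)
      (((h'' n hn).congr_left (mapSgIso F X).symm).congr_right (mapSgShiftIso F Y n).symm)

/-- The essential image of a fully faithful triangulated functor is a triangulated subcategory. -/
lemma isTri_essImage
    (hF : ∀ X Y : DerivedCategory B, Bdd X → Bdd Y → BijHom F.mapDerivedCategory X Y) :
    IsTri (fun N : DerivedCategory A => ∃ M : DerivedCategory B, Bdd M ∧
      Nonempty (F.mapDerivedCategory.obj M ≅ N)) where
  zero X hX := ⟨sg (⊥_ B), bdd_sg _, ⟨(Functor.map_isZero _ (Functor.map_isZero _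
    ((isZero_zero B).of_iso (initialIsInitial.uniqueUpToIso (isZero_zero B).isInitial)))).iso hX⟩⟩
  of_iso e := fun ⟨M, hM, ⟨i⟩⟩ => ⟨M, hM, ⟨i ≪≫ e⟩⟩
  shift n X := fun ⟨M, hM, ⟨i⟩⟩ => ⟨M⟦n⟧, bdd_isTri.shift n M hM,
    ⟨(F.mapDerivedCategory.commShiftIso n).app M ≪≫ (shiftFunctor _ n).mapIso i⟩⟩
  ext {X Y Z f g h} T := by
    rintro ⟨M, hM, ⟨i⟩⟩ ⟨N, hN, ⟨j⟩⟩
    obtain ⟨h', hh'⟩ := (hF N (M⟦(1 : ℤ)⟧) hN (bdd_isTri.shift 1 M hM)).2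
      (j.hom ≫ h ≫ i.inv⟦(1 : ℤ)⟧' ≫ (F.mapDerivedCategory.commShiftIso (1 : ℤ)).inv.app M)
    dsimp only at hh'
    obtain ⟨K, f', g', T'⟩ := Dist.exists_middle h'
    have w : (F.mapDerivedCategory.map h' ≫ (F.mapDerivedCategory.commShiftIso (1 : ℤ)).hom.app M) ≫
        i.hom⟦(1 : ℤ)⟧' = j.hom ≫ h := by
      have h1 : (shiftFunctor (DerivedCategory A) (1 : ℤ)).map i.inv ≫
          (shiftFunctor (DerivedCategory A) (1 : ℤ)).map i.hom = 𝟙 _ := by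
        rw [← Functor.map_comp, Iso.inv_hom_id, CategoryTheory.Functor.map_id]
      rw [hh']
      simp only [Category.assoc, Iso.inv_hom_id_app]
      erw [Category.id_comp, h1, Category.comp_id]
    obtain ⟨b, hb₁, hb₂⟩ := (T'.map F.mapDerivedCategory).complete₂ T i.hom j.hom w
    have := (T'.map F.mapDerivedCategory).isIso₂ T hb₁ hb₂ w
    exact ⟨K, bdd_isTri.ext T' hM hN, ⟨asIso b⟩⟩

variable {C : Type u₁} [Category.{v₁} C] [Abelian C] [HasDerivedCategory.{w₁} C]

/-- Compatibility of the formation of `mapDerivedCategory` with composition. -/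
noncomputable def mapDerivedCategoryComp {F' : A ⥤ C} [F'.Additive] [PreservesFiniteLimits F']
    [PreservesFiniteColimits F'] {K : B ⥤ C} [K.Additive] [PreservesFiniteLimits K]
    [PreservesFiniteColimits K] (e : F ⋙ F' ≅ K) :
    F.mapDerivedCategory ⋙ F'.mapDerivedCategory ≅ K.mapDerivedCategory :=
  letI L : Localization.Lifting Q (HomologicalComplex.quasiIso B (ComplexShape.up ℤ))
      (F.mapHomologicalComplex (ComplexShape.up ℤ) ⋙ F'.mapHomologicalComplex _ ⋙ Q)
      (F.mapDerivedCategory ⋙ F'.mapDerivedCategory) :=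
    ⟨(Functor.associator _ _ _).symm ≪≫ Functor.isoWhiskerRight F.mapDerivedCategoryFactors _ ≪≫
      Functor.associator _ _ _ ≪≫ Functor.isoWhiskerLeft _ F'.mapDerivedCategoryFactors⟩
  Localization.liftNatIso Q (HomologicalComplex.quasiIso B (ComplexShape.up ℤ))
    (F.mapHomologicalComplex (ComplexShape.up ℤ) ⋙ F'.mapHomologicalComplex _ ⋙ Q)
    (K.mapHomologicalComplex _ ⋙ Q) _ _
    (Functor.isoWhiskerRight (NatIso.ofComponents (fun X => HomologicalComplex.Hom.isoOfComponents
      (fun i => e.app (X.X i)) (fun i j _ => (e.hom.naturality (X.d i j)).symm))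
      (fun f => by ext i; exact e.hom.naturality (f.f i)) :
      F.mapHomologicalComplex (ComplexShape.up ℤ) ⋙ F'.mapHomologicalComplex _ ≅
        K.mapHomologicalComplex _) Q)

/-- An exact functor isomorphic to the identity functor induces the identity functor. -/
noncomputable def mapDerivedCategoryId {K : B ⥤ B} [K.Additive] [PreservesFiniteLimits K]
    [PreservesFiniteColimits K] (e : K ≅ 𝟭 B) : K.mapDerivedCategory ≅ 𝟭 (DerivedCategory B) :=
  letI L : Localization.Lifting Q (HomologicalComplex.quasiIso B (ComplexShape.up ℤ)) Q
      (𝟭 (DerivedCategory B)) := ⟨Functor.rightUnitor _⟩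
  Localization.liftNatIso Q (HomologicalComplex.quasiIso B (ComplexShape.up ℤ))
    (K.mapHomologicalComplex (ComplexShape.up ℤ) ⋙ Q) Q _ _
    (Functor.isoWhiskerRight (NatIso.ofComponents (fun X => HomologicalComplex.Hom.isoOfComponents
      (fun i => e.app (X.X i)) (fun i j _ => (e.hom.naturality (X.d i j)).symm))
      (fun f => by ext i; exact e.hom.naturality (f.f i)) :
      K.mapHomologicalComplex (ComplexShape.up ℤ) ≅ 𝟭 _) Q ≪≫ Functor.leftUnitor _)

end MapDerivedCategory

/-! ### Restriction to Serre subcategories -/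

section Restriction

variable {A : Type u} [Category.{v} A] [Abelian A] {Λ : Type x} {S : Type y}

lemma shortExact_of_ι (P : ObjectProperty A) [P.IsSerreClass] {X : ShortComplex P.FullSubcategory}
    (h : (X.map P.ι).ShortExact) : X.ShortExact where
  exact := (X.exact_map_iff_of_faithful P.ι).1 h.exact
  mono_f := P.ι.mono_of_mono_map h.mono_f
  epi_g := P.ι.epi_of_epi_map h.epi_g

/-- The data of `L`, `Δ`, `∇` with weights in `T`, in a subcategory containing these objects. -/
def WeightData.restrict (W : WeightData A Λ) (wt : Λ → S) (P : ObjectProperty A) (T : Set S)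
    (h : ∀ l, wt l ∈ T → P (W.L l) ∧ P (W.std l) ∧ P (W.costd l)) :
    WeightData P.FullSubcategory {l // wt l ∈ T} where
  L l := ⟨W.L l, (h l l.2).1⟩
  std l := ⟨W.std l, (h l l.2).2.1⟩
  costd l := ⟨W.costd l, (h l l.2).2.2⟩
  π l := ObjectProperty.homMk (W.π l)
  i l := ObjectProperty.homMk (W.i l)

variable {W : WeightData A Λ} {wt : Λ → S} {P : ObjectProperty A} [P.IsSerreClass] {T : Set S}
  (h : ∀ l, wt l ∈ T → P (W.L l) ∧ P (W.std l) ∧ P (W.costd l))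

lemma filt_restrict {T' : Set S} (hT' : T' ⊆ T) (hT'P : ∀ X, W.filt wt T' X → P X)
    {X : P.FullSubcategory} (hX : W.filt wt T' X.obj) :
    (W.restrict wt P T h).filt (fun l => wt l) T' X := by
  suffices ∀ Y : A, W.filt wt T' Y → ∀ X : P.FullSubcategory, (X.obj ≅ Y) →
    (W.restrict wt P T h).filt (fun l => wt l) T' X from this _ hX _ (Iso.refl _)
  intro Y hY
  induction hY with
  | of hμ =>
    obtain ⟨μ, hμ, rfl⟩ := hμ
    intro X e
    exact .of_iso (P.fullyFaithfulι.preimageIso (X := (W.restrict wt P T h).L ⟨μ, hT' hμ⟩) (Y := X)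
      e.symm) (.of ⟨⟨μ, hT' hμ⟩, hμ, rfl⟩)
  | zero hz =>
    intro X e
    refine .zero ((IsZero.iff_id_eq_zero _).2 (P.ι.map_injective ((hz.of_iso e).eq_of_src _ _)))
  | @ext S' hS h₁ h₃ ih₁ ih₃ =>
    intro X e
    let Z : ShortComplex P.FullSubcategory :=
      ShortComplex.mk (X₁ := ⟨S'.X₁, hT'P _ h₁⟩) (X₂ := ⟨S'.X₂, hT'P _ (.ext hS h₁ h₃)⟩)
        (X₃ := ⟨S'.X₃, hT'P _ h₃⟩) (ObjectProperty.homMk S'.f) (ObjectProperty.homMk S'.g)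
        (P.ι.map_injective S'.zero)
    have hZ : Z.ShortExact := shortExact_of_ι P hS
    exact .of_iso (P.fullyFaithfulι.preimageIso (X := Z.X₂) (Y := X) e.symm)
      (.ext hZ (ih₁ Z.X₁ (Iso.refl _)) (ih₃ Z.X₃ (Iso.refl _)))

lemma filt_of_restrict {T' : Set S} {X : P.FullSubcategory}
    (hX : (W.restrict wt P T h).filt (fun l => wt l) T' X) : W.filt wt T' X.obj := by
  induction hX with
  | of hμ =>
    obtain ⟨μ, hμ, rfl⟩ := hμ
    exact .of ⟨μ.1, hμ, rfl⟩
  | zero hz => exact .zero (P.ι.map_isZero hz)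
  | ext hS _ _ ih₁ ih₃ => exact .ext (hS.map_of_exact P.ι) ih₁ ih₃

/-- A covering of an object of `A_T` by standard objects of `A_T` is a covering in `A_T`. The
equality `Y = Q.obj` is there for the induction, in which the target is an index. -/
lemma Cov.restrict {Q : P.FullSubcategory} {X Y : A} {p : X ⟶ Y} (hp : Cov W wt T p)
    (e : Y = Q.obj) : ∃ (X' : P.FullSubcategory) (hX' : X'.obj = X) (p' : X' ⟶ Q),
      Cov (W.restrict wt P T h) (fun l => wt l) Set.univ p' ∧
        P.ι.map p' = eqToHom hX' ≫ p ≫ eqToHom e := by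
  induction hp with
  | id Y => exact ⟨Q, e.symm, 𝟙 _, .id _, by simp⟩
  | @step l hl X' X Y i q p w hS hp ih =>
    obtain ⟨Z, rfl, p', hp', hpe⟩ := ih e
    have hX' : P X' := P.prop_X₂_of_shortExact hS (h l hl).2.1 Z.property
    let K : ShortComplex P.FullSubcategory :=
      ShortComplex.mk (X₁ := (W.restrict wt P T h).std ⟨l, hl⟩) (X₂ := ⟨X', hX'⟩)
        (X₃ := Z) (ObjectProperty.homMk i) (ObjectProperty.homMk q)
        (P.ι.map_injective w)
    have hK : K.ShortExact := shortExact_of_ι P hS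
    refine ⟨_, rfl, _, @Cov.step _ _ _ _ _ _ _ _ ⟨l, hl⟩ (Set.mem_univ _) _ _ _ K.f K.g p' K.zero hK
      hp', ?_⟩
    rw [Functor.map_comp, hpe]
    simp [K]

/-- The refinements in `A` of epimorphisms of `A_T` lie in `A_T`, so that the higher extensions
between standard and costandard objects vanish in `A_T` as well. -/
lemma Refines.restrict (hP : ∀ X, P X ↔ W.filt wt T X) (R : Refines W wt T) :
    Refines (W.restrict wt P T h) (fun l => wt l) Set.univ := by
  intro l _ X f hf _
  obtain ⟨X', p, v, hp, hv⟩ := R l.1 l.2 (P.ι.map f)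
    (P.ι.map_epi f) ((hP _).1 X.property)
  obtain ⟨Z, rfl, p', hp', hpe⟩ := hp.restrict h (Q := (W.restrict wt P T h).std l) rfl
  refine ⟨Z, p', ObjectProperty.homMk v, hp', P.ι.map_injective ?_⟩
  exact (P.ι.map_comp _ _).trans (hv.trans
    (hpe.trans ((Category.id_comp _).trans (Category.comp_id _))).symm)

variable [PartialOrder S]

namespace IsHW

variable {k : Type w'} [Field k] [Linear k A] (H : IsHW k W wt)
  (hT : IsLowerSet T) (hP : ∀ X, P X ↔ W.filt wt T X)

include hP

include H hT

/-- The category `A_T` is again a highest weight category, for a lower set `T`. -/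
lemma restrict : IsHW k (W.restrict wt P T h) (fun l => wt l) where
  finite_Iic := H.finite_Iic
  simple l := ⟨fun {Y} f _ => by
    have : Simple (P.ι.obj ((W.restrict wt P T h).L l)) := H.simple l
    have h1 := Simple.mono_isIso_iff_nonzero (P.ι.map f)
    rw [← isIso_iff_of_reflects_iso f P.ι]
    exact h1.trans (not_congr P.ι.map_eq_zero_iff)⟩
  hom_simple l m hlm := (homZero_map_iff P.ι).1 (H.hom_simple l m fun e => hlm (Subtype.ext e))
  end_simple l f := by
    obtain ⟨c, hc⟩ := H.end_simple l (P.ι.map f)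
    exact ⟨c, P.ι.map_injective (by rw [hc]; rfl)⟩
  epi_π l := P.ι.epi_of_epi_map (H.epi_π l)
  mono_i l := P.ι.mono_of_mono_map (H.mono_i l)
  kernel_mem l := filt_restrict h (fun t ht => hT (le_of_lt ht) l.2)
    (fun X hX => (hP X).2 (WeightData.filt_mono (fun t ht => hT (le_of_lt ht) l.2) hX))
    (ExtClosure.of_iso (PreservesKernel.iso P.ι ((W.restrict wt P T h).π l)).symm (H.kernel_mem l))
  cokernel_mem l := filt_restrict h (fun t ht => hT (le_of_lt ht) l.2)
    (fun X hX => (hP X).2 (WeightData.filt_mono (fun t ht => hT (le_of_lt ht) l.2) hX))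
    (ExtClosure.of_iso (PreservesCokernel.iso P.ι ((W.restrict wt P T h).i l)).symm
      (H.cokernel_mem l))
  hom_std l m hlm := (homZero_map_iff P.ι).1 (H.hom_std l m fun e => hlm (Subtype.ext e))
  hom_costd l m hlm := (homZero_map_iff P.ι).1 (H.hom_costd l m fun e => hlm (Subtype.ext e))
  std_split l m hlm E f g w hS := by
    obtain ⟨s, hs⟩ := H.std_split l m hlm (P.ι.map f) (P.ι.map g)
      ((P.ι.map_comp f g).symm.trans ((congrArg P.ι.map w).trans (P.ι.map_zero _ _)))
      (hS.map_of_exact P.ι)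
    exact ⟨ObjectProperty.homMk s, P.ι.map_injective hs⟩
  costd_split l m hlm E f g w hS := by
    obtain ⟨s, hs⟩ := H.costd_split l m hlm (P.ι.map f) (P.ι.map g)
      ((P.ι.map_comp f g).symm.trans ((congrArg P.ι.map w).trans (P.ι.map_zero _ _)))
      (hS.map_of_exact P.ι)
    exact ⟨ObjectProperty.homMk s, P.ι.map_injective hs⟩
  filt_univ X := WeightData.filt_mono (Set.subset_univ _) (filt_restrict h subset_rfl
    (fun X hX => (hP X).2 hX) ((hP _).1 X.property))

variable [HasDerivedCategory.{w} A] [HasDerivedCategory.{w₁} P.FullSubcategory]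

include h in
lemma supp_ι {M : DerivedCategory P.FullSubcategory} (hM : Bdd M) :
    W.Supp wt T (P.ι.mapDerivedCategory.obj M) :=
  (H.restrict h hT hP).of_std ((H.supp_isTri T).comap P.ι.mapDerivedCategory) isLowerSet_univ
    (fun l _ => (H.supp_isTri T).of_iso (mapSgIso P.ι _).symm (WeightData.supp_sg
      (WeightData.filt_mono (fun _ ht => hT ht l.2) (H.filt_std l))))
    hM ((H.restrict h hT hP).supp_univ M)

variable (R : Refines W wt Set.univ) (R' : Refines (W.restrict wt P T h) (fun l => wt l) Set.univ)

include R R' h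

/-- The inclusion of `A_T` induces a fully faithful functor on bounded derived categories. -/
lemma bijHom_ι {M N : DerivedCategory P.FullSubcategory} (hM : Bdd M) (hN : Bdd N) :
    BijHom P.ι.mapDerivedCategory M N := by
  have H' := H.restrict h hT hP
  have h1 : ∀ l m n, BijHom P.ι.mapDerivedCategory (sg ((W.restrict wt P T h).std l))
      ((sg ((W.restrict wt P T h).costd m))⟦(n : ℤ)⟧) := fun l m n =>
    bijHom_sg_shift ⟨P.ι.map_injective, P.ι.map_surjective⟩
      (fun n hn => H'.ext_std_costd R' l m hn) (fun n hn => H.ext_std_costd R l m hn) n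
  have h2 : ∀ l, ∀ n : ℤ, BijHom P.ι.mapDerivedCategory (sg ((W.restrict wt P T h).std l)) (N⟦n⟧) :=
    fun l => H'.of_costd (isTri_bijHom_right _) isLowerSet_univ (fun m _ n => h1 l m n) hN
      (H'.supp_univ N)
  have h3 : ∀ n : ℤ, BijHom P.ι.mapDerivedCategory (M⟦n⟧) N := by
    refine H'.of_std (isTri_bijHom_left N) isLowerSet_univ (fun l _ n => ?_) hM (H'.supp_univ M)
    exact ((h2 l (-n)).shift n).congr (Iso.refl _) ((shiftFunctorCompIsoId _ (-n) n (by lia)).app N)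
  exact (h3 0).congr ((shiftFunctorZero _ ℤ).app M) (Iso.refl N)

/-- The bounded objects supported on `T` come from the derived category of `A_T`. -/
lemma exists_ι_iso {N : DerivedCategory A} (hN : Bdd N) (hNT : W.Supp wt T N) :
    ∃ M : DerivedCategory P.FullSubcategory, Bdd M ∧
      Nonempty (P.ι.mapDerivedCategory.obj M ≅ N) :=
  H.of_std (isTri_essImage fun _ _ hX hY => H.bijHom_ι h hT hP R R' hX hY) hT
    (fun l hl => ⟨sg ((W.restrict wt P T h).std ⟨l, hl⟩), bdd_sg _, ⟨mapSgIso P.ι _⟩⟩) hN hNT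

end IsHW

end Restriction

/-! ### Graded highest weight categories as highest weight categories -/

section Graded

variable {A : Type u} [Category.{v} A] [Abelian A] [HasShift A ℤ] {S : Type x}

/-- The data of the objects `L s⟨n⟩`, `Δ s⟨n⟩`, `∇ s⟨n⟩`, indexed by the pairs `(s, n)`. -/
def WeightData.gr (D : WeightData A S) : WeightData A (S × ℤ) where
  L l := (D.L l.1)⟦l.2⟧
  std l := (D.std l.1)⟦l.2⟧
  costd l := (D.costd l.1)⟦l.2⟧
  π l := (D.π l.1)⟦l.2⟧'
  i l := (D.i l.1)⟦l.2⟧'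

variable [PartialOrder S] {D : WeightData A S} {k : Type y} [Field k] [Linear k A]

namespace WeightData.IsGradedHighestWeight

variable (h : D.IsGradedHighestWeight k)

include h

lemma simple_gr (l : S × ℤ) : Simple (D.gr.L l) := by
  have := h.simple l.1
  exact simple_obj (shiftFunctor A l.2) (D.L l.1)

lemma serre_iff (T : Set S) (X : A) : D.serre T X ↔ D.gr.filt Prod.fst T X := by
  have e : (fun X => ∃ t ∈ T, ∃ n : ℤ, X = (shiftFunctor A n).obj (D.L t)) =
      (fun X => ∃ l : S × ℤ, l.1 ∈ T ∧ X = D.gr.L l) := by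
    funext X
    exact propext ⟨fun ⟨t, ht, n, e⟩ => ⟨⟨t, n⟩, ht, e⟩, fun ⟨⟨t, n⟩, ht, e⟩ => ⟨t, ht, n, e⟩⟩
  unfold serre filt
  rw [e, serreClosure_eq_extClosure]
  rintro _ ⟨l, -, rfl⟩
  exact h.simple_gr l

/-- Epimorphisms of `A_T` to the projective object `Δ s` split. -/
lemma cover (T : Set S) (s : S) (hT : IsLowerSet T) (hs : Maximal (· ∈ T) s) {X : A}
    (hX : D.serre T X) (g : X ⟶ D.std s) [Epi g] : ∃ a, a ≫ g = 𝟙 _ := by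
  obtain ⟨hL, hΔ, hp⟩ := h.projective_cover T s hT hs
  have := hp.projective
  let g' : (⟨X, hX⟩ : (D.serre T).FullSubcategory) ⟶ ⟨D.std s, hΔ⟩ := ObjectProperty.homMk g
  have : Epi g' := (D.serre T).ι.epi_of_epi_map ‹Epi g›
  exact ⟨(Projective.factorThru (𝟙 _) g').hom,
    congrArg (fun f => f.hom) (Projective.factorThru_comp (𝟙 _) g')⟩

/-- Monomorphisms of `A_T` from the injective object `∇ s` split. -/
lemma envelope (T : Set S) (s : S) (hT : IsLowerSet T) (hs : Maximal (· ∈ T) s) {X : A}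
    (hX : D.serre T X) (g : D.costd s ⟶ X) [Mono g] : ∃ a, g ≫ a = 𝟙 _ := by
  obtain ⟨hL, hN, hp⟩ := h.injective_envelope T s hT hs
  have := hp.injective
  let g' : (⟨D.costd s, hN⟩ : (D.serre T).FullSubcategory) ⟶ ⟨X, hX⟩ := ObjectProperty.homMk g
  have : Mono g' := (D.serre T).ι.mono_of_mono_map ‹Mono g›
  exact ⟨(Injective.factorThru (𝟙 _) g').hom,
    congrArg (fun f => f.hom) (Injective.comp_factorThru (𝟙 _) g')⟩

omit h in
lemma maximal_Iic (s : S) : Maximal (· ∈ Set.Iic s) s := ⟨le_refl s, fun _ hy _ => hy⟩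

lemma epi_π (s : S) : Epi (D.π s) := by
  obtain ⟨hL, hΔ, hp⟩ := h.projective_cover _ s (isLowerSet_Iic s) (maximal_Iic s)
  have := hp.epi
  exact (D.serre (Set.Iic s)).ι.map_epi (ObjectProperty.homMk (D.π s) :
    (⟨D.std s, hΔ⟩ : (D.serre (Set.Iic s)).FullSubcategory) ⟶ ⟨D.L s, hL⟩)

lemma mono_i (s : S) : Mono (D.i s) := by
  obtain ⟨hL, hN, hp⟩ := h.injective_envelope _ s (isLowerSet_Iic s) (maximal_Iic s)
  have := hp.mono
  exact (D.serre (Set.Iic s)).ι.map_mono (ObjectProperty.homMk (D.i s) :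
    (⟨D.L s, hL⟩ : (D.serre (Set.Iic s)).FullSubcategory) ⟶ ⟨D.costd s, hN⟩)

variable [∀ n : ℤ, (shiftFunctor A n).Additive]

lemma hom_simple_gr (l m : S × ℤ) (hlm : l ≠ m) : HomZero (D.gr.L l) (D.gr.L m) := by
  obtain ⟨s, a⟩ := l
  obtain ⟨t, b⟩ := m
  refine (homZero_shift_iff (b - a) (by lia)).2 fun f => ?_
  by_contra hf
  have := h.simple s
  have : Simple ((D.L t)⟦b - a⟧) := h.simple_gr (t, b - a)
  have : IsIso f := isIso_of_hom_simple hf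
  obtain rfl := h.eq_of_iso s t (b - a) ⟨asIso f⟩
  exact hf (h.hom_eq_zero s (b - a) (fun e => hlm (by rw [sub_eq_zero.1 e])) f)

/-- The simple object `L s` is the only simple quotient of `Δ s`. -/
lemma hom_std_gr (l m : S × ℤ) (hlm : l ≠ m) : HomZero (D.gr.std l) (D.gr.L m) := by
  obtain ⟨s, a⟩ := l
  obtain ⟨t, b⟩ := m
  refine (homZero_shift_iff (b - a) (by lia)).2 fun g => ?_
  by_contra hg
  have := h.simple s
  have : Simple ((D.L t)⟦b - a⟧) := h.simple_gr (t, b - a)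
  have := h.epi_π s
  have : Epi g := epi_of_nonzero_to_simple hg
  by_cases h0 : kernel.ι g ≫ D.π s = 0
  · have hd : g ≫ Abelian.epiDesc g (D.π s) h0 = D.π s := Abelian.comp_epiDesc _ _ _
    have hz : Abelian.epiDesc g (D.π s) h0 = 0 :=
      (homZero_shift_left_iff (X := D.L t) (Y := D.L s) (a := b - a) (a - b) (by lia)).2
        ((homZero_shift_iff (a - b) (by lia)).1
          (h.hom_simple_gr (t, b) (s, a) (Ne.symm hlm))) _
    rw [hz, comp_zero] at hd
    have := IsZero.of_epi_eq_zero _ hd.symm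
    exact Simple.not_isZero _ this
  · -- then `kernel g` is all of `Δ s`, since `Δ s ⟶ L s` is an essential epimorphism
    have he : Epi (kernel.ι g ≫ D.π s) := epi_of_nonzero_to_simple h0
    obtain ⟨hL, hΔ, hp⟩ := h.projective_cover _ s (isLowerSet_Iic s) (maximal_Iic s)
    let K : (D.serre (Set.Iic s)).FullSubcategory :=
      ⟨kernel g, (D.serre (Set.Iic s)).prop_of_mono (kernel.ι g) hΔ⟩
    have h1 := hp.essential (Y := K) (ObjectProperty.homMk (kernel.ι g))
      ((D.serre (Set.Iic s)).ι.epi_of_epi_map he)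
    have h2 : Epi (kernel.ι g) := (D.serre (Set.Iic s)).ι.map_epi
      (ObjectProperty.homMk (kernel.ι g) : K ⟶ ⟨D.std s, hΔ⟩)
    exact hg (by rw [← cancel_epi (kernel.ι g), kernel.condition, comp_zero])

/-- The simple object `L s` is the only simple subobject of `∇ s`. -/
lemma hom_costd_gr (l m : S × ℤ) (hlm : l ≠ m) : HomZero (D.gr.L m) (D.gr.costd l) := by
  obtain ⟨s, a⟩ := l
  obtain ⟨t, b⟩ := m
  refine (homZero_shift_iff (a - b) (by lia)).2
    ((homZero_shift_left_iff (a := b - a) (a - b) (by lia)).1 fun g => ?_)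
  by_contra hg
  have := h.simple s
  have : Simple ((D.L t)⟦b - a⟧) := h.simple_gr (t, b - a)
  have := h.mono_i s
  have : Mono g := mono_of_nonzero_from_simple hg
  by_cases h0 : D.i s ≫ cokernel.π g = 0
  · have hd : Abelian.monoLift g (D.i s) h0 ≫ g = D.i s := Abelian.monoLift_comp _ _ _
    have hz : Abelian.monoLift g (D.i s) h0 = 0 :=
      (homZero_shift_iff (X := D.L s) (Y := D.L t) (a := a) (b := b) (b - a) (by lia)).1
          (h.hom_simple_gr (s, a) (t, b) hlm) _
    rw [hz, zero_comp] at hd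
    have := IsZero.of_mono_eq_zero _ hd.symm
    exact Simple.not_isZero _ this
  · -- then `∇ s ⟶ cokernel g` is a monomorphism, since `L s ⟶ ∇ s` is an essential one
    have he : Mono (D.i s ≫ cokernel.π g) := mono_of_nonzero_from_simple h0
    obtain ⟨hL, hN, hp⟩ := h.injective_envelope _ s (isLowerSet_Iic s) (maximal_Iic s)
    let K : (D.serre (Set.Iic s)).FullSubcategory :=
      ⟨cokernel g, (D.serre (Set.Iic s)).prop_of_epi (cokernel.π g) hN⟩
    have h1 := hp.essential (Y := K) (ObjectProperty.homMk (cokernel.π g))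
      ((D.serre (Set.Iic s)).ι.mono_of_mono_map he)
    have h2 : Mono (cokernel.π g) := (D.serre (Set.Iic s)).ι.map_mono
      (ObjectProperty.homMk (cokernel.π g) : ⟨D.costd s, hN⟩ ⟶ K)
    exact hg (by rw [← cancel_mono (cokernel.π g), cokernel.condition, zero_comp])

omit [Linear k A] h in
lemma maximal_union {s t : S} (hst : ¬ s < t) : Maximal (· ∈ Set.Iic s ∪ Set.Iic t) s :=
  ⟨Or.inl le_rfl, fun _ hy hsy => hy.elim id fun hyt =>
    ((hsy.trans hyt).eq_of_not_lt hst).symm ▸ hyt⟩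

/-- A graded highest weight category satisfies the axioms `IsHW`. The splittings hold because
`Δ s` is projective, and `∇ s` injective, in `A_T` for `T = {≤ s} ∪ {≤ t}`, in which `s` is maximal
unless `s < t`. -/
lemma isHW [∀ n : ℤ, Functor.Linear k (shiftFunctor A n)] : IsHW k D.gr Prod.fst where
  finite_Iic := h.finite_Iic
  simple := h.simple_gr
  hom_simple := h.hom_simple_gr
  end_simple l f := by
    have := h.simple l.1
    obtain ⟨g, rfl⟩ := (shiftFunctor A l.2).map_surjective f
    obtain ⟨c, hc⟩ := (finrank_eq_one_iff_of_nonzero' (𝟙 (D.L l.1)) (id_nonzero _)).1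
      (h.finrank_end l.1) g
    refine ⟨c, ?_⟩
    rw [← hc, Functor.map_smul, CategoryTheory.Functor.map_id]
    rfl
  epi_π l := by
    have := h.epi_π l.1
    exact (shiftFunctor A l.2).map_epi (D.π l.1)
  mono_i l := by
    have := h.mono_i l.1
    exact (shiftFunctor A l.2).map_mono (D.i l.1)
  kernel_mem l := (h.serre_iff _ _).1 ((D.serre _).prop_of_iso
    (PreservesKernel.iso (shiftFunctor A l.2) (D.π l.1))
    ((D.serre _).le_shift l.2 _ (h.kernel_mem l.1)))
  cokernel_mem l := (h.serre_iff _ _).1 ((D.serre _).prop_of_iso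
    (PreservesCokernel.iso (shiftFunctor A l.2) (D.i l.1))
    ((D.serre _).le_shift l.2 _ (h.cokernel_mem l.1)))
  hom_std := h.hom_std_gr
  hom_costd := h.hom_costd_gr
  std_split := by
    rintro ⟨s, a⟩ ⟨t, b⟩ hst E f g w hS
    have := hS.epi_g
    have hE : D.serre (Set.Iic s ∪ Set.Iic t) E :=
      (D.serre _).prop_X₂_of_shortExact hS
        ((D.serre _).le_shift b _ (D.serre_mono Set.subset_union_right _
          (h.mem_serre t t le_rfl).1))
        ((D.serre _).le_shift a _ (D.serre_mono Set.subset_union_left _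
          (h.mem_serre s s le_rfl).2.1))
    let e : (D.gr.std (s, a))⟦-a⟧ ≅ D.std s := (shiftFunctorCompIsoId A a (-a) (by lia)).app _
    obtain ⟨r, hr⟩ := h.cover _ s ((isLowerSet_Iic s).union (isLowerSet_Iic t)) (maximal_union hst)
      ((D.serre _).le_shift (-a) _ hE) (g⟦-a⟧' ≫ e.hom)
    obtain ⟨r', hr'⟩ := (shiftFunctor A (-a)).map_surjective (e.hom ≫ r)
    refine ⟨r', (shiftFunctor A (-a)).map_injective ?_⟩
    rw [Functor.map_comp, hr', ← cancel_mono e.hom, Category.assoc, Category.assoc, hr,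
      CategoryTheory.Functor.map_id, Category.id_comp, Category.comp_id]
  costd_split := by
    rintro ⟨s, a⟩ ⟨t, b⟩ hst E f g w hS
    have := hS.mono_f
    have := hS.epi_g
    have hE : D.serre (Set.Iic s ∪ Set.Iic t) E :=
      (D.serre _).prop_X₂_of_shortExact hS
        ((D.serre _).le_shift a _ (D.serre_mono Set.subset_union_left _
          (h.mem_serre s s le_rfl).2.2))
        ((D.serre _).le_shift b _ (D.serre_mono Set.subset_union_right _
          (h.mem_serre t t le_rfl).1))
    let e : (D.gr.costd (s, a))⟦-a⟧ ≅ D.costd s := (shiftFunctorCompIsoId A a (-a) (by lia)).app _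
    obtain ⟨r, hr⟩ := h.envelope _ s ((isLowerSet_Iic s).union (isLowerSet_Iic t))
      (maximal_union hst) ((D.serre _).le_shift (-a) _ hE) (e.inv ≫ f⟦-a⟧')
    obtain ⟨r', hr'⟩ := (shiftFunctor A (-a)).map_surjective (r ≫ e.inv)
    have hfr : f ≫ r' = 𝟙 _ := by
      refine (shiftFunctor A (-a)).map_injective ?_
      rw [Functor.map_comp, hr', ← cancel_epi e.inv, reassoc_of% hr,
        CategoryTheory.Functor.map_id, Category.comp_id]
    let σ := ShortComplex.Splitting.ofExactOfRetraction _ hS.exact r' hfr this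
    exact ⟨σ.s, σ.s_g⟩
  filt_univ X := by
    obtain ⟨_, _⟩ := h.finite_length X
    refine ExtClosure.mono (fun Y hY => ?_) (extClosure_simple_of_finite_length X)
    obtain ⟨s, n, ⟨e⟩⟩ := h.exists_iso Y hY
    exact .of_iso e.symm (.of ⟨(s, n), trivial, rfl⟩)

end WeightData.IsGradedHighestWeight

end Graded

/-! ### The Serre quotient by the smaller weights -/

section Quotient

variable {C : Type u} [Category.{v} C] [Abelian C] {P : ObjectProperty C} [P.IsSerreClass]
  {X : C} [Projective X] (hX : ∀ N, P N → HomZero X N)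

include hX

open ObjectProperty.SerreClassLocalization in
/-- The quotient functor is fully faithful on morphisms from a projective object without nonzero
morphisms to the Serre subcategory. -/
lemma quotient_map_bijective (Y : C) :
    Function.Bijective (fun f : X ⟶ Y => (serreQuotientFunctor P).map f) := by
  constructor
  · refine (injective_iff_map_eq_zero ((serreQuotientFunctor P).mapAddHom (X := X) (Y := Y))).2
      fun f hf => ?_
    rw [← Abelian.image.fac f, hX _ ((map_eq_zero_iff (serreQuotientFunctor P) P f).1 hf)
      (Abelian.factorThruImage f), zero_comp]
  · intro g
    obtain ⟨φ, hφ⟩ := Localization.exists_rightFraction (serreQuotientFunctor P) P.isoModSerre g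
    have : Epi φ.s := Preadditive.epi_of_cokernel_zero (hX _ φ.hs.2 _)
    have hs : (serreQuotientFunctor P).map (Projective.factorThru (𝟙 X) φ.s) ≫
        (serreQuotientFunctor P).map φ.s = 𝟙 _ := by
      rw [← Functor.map_comp, Projective.factorThru_comp, CategoryTheory.Functor.map_id]
    refine ⟨Projective.factorThru (𝟙 X) φ.s ≫ φ.f, ?_⟩
    dsimp only
    rw [Functor.map_comp, ← φ.map_s_comp_map (serreQuotientFunctor P)
      (Localization.inverts _ _), reassoc_of% hs, hφ]

open ObjectProperty.SerreClassLocalization in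
/-- The image of `X` in the quotient is projective. -/
lemma quotient_split {Y : SerreQuotient P} (p : Y ⟶ (serreQuotientFunctor P).obj X) [Epi p] :
    ∃ t, t ≫ p = 𝟙 _ := by
  have := Localization.essSurj (serreQuotientFunctor P) P.isoModSerre
  let e := (serreQuotientFunctor P).objObjPreimageIso Y
  obtain ⟨φ, hφ⟩ := Localization.exists_leftFraction (serreQuotientFunctor P) P.isoModSerre
    (e.hom ≫ p)
  have hs : IsIso ((serreQuotientFunctor P).map φ.s) := Localization.inverts _ _ _ φ.hs
  have hf : (serreQuotientFunctor P).map φ.f = (e.hom ≫ p) ≫ (serreQuotientFunctor P).map φ.s := by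
    rw [hφ, φ.map_comp_map_s]
  have : Epi ((serreQuotientFunctor P).map φ.f) := by rw [hf]; infer_instance
  have h0 : φ.s ≫ cokernel.π φ.f = 0 :=
    hX _ ((epi_map_iff (serreQuotientFunctor P) P φ.f).1 this) _
  -- `φ.s` factors through the image of `φ.f`, and lifts since `X` is projective
  let a : X ⟶ Abelian.image φ.f := kernel.lift _ φ.s h0
  let t := Projective.factorThru a (Abelian.factorThruImage φ.f)
  have ht : t ≫ φ.f = φ.s := by
    conv_lhs => rw [← Abelian.image.fac φ.f, ← Category.assoc, Projective.factorThru_comp]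
    exact kernel.lift_ι _ _ _
  refine ⟨(serreQuotientFunctor P).map t ≫ e.hom, ?_⟩
  rw [← cancel_mono ((serreQuotientFunctor P).map φ.s), Category.assoc, Category.assoc,
    ← Category.assoc e.hom, ← hf, ← Functor.map_comp, ht, Category.id_comp]

/-- The image of `X` in the quotient has no higher extensions, since these are effaceable and
epimorphisms to it split. -/
lemma quotient_ext [HasDerivedCategory.{w} (SerreQuotient P)] (Y : SerreQuotient P) {n : ℤ}
    (hn : n ≠ 0) : HomZero (sg ((serreQuotientFunctor P).obj X)) ((sg Y)⟦n⟧) := by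
  rcases hn.lt_or_gt with hn' | hn'
  · exact homZero_neg _ _ hn'
  · intro ξ
    obtain ⟨W, p, _, h0⟩ := exists_epi_comp_eq_zero hn' ξ
    obtain ⟨t, ht⟩ := quotient_split hX p
    rw [← Category.id_comp ξ, ← CategoryTheory.Functor.map_id, ← ht, Functor.map_comp,
      Category.assoc, h0, comp_zero]

end Quotient

namespace IsHW

variable {A : Type u} [Category.{v} A] [Abelian A] {Λ : Type x} {S : Type y}
  [PartialOrder S] {k : Type w'} [Field k] [Linear k A]
  {W : WeightData A Λ} {wt : Λ → S} (H : IsHW k W wt) {P : ObjectProperty A} {s : S}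
  (hP : ∀ X, P X ↔ W.filt wt (Set.Iio s) X)

include H hP

lemma homZero_std_of_serre {l : Λ} (hl : wt l = s) (N : A) (hN : P N) : HomZero (W.std l) N :=
  H.hom_std_of_filt (show wt l ∉ Set.Iio s from hl ▸ lt_irrefl _) ((hP N).1 hN)

variable [HasDerivedCategory.{w} A] (R : Refines W wt Set.univ)

omit hP in
include R in
lemma ext_std_of_maximal {l : Λ} (hl : ∀ m, ¬ wt l < wt m) (X : A) {n : ℤ} (hn : n ≠ 0) :
    HomZero (sg (W.std l)) ((sg X)⟦n⟧) :=
  (H.filt_univ X).homZero_right (by rintro _ ⟨m, -, rfl⟩; exact H.ext_std_simple R (hl m) hn)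

omit hP in
include R in
/-- The standard objects of maximal weight are projective. -/
lemma projective_std {l : Λ} (hl : ∀ m, ¬ wt l < wt m) : Projective (W.std l) where
  factors {X Y} f g _ := by
    have T := dist_of_shortExact (shortExact_kernel g)
    obtain ⟨a, ha⟩ := T.lift₃ ((DerivedCategory.singleFunctor A 0).map f)
      (H.ext_std_of_maximal R hl _ one_ne_zero _)
    obtain ⟨a, rfl⟩ := (DerivedCategory.singleFunctor A 0).map_surjective a
    rw [← Functor.map_comp] at ha
    exact ⟨a, ((DerivedCategory.singleFunctor A 0).map_injective ha).symm⟩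

variable [P.IsSerreClass] [HasDerivedCategory.{w₁} (SerreQuotient P)] (hs : ∀ m, ¬ s < wt m)

include R hs in
/-- Passing to the quotient by the smaller weights does not change the morphisms from the standard
objects of maximal weight. -/
lemma bijHom_quotient {l : Λ} (hl : wt l = s) {N : DerivedCategory A} (hN : Bdd N) (n : ℤ) :
    BijHom (serreQuotientFunctor P).mapDerivedCategory ((sg (W.std l))⟦n⟧) N := by
  subst hl
  have := H.projective_std R hs
  have hX := H.homZero_std_of_serre hP rfl
  have h : ∀ n : ℤ, BijHom (serreQuotientFunctor P).mapDerivedCategory (sg (W.std l)) (N⟦n⟧) :=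
    H.of_costd (isTri_bijHom_right _) isLowerSet_univ (fun m _ n =>
      bijHom_sg_shift (quotient_map_bijective hX _)
        (fun n hn => H.ext_std_of_maximal R hs _ hn) (fun n hn => quotient_ext hX _ hn) n) hN
      (H.supp_univ N)
  exact ((h (-n)).shift n).congr (Iso.refl _) ((shiftFunctorCompIsoId _ (-n) n (by lia)).app N)

/-- Objects supported on the smaller weights are killed by the quotient functor. -/
lemma isZero_quotient {N : DerivedCategory A} (hN : Bdd N) (hNs : W.Supp wt (Set.Iio s) N) :
    IsZero ((serreQuotientFunctor P).mapDerivedCategory.obj N) := by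
  have hz : IsTri (fun N : DerivedCategory (SerreQuotient P) => IsZero N) :=
    { zero := fun _ h => h
      of_iso := fun e h => h.of_iso e.symm
      shift := fun n _ h => Functor.map_isZero _ h
      ext := fun T h₁ h₃ => (IsZero.iff_id_eq_zero _).2
        (T.homZero₂_left (.of_isZero_left h₁) (.of_isZero_left h₃) _) }
  refine H.of_std (hz.comap (serreQuotientFunctor P).mapDerivedCategory) (isLowerSet_Iio s)
    (fun l hl => ?_) hN hNs
  refine IsZero.of_iso (Functor.map_isZero _ ?_) (mapSgIso (serreQuotientFunctor P) (W.std l))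
  exact (ObjectProperty.SerreClassLocalization.isZero_obj_iff (serreQuotientFunctor P) P _).2
    ((hP _).2 (WeightData.filt_mono (fun t ht => lt_of_le_of_lt ht hl) (H.filt_std l)))

end IsHW

/-! ### Grading shifts and parity -/

section Grading

variable {A : Type u} [Category.{v} A] [Abelian A] [HasShift A ℤ]
  [∀ n : ℤ, (shiftFunctor A n).Additive] [HasDerivedCategory.{w} A]

/-- The autoequivalence `⟨n⟩` of the derived category. -/
noncomputable abbrev gradeD (n : ℤ) : DerivedCategory A ⥤ DerivedCategory A :=
  (shiftFunctor A n).mapDerivedCategory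

/-- `⟨a⟩⟨b⟩` is isomorphic to the identity functor for `a + b = 0`. -/
noncomputable def gradeDCompIsoId {a b : ℤ} (h : a + b = 0) :
    gradeD (A := A) a ⋙ gradeD b ≅ 𝟭 (DerivedCategory A) :=
  mapDerivedCategoryComp (shiftFunctorCompIsoId A a b h) ≪≫ mapDerivedCategoryId (Iso.refl _)

instance (n : ℤ) : (gradeD (A := A) n).IsEquivalence :=
  (CategoryTheory.Equivalence.mk (gradeD n) (gradeD (-n)) (gradeDCompIsoId (by lia)).symm
    (gradeDCompIsoId (by lia))).isEquivalence_functor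

/-- `M⟨n⟩[m]`, for an object `M` of the derived category. -/
noncomputable abbrev tw (n m : ℤ) (M : DerivedCategory A) : DerivedCategory A :=
  ((gradeD n).obj M)⟦m⟧

/-- `⟨n⟩[n]` and `⟨n'⟩[n']` are inverse to each other for `n + n' = 0`. -/
noncomputable def twTwIso (n n' : ℤ) (h : n + n' = 0) (M : DerivedCategory A) :
    tw n' n' (tw n n M) ≅ M :=
  (shiftFunctor _ n').mapIso (((gradeD n').commShiftIso n).app _) ≪≫
    (shiftFunctorCompIsoId _ n n' h).app _ ≪≫ (gradeDCompIsoId h).app M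

lemma homZero_tw_iff (n m : ℤ) {M N : DerivedCategory A} :
    HomZero (tw n m M) (tw n m N) ↔ HomZero M N :=
  (homZero_map_iff (shiftFunctor (DerivedCategory A) m)).trans (homZero_map_iff (gradeD n))

/-- `X[m']⟨n⟩[m] = X⟨n⟩[m' + m]` for an object `X` of the heart. -/
noncomputable def twSgIso (n m c m' : ℤ) (h : m' + m = c) (X : A) :
    tw n m ((sg X)⟦m'⟧) ≅ (sg (X⟦n⟧))⟦c⟧ :=
  (shiftFunctor _ m).mapIso (mapSgShiftIso (shiftFunctor A n) X m') ≪≫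
    ((shiftFunctorAdd' _ m' m c h).app _).symm

variable {S : Type x} (D : WeightData A S)

/-- `Δ s⟨a⟩[b]⟨n⟩[m] = Δ s⟨a + n⟩[b + m]`. -/
noncomputable def twStdIso (s : S) {n m a a' b b' : ℤ} (ha : a + n = a') (hb : b + m = b') :
    tw n m ((sg (D.gr.std (s, a)))⟦b⟧) ≅ (sg (D.gr.std (s, a')))⟦b'⟧ :=
  twSgIso n m b' b hb _ ≪≫ (shiftFunctor _ b').mapIso ((DerivedCategory.singleFunctor A 0).mapIso
    ((shiftFunctorAdd' A a n a' ha).app (D.std s)).symm)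

/-- `∇ s⟨a⟩[b]⟨n⟩[m] = ∇ s⟨a + n⟩[b + m]`. -/
noncomputable def twCostdIso (s : S) {n m a a' b b' : ℤ} (ha : a + n = a') (hb : b + m = b') :
    tw n m ((sg (D.gr.costd (s, a)))⟦b⟧) ≅ (sg (D.gr.costd (s, a')))⟦b'⟧ :=
  twSgIso n m b' b hb _ ≪≫ (shiftFunctor _ b').mapIso ((DerivedCategory.singleFunctor A 0).mapIso
    ((shiftFunctorAdd' A a n a' ha).app (D.costd s)).symm)

/-- `Δ s⟨0⟩[0] = Δ s`. -/
noncomputable def stdZeroIso (s : S) : (sg (D.gr.std (s, 0)))⟦(0 : ℤ)⟧ ≅ sg (D.std s) :=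
  (shiftFunctorZero _ ℤ).app _ ≪≫
    (DerivedCategory.singleFunctor A 0).mapIso ((shiftFunctorZero A ℤ).app (D.std s))

/-- `∇ s⟨0⟩[0] = ∇ s`. -/
noncomputable def costdZeroIso (s : S) : (sg (D.gr.costd (s, 0)))⟦(0 : ℤ)⟧ ≅ sg (D.costd s) :=
  (shiftFunctorZero _ ℤ).app _ ≪≫
    (DerivedCategory.singleFunctor A 0).mapIso ((shiftFunctorZero A ℤ).app (D.costd s))

variable {D}

lemma homZero_std_tw_iff (s : S) {n m a a' b b' : ℤ} (ha : a + n = a') (hb : b + m = b')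
    {M : DerivedCategory A} : HomZero ((sg (D.gr.std (s, a')))⟦b'⟧) (tw n m M) ↔
      HomZero ((sg (D.gr.std (s, a)))⟦b⟧) M :=
  ⟨fun h => (homZero_tw_iff n m).1 (h.congr_left (twStdIso D s ha hb).symm),
    fun h => ((homZero_tw_iff n m).2 h).congr_left (twStdIso D s ha hb)⟩

lemma homZero_tw_costd_iff (s : S) {n m a a' b b' : ℤ} (ha : a + n = a') (hb : b + m = b')
    {M : DerivedCategory A} : HomZero (tw n m M) ((sg (D.gr.costd (s, a')))⟦b'⟧) ↔
      HomZero M ((sg (D.gr.costd (s, a)))⟦b⟧) :=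
  ⟨fun h => (homZero_tw_iff n m).1 (h.congr_right (twCostdIso D s ha hb).symm),
    fun h => ((homZero_tw_iff n m).2 h).congr_right (twCostdIso D s ha hb)⟩

end Grading

section Purity

variable {A : Type u} [Category.{v} A] [Abelian A] [HasDerivedCategory.{w} A] {Λ : Type x}

/-- An object which is pure of degrees `e`, and such that the degrees `e l` which occur are
congruent to `d l` modulo `2`. -/
structure IsPureOfParity (W : WeightData A Λ) (e : Λ → ℤ) (d : Λ → ZMod 2)
    (M : DerivedCategory A) : Prop where
  shriek : ∀ l (m : ℤ), ¬ HomZero ((sg (W.std l))⟦m⟧) M → m = e l ∧ (e l : ZMod 2) = d l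
  star : ∀ l (m : ℤ), ¬ HomZero M ((sg (W.costd l))⟦m⟧) → m = e l ∧ (e l : ZMod 2) = d l

variable {W : WeightData A Λ} {e : Λ → ℤ} {d : Λ → ZMod 2} {M N : DerivedCategory A}

lemma IsPureOfParity.shriekPure (h : IsPureOfParity W e d M) : W.ShriekPure e M :=
  fun l m hm => (h.shriek l m hm).1

lemma IsPureOfParity.starPure (h : IsPureOfParity W e d M) : W.StarPure e M :=
  fun l m hm => (h.star l m hm).1

lemma IsPureOfParity.of_iso (i : M ≅ N) (h : IsPureOfParity W e d M) : IsPureOfParity W e d N :=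
  ⟨fun l m hm => h.shriek l m fun h' => hm (h'.congr_right i),
    fun l m hm => h.star l m fun h' => hm (h'.congr_left i)⟩

lemma isPureOfParity_of_isZero (h : IsZero M) : IsPureOfParity W e d M :=
  ⟨fun _ _ hm => (hm (.of_isZero_right h)).elim, fun _ _ hm => (hm (.of_isZero_left h)).elim⟩

lemma IsPureOfParity.reindex {Λ' : Type y} {W' : WeightData A Λ'} (φ : Λ' → Λ)
    (i : ∀ l, W.std (φ l) ≅ W'.std l) (j : ∀ l, W.costd (φ l) ≅ W'.costd l)
    (h : IsPureOfParity W e d M) : IsPureOfParity W' (fun l => e (φ l)) (fun l => d (φ l)) M :=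
  ⟨fun l m hm => h.shriek (φ l) m fun h' => hm (HomZero.congr_left
      ((shiftFunctor _ m).mapIso ((DerivedCategory.singleFunctor A 0).mapIso (i l))) h'),
    fun l m hm => h.star (φ l) m fun h' => hm (HomZero.congr_right
      ((shiftFunctor _ m).mapIso ((DerivedCategory.singleFunctor A 0).mapIso (j l))) h')⟩

lemma homZero_bounded_iff {M N : DerivedCategory.Bounded A} :
    HomZero M N ↔ HomZero M.obj N.obj :=
  (homZero_map_iff (ObjectProperty.ι _)).symm

end Purity

section Parity

variable {A : Type u} [Category.{v} A] [Abelian A] [HasShift A ℤ]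
  [∀ n : ℤ, (shiftFunctor A n).Additive] [HasDerivedCategory.{w} A] {S : Type x}
  {D : WeightData A S} {dag : S → ZMod 2}

/-- The effect of `⟨n⟩[n]` on parities. -/
lemma IsPureOfParity.tw {c c' : ZMod 2} {n : ℤ} {M : DerivedCategory A} (hc : c' = c + n)
    (h : IsPureOfParity D.gr Prod.snd (fun l => dag l.1 + c) M) :
    IsPureOfParity D.gr Prod.snd (fun l => dag l.1 + c') (GradedHW.tw n n M) := by
  subst hc
  constructor
  · rintro ⟨s, a⟩ b hb
    obtain ⟨h1, h2⟩ := h.shriek (s, a - n) (b - n) fun h' =>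
      hb ((homZero_std_tw_iff s (by lia) (by lia)).2 h')
    dsimp only at h1 h2 ⊢
    exact ⟨by lia, by rw [← add_assoc, ← h2]; push_cast; ring⟩
  · rintro ⟨s, a⟩ b hb
    obtain ⟨h1, h2⟩ := h.star (s, a - n) (b - n) fun h' =>
      hb ((homZero_tw_costd_iff s (by lia) (by lia)).2 h')
    dsimp only at h1 h2 ⊢
    exact ⟨by lia, by rw [← add_assoc, ← h2]; push_cast; ring⟩

/-- `M⟨n⟩[m]` in the bounded derived category and in the derived category. -/
noncomputable def bishiftObjIso (M : DerivedCategory.Bounded A) (n m : ℤ) :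
    (bishift M n m).obj ≅ tw n m M.obj :=
  ((ObjectProperty.ι _).commShiftIso m).app _

/-- Even objects are the pure ones of degrees `e (s, n) = n`, such that only the `n` congruent to
`dag s` occur. -/
lemma isEven_iff {M : DerivedCategory.Bounded A} :
    D.IsEven dag M ↔ IsPureOfParity D.gr Prod.snd (fun l => dag l.1) M.obj := by
  have h1 : ∀ (s : S) (n m : ℤ), (∃ f : single (D.std s) ⟶ bishift M n m, f ≠ 0) ↔
      ¬ HomZero ((sg (D.gr.std (s, -n)))⟦-m⟧) M.obj := fun s n m => by
    rw [← homZero_std_tw_iff (n := n) (m := m) (a' := 0) (b' := 0) s (by lia) (by lia),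
      ← not_iff_not, not_not, not_exists]
    simp only [not_not]
    exact homZero_bounded_iff.trans
      ⟨fun h => (HomZero.congr_left (stdZeroIso D s).symm h).congr_right (bishiftObjIso M n m),
        fun h => (HomZero.congr_left (stdZeroIso D s) h).congr_right (bishiftObjIso M n m).symm⟩
  have h2 : ∀ (s : S) (n m : ℤ), (∃ f : bishift M n m ⟶ single (D.costd s), f ≠ 0) ↔
      ¬ HomZero M.obj ((sg (D.gr.costd (s, -n)))⟦-m⟧) := fun s n m => by
    rw [← homZero_tw_costd_iff (n := n) (m := m) (a' := 0) (b' := 0) s (by lia) (by lia),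
      ← not_iff_not, not_not, not_exists]
    simp only [not_not]
    exact homZero_bounded_iff.trans
      ⟨fun h => (HomZero.congr_left (bishiftObjIso M n m) h).congr_right (costdZeroIso D s).symm,
        fun h => (HomZero.congr_left (bishiftObjIso M n m).symm h).congr_right (costdZeroIso D s)⟩
  have h3 : ∀ n : ℤ, ((-n : ℤ) : ZMod 2) = n := fun n => by
    rw [Int.cast_neg, ZMod.neg_eq_self_mod_two]
  unfold WeightData.IsEven WeightData.IsShriekEven WeightData.IsStarEven
  simp only [h1, h2]
  constructor
  · rintro ⟨h, h'⟩
    constructor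
    · rintro ⟨s, a⟩ b hb
      obtain ⟨h4, h5⟩ := h s (-a) (-b) (by rwa [neg_neg, neg_neg])
      exact ⟨by dsimp only; lia, by rw [← h5, h3]⟩
    · rintro ⟨s, a⟩ b hb
      obtain ⟨h4, h5⟩ := h' s (-a) (-b) (by rwa [neg_neg, neg_neg])
      exact ⟨by dsimp only; lia, by rw [← h5, h3]⟩
  · rintro ⟨h, h'⟩
    constructor
    · intro s n m hm
      obtain ⟨h4, h5⟩ := h _ _ hm
      dsimp only at h4 h5
      exact ⟨by lia, by rw [← h5, h3]⟩
    · intro s n m hm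
      obtain ⟨h4, h5⟩ := h' _ _ hm
      dsimp only at h4 h5
      exact ⟨by lia, by rw [← h5, h3]⟩

/-- An indecomposable parity object `M ≅ M₀ ⊞ M₁` is isomorphic to `M₀` or to `M₁`, hence is pure;
the parity is `dag + c`, with `c = 0` or `c = 1` accordingly. -/
lemma exists_isPureOfParity {M : DerivedCategory.Bounded A} (h : Indecomposable M)
    (hM : D.IsParity dag M) :
    ∃ c, IsPureOfParity D.gr Prod.snd (fun l => dag l.1 + c) M.obj := by
  obtain ⟨M₀, M₁, ⟨e⟩, h₀, h₁⟩ := hM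
  rw [isEven_iff] at h₀ h₁
  rcases h.2 _ _ e with hz | hz
  · let e' : M ≅ M₁ := e ≪≫ (isoZeroBiprod hz).symm
    have h₂ := (h₁.of_iso (bishiftObjIso M₁ 1 1))
    refine ⟨1, IsPureOfParity.of_iso (twTwIso 1 (-1) (by lia) M₁.obj ≪≫
      (ObjectProperty.ι _).mapIso e'.symm) (IsPureOfParity.tw (c := 0) (by decide) ?_)⟩
    simpa using h₂
  · let e' : M ≅ M₀ := e ≪≫ (isoBiprodZero hz).symm
    exact ⟨0, by simpa using IsPureOfParity.of_iso ((ObjectProperty.ι _).mapIso e'.symm) h₀⟩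

/-- Pure objects of parity `dag + c` are parity objects, with one of the two summands
equal to zero. -/
lemma isParity_of_isPureOfParity {M : DerivedCategory.Bounded A} {c : ZMod 2}
    (h : IsPureOfParity D.gr Prod.snd (fun l => dag l.1 + c) M.obj) : D.IsParity dag M := by
  have hz : ∀ X : DerivedCategory.Bounded A, IsZero X → IsZero X.obj := fun X hX =>
    Functor.map_isZero (ObjectProperty.ι _) hX
  obtain ⟨Z, hZ⟩ := HasZeroObject.zero (C := DerivedCategory.Bounded A)
  rcases (by decide : ∀ c : ZMod 2, c = 0 ∨ c = 1) c with rfl | rfl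
  · refine ⟨M, Z, ⟨isoBiprodZero hZ⟩, isEven_iff.2 (by simpa using h),
      isEven_iff.2 (isPureOfParity_of_isZero ((Functor.map_isZero (shiftFunctor _ _)
        (Functor.map_isZero (gradeD 1) (hz _ hZ))).of_iso (bishiftObjIso _ 1 1)))⟩
  · refine ⟨Z, M, ⟨isoZeroBiprod hZ⟩,
      isEven_iff.2 (isPureOfParity_of_isZero (hz _ hZ)), isEven_iff.2 ?_⟩
    have := IsPureOfParity.tw (n := 1) (c' := 0) (by decide) h
    exact (IsPureOfParity.of_iso (bishiftObjIso M 1 1).symm (by simpa using this))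

end Parity

section Indecomposable

variable {A : Type u} [Category.{v} A] [Abelian A] [HasDerivedCategory.{w} A]

lemma Bdd.of_retract {M N : DerivedCategory A} (hM : Bdd M) (i : N ⟶ M) (p : M ⟶ N)
    (h : i ≫ p = 𝟙 N) : Bdd N := by
  obtain ⟨a, b, ha, hb⟩ := (bdd_iff M).1 hM
  have key : ∀ j, IsZero (coh j M) → IsZero (coh j N) := fun j hj => by
    have h' := congrArg (DerivedCategory.homologyFunctor A j).map h
    rw [Functor.map_comp, CategoryTheory.Functor.map_id] at h'
    exact (IsZero.iff_id_eq_zero _).2 (by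
      rw [← h', hj.eq_of_tgt ((DerivedCategory.homologyFunctor A j).map i) 0, zero_comp])
  exact (bdd_iff N).2 ⟨a, b,
    (DerivedCategory.isGE_iff _ _).2 fun j hj => key j (M.isZero_of_isGE a j hj),
    (DerivedCategory.isLE_iff _ _).2 fun j hj => key j (M.isZero_of_isLE b j hj)⟩

instance : IsIdempotentComplete (DerivedCategory.Bounded A) where
  idempotents_split M p hp := by
    obtain ⟨Y, i, q, h₁, h₂⟩ := splits_of_bdd M.property p.hom (congrArg (fun f => f.hom) hp)
    have hY : Bdd Y := Bdd.of_retract M.property i q h₁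
    exact ⟨⟨Y, hY⟩, ObjectProperty.homMk i, ObjectProperty.homMk q,
      (ObjectProperty.ι _).map_injective h₁, (ObjectProperty.ι _).map_injective h₂⟩

lemma BijHom.trivialIdempotents_iff {C : Type u} [Category.{v} C] [Preadditive C] {D : Type u'}
    [Category.{v'} D] [Preadditive D] {G : C ⥤ D} [G.Additive] {M : C} (h : BijHom G M M) :
    TrivialIdempotents (G.obj M) ↔ TrivialIdempotents M := by
  constructor
  · intro hM e he
    rcases hM (G.map e) (by rw [← G.map_comp, he]) with h' | h'
    · exact Or.inl (h.1 (by dsimp only; rw [h', G.map_zero]))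
    · exact Or.inr (h.1 (by dsimp only; rw [h', G.map_id]))
  · intro hM e he
    obtain ⟨e, rfl⟩ := h.2 e
    dsimp only at he ⊢
    rcases hM e (h.1 (by dsimp only; rw [G.map_comp, he])) with rfl | rfl
    · exact Or.inl (G.map_zero _ _)
    · exact Or.inr (G.map_id _)

lemma bijHom_of_fullyFaithful {C : Type u} [Category.{v} C] {D : Type u'}
    [Category.{v'} D] (G : C ⥤ D) [G.Full] [G.Faithful] (X Y : C) : BijHom G X Y :=
  ⟨G.map_injective, G.map_surjective⟩

lemma TrivialIdempotents.of_iso {C : Type u} [Category.{v} C] [Preadditive C] {M N : C}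
    (e : M ≅ N) (h : TrivialIdempotents M) : TrivialIdempotents N := fun p hp => by
  rcases h (e.hom ≫ p ≫ e.inv) (by simp [reassoc_of% hp]) with h' | h'
  · exact Or.inl (by rw [← cancel_epi e.hom, ← cancel_mono e.inv, Category.assoc, h']; simp)
  · exact Or.inr (by rw [← cancel_epi e.hom, ← cancel_mono e.inv, Category.assoc, h']; simp)

lemma indecomposable_bounded_iff {M : DerivedCategory.Bounded A} :
    Indecomposable M ↔ ¬ IsZero M.obj ∧ TrivialIdempotents M.obj := by
  have hz : IsZero M.obj ↔ IsZero M :=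
    ⟨fun h => (IsZero.iff_id_eq_zero _).2 ((ObjectProperty.ι _).map_injective (h.eq_of_src _ _)),
      fun h => Functor.map_isZero (ObjectProperty.ι _) h⟩
  have hi := (bijHom_of_fullyFaithful (ObjectProperty.ι _) M M).trivialIdempotents_iff
  rw [hz]
  exact ⟨fun h => ⟨h.1, hi.2 (trivialIdempotents_of_indecomposable h)⟩,
    fun h => indecomposable_of_trivialIdempotents h.1 (hi.1 h.2)⟩

end Indecomposable

/-! ### The derived category of the weights `≤ s` -/

namespace WeightData.IsGradedHighestWeight

variable {k : Type y} [Field k] {A : Type u} [Category.{v} A] [Abelian A] [Linear k A]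
  [HasShift A ℤ] [∀ n : ℤ, (shiftFunctor A n).Additive] {S : Type x} [PartialOrder S]
  {D : WeightData A S} (h : D.IsGradedHighestWeight k)

include h

lemma mem_serre_gr (s : S) (l : S × ℤ) (hl : l.1 ∈ Set.Iic s) : D.serre (Set.Iic s) (D.gr.L l) ∧
    D.serre (Set.Iic s) (D.gr.std l) ∧ D.serre (Set.Iic s) (D.gr.costd l) :=
  have hl' := h.mem_serre s l.1 hl
  ⟨(D.serre _).le_shift l.2 _ hl'.1, (D.serre _).le_shift l.2 _ hl'.2.1,
    (D.serre _).le_shift l.2 _ hl'.2.2⟩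

/-- The objects `L t⟨n⟩`, `Δ t⟨n⟩`, `∇ t⟨n⟩` of `A_{≤ s}`. -/
abbrev grLE (s : S) : WeightData (D.SubcatLE s) {l : S × ℤ // l.1 ∈ Set.Iic s} :=
  D.gr.restrict Prod.fst (D.serre (Set.Iic s)) (Set.Iic s) (h.mem_serre_gr s)

/-- The vanishing of `Ext²(Δ s, ∇ t⟨n⟩)`, for all the objects indexed by `S × ℤ`. -/
lemma hom_std_costd_two [HasDerivedCategory.{w} A] (l m : S × ℤ) :
    HomZero (sg (D.gr.std l)) ((sg (D.gr.costd m))⟦(2 : ℤ)⟧) := by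
  obtain ⟨s, a⟩ := l
  obtain ⟨t, b⟩ := m
  have h0 : HomZero (sg (D.std s)) ((sg ((D.costd t)⟦b - a⟧))⟦(2 : ℤ)⟧) := fun f => by
    have := HasExt.standard A
    have := h.ext_two s t (b - a)
    exact (Abelian.Ext.homEquiv (C := A) (n := 2)).symm.subsingleton.elim _ _
  refine HomZero.congr_left (mapSgIso (shiftFunctor A a) (D.std s)) ?_
  exact ((homZero_map_iff (gradeD a)).2 h0).congr_right
    (mapSgShiftIso (shiftFunctor A a) _ 2 ≪≫ (shiftFunctor _ (2 : ℤ)).mapIso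
      ((DerivedCategory.singleFunctor A 0).mapIso
        ((shiftFunctorAdd' A (b - a) a b (by lia)).app (D.costd t)).symm))

/-- The Serre subcategory `A_{< s}` of `A_{≤ s}` is given by the weights `< s`. -/
lemma ltInLE_iff (s : S) (X : D.SubcatLE s) :
    D.ltInLE s X ↔ (h.grLE s).filt (fun l => l.1.1) (Set.Iio s) X := by
  refine (h.serre_iff (Set.Iio s) X.obj).trans ⟨fun hX => ?_, fun hX => filt_of_restrict _ hX⟩
  exact filt_restrict _ Set.Iio_subset_Iic_self (fun Y hY =>
    (h.serre_iff _ Y).2 (WeightData.filt_mono Set.Iio_subset_Iic_self hY)) hX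

variable [∀ n : ℤ, Functor.Linear k (shiftFunctor A n)]

lemma isHW_LE (s : S) : IsHW k (h.grLE s) (fun l => l.1.1) :=
  h.isHW.restrict (h.mem_serre_gr s) (isLowerSet_Iic s) (h.serre_iff (Set.Iic s))

variable [HasDerivedCategory.{w} A]

lemma refines_univ : Refines D.gr Prod.fst Set.univ :=
  h.isHW.refines h.hom_std_costd_two isLowerSet_univ

lemma refines_LE (s : S) : Refines (h.grLE s) (fun l => l.1.1) Set.univ :=
  (h.isHW.refines h.hom_std_costd_two (isLowerSet_Iic s)).restrict (h.mem_serre_gr s)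
    (h.serre_iff (Set.Iic s))

variable (s : S) [HasDerivedCategory.{w₁} (D.SubcatLE s)]

/-- The functor `ι_{≤ s}` on derived categories. -/
noncomputable abbrev ιD (D : WeightData A S) (s : S) [HasDerivedCategory.{w₁} (D.SubcatLE s)] :
    DerivedCategory (D.SubcatLE s) ⥤ DerivedCategory A :=
  (D.serre (Set.Iic s)).ι.mapDerivedCategory

variable {s}

lemma bijHom_ιD {M N : DerivedCategory (D.SubcatLE s)} (hM : Bdd M) (hN : Bdd N) :
    BijHom (ιD D s) M N :=
  h.isHW.bijHom_ι (h.mem_serre_gr s) (isLowerSet_Iic s) (h.serre_iff (Set.Iic s)) h.refines_univ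
    (h.refines_LE s) hM hN

omit [HasDerivedCategory.{w} A] [∀ n : ℤ, Functor.Linear k (shiftFunctor A n)] in
/-- The two ways to index the standard and costandard objects of `A_{≤ s}`, as shifts of those with
index `t ≤ s` and as the restriction of those of `A`, lead to the same pure objects. -/
lemma isPureOfParity_restrictLE {dag : S → ZMod 2} {c : ZMod 2}
    {M : DerivedCategory (D.SubcatLE s)} :
    IsPureOfParity (h.restrictLE s).gr Prod.snd (fun l => dag l.1 + c) M ↔
      IsPureOfParity (h.grLE s) (fun l => l.1.2) (fun l => dag l.1.1 + c) M := by
  -- the shifts of `A_{≤ s}` are those of `A`, up to isomorphism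
  let P := D.serre (Set.Iic s)
  let i : ∀ l : {l : S × ℤ // l.1 ∈ Set.Iic s},
      (h.restrictLE s).gr.std (⟨l.1.1, l.2⟩, l.1.2) ≅ (h.grLE s).std l := fun l =>
    P.fullyFaithfulι.preimageIso ((P.ι.commShiftIso l.1.2).app ((h.restrictLE s).std ⟨l.1.1, l.2⟩))
  let j : ∀ l : {l : S × ℤ // l.1 ∈ Set.Iic s},
      (h.restrictLE s).gr.costd (⟨l.1.1, l.2⟩, l.1.2) ≅ (h.grLE s).costd l := fun l =>
    P.fullyFaithfulι.preimageIso
      ((P.ι.commShiftIso l.1.2).app ((h.restrictLE s).costd ⟨l.1.1, l.2⟩))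
  let φ : {l : S × ℤ // l.1 ∈ Set.Iic s} → Set.Iic s × ℤ := fun l => (⟨l.1.1, l.2⟩, l.1.2)
  let ψ : Set.Iic s × ℤ → {l : S × ℤ // l.1 ∈ Set.Iic s} := fun l => ⟨(l.1, l.2), l.1.2⟩
  exact ⟨fun H => H.reindex φ i j, fun H => H.reindex (W' := (h.restrictLE s).gr) ψ
    (fun l => (i (ψ l)).symm) (fun l => (j (ψ l)).symm)⟩

variable {M : DerivedCategory (D.SubcatLE s)}

lemma homZero_std_ι (hM : Bdd M) (l : {l : S × ℤ // l.1 ∈ Set.Iic s}) (m : ℤ) :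
    HomZero ((sg (D.gr.std l.1))⟦m⟧) ((ιD D s).obj M) ↔
      HomZero ((sg ((h.grLE s).std l))⟦m⟧) M := by
  rw [← (h.bijHom_ιD (bdd_isTri.shift m _ (bdd_sg ((h.grLE s).std l))) hM).homZero_iff]
  let e := mapSgShiftIso (D.serre (Set.Iic s)).ι ((h.grLE s).std l) m
  exact ⟨fun h => HomZero.congr_left e.symm h, fun h => HomZero.congr_left e h⟩

lemma homZero_ι_costd (hM : Bdd M) (l : {l : S × ℤ // l.1 ∈ Set.Iic s}) (m : ℤ) :
    HomZero ((ιD D s).obj M) ((sg (D.gr.costd l.1))⟦m⟧) ↔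
      HomZero M ((sg ((h.grLE s).costd l))⟦m⟧) := by
  rw [← (h.bijHom_ιD hM (bdd_isTri.shift m _ (bdd_sg ((h.grLE s).costd l)))).homZero_iff]
  let e := mapSgShiftIso (D.serre (Set.Iic s)).ι ((h.grLE s).costd l) m
  exact ⟨fun h => HomZero.congr_right e.symm h, fun h => HomZero.congr_right e h⟩

lemma supp_ιD (hM : Bdd M) :
    D.gr.Supp Prod.fst (Set.Iic s) ((ιD D s).obj M) :=
  h.isHW.supp_ι (h.mem_serre_gr s) (isLowerSet_Iic s) (h.serre_iff (Set.Iic s)) hM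

lemma le_of_hom_std_ι (hM : Bdd M) {t : S} {a m : ℤ}
    (h0 : ¬ HomZero ((sg (D.gr.std (t, a)))⟦m⟧) ((ιD D s).obj M)) : t ≤ s :=
  h.isHW.le_of_hom_std h.refines_univ (bounded_map _ M hM) (h.supp_ιD hM) h0

/-- Purity of an object of the derived category of `A_{≤ s}` can be tested in that of `A`, since the
objects `Δ t⟨n⟩` and `∇ t⟨n⟩` with `t ≰ s` have no morphisms from or to it. -/
lemma isPureOfParity_ι_iff (hM : Bdd M) {dag : S → ZMod 2} {c : ZMod 2} :
    IsPureOfParity D.gr Prod.snd (fun l => dag l.1 + c) ((ιD D s).obj M) ↔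
      IsPureOfParity (h.grLE s) (fun l => l.1.2) (fun l => dag l.1.1 + c) M := by
  constructor
  · intro H
    exact ⟨fun l m hm => H.shriek l.1 m fun h' => hm ((h.homZero_std_ι hM l m).1 h'),
      fun l m hm => H.star l.1 m fun h' => hm ((h.homZero_ι_costd hM l m).1 h')⟩
  · intro H
    refine ⟨fun l m hm => ?_, fun l m hm => ?_⟩
    · have hl : l.1 ≤ s := h.le_of_hom_std_ι hM hm
      exact H.shriek ⟨l, hl⟩ m fun h' => hm ((h.homZero_std_ι hM ⟨l, hl⟩ m).2 h')
    · have hl : l.1 ≤ s :=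
        h.isHW.le_of_hom_costd h.refines_univ (bounded_map _ M hM) (h.supp_ιD hM) hm
      exact H.star ⟨l, hl⟩ m fun h' => hm ((h.homZero_ι_costd hM ⟨l, hl⟩ m).2 h')

end WeightData.IsGradedHighestWeight

/-! ### Pure objects and the quotient functor -/

namespace WeightData.IsGradedHighestWeight

variable {k : Type y} [Field k] {A : Type u} [Category.{v} A] [Abelian A] [Linear k A]
  [HasShift A ℤ] [∀ n : ℤ, (shiftFunctor A n).Additive]
  [∀ n : ℤ, Functor.Linear k (shiftFunctor A n)] {S : Type x} [PartialOrder S]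
  {D : WeightData A S} (h : D.IsGradedHighestWeight k) [HasDerivedCategory.{w} A] {s : S}
  [HasDerivedCategory.{w₁} (D.SubcatLE s)]

include h

section Twist

omit [HasDerivedCategory.{w₁} (D.SubcatLE s)]

lemma supp_tw {T : Set S} (hT : IsLowerSet T) (n m : ℤ) {M : DerivedCategory A} (hM : Bdd M)
    (hMT : D.gr.Supp Prod.fst T M) : D.gr.Supp Prod.fst T (tw n m M) := by
  refine (h.isHW.supp_isTri T).shift m _ (h.isHW.of_std ((h.isHW.supp_isTri T).comap (gradeD n)) hT
    (fun l hl => (h.isHW.supp_isTri T).of_iso (mapSgIso (shiftFunctor A n) _ ≪≫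
      (DerivedCategory.singleFunctor A 0).mapIso
        ((shiftFunctorAdd' A l.2 n (l.2 + n) rfl).app (D.std l.1)).symm).symm
      (WeightData.supp_sg (WeightData.filt_mono (fun t ht => hT ht hl)
        (h.isHW.filt_std (l.1, l.2 + n))))) hM hMT)

end Twist

section Extension

variable {E E' : DerivedCategory (D.SubcatLE s)} [HasDerivedCategory.{w₂} (D.QuotLE s)]

/-- The functor `Π_{< s}` on derived categories. -/
noncomputable abbrev quotD (D : WeightData A S) (s : S) [HasDerivedCategory.{w₁} (D.SubcatLE s)]
    [HasDerivedCategory.{w₂} (D.QuotLE s)] :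
    DerivedCategory (D.SubcatLE s) ⥤ DerivedCategory (D.QuotLE s) :=
  (serreQuotientFunctor (D.ltInLE s)).mapDerivedCategory

/-- The weights `(s, n)`, which are maximal in `A_{≤ s}`. -/
abbrev topLE (s : S) (n : ℤ) : {l : S × ℤ // l.1 ∈ Set.Iic s} := ⟨(s, n), le_refl s⟩

/-- The two incarnations of `Δ s` as an object of `A_{≤ s}`. -/
noncomputable def stdTopIso (s : S) [HasDerivedCategory.{w₁} (D.SubcatLE s)] :
    (sg ((h.grLE s).std (topLE s 0)))⟦(0 : ℤ)⟧ ≅ sg ((h.restrictLE s).std ⟨s, le_refl s⟩) :=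
  (shiftFunctorZero _ ℤ).app _ ≪≫ (DerivedCategory.singleFunctor _ 0).mapIso
    ((D.serre (Set.Iic s)).fullyFaithfulι.preimageIso
      (X := (h.grLE s).std (topLE s 0)) (Y := (h.restrictLE s).std ⟨s, le_refl s⟩)
      ((shiftFunctorZero A ℤ).app (D.std s)))

omit h [∀ n : ℤ, (shiftFunctor A n).Additive] [HasDerivedCategory.{w} A]
  [∀ n : ℤ, Functor.Linear k (shiftFunctor A n)] [Linear k A] in
lemma not_lt_LE (s : S) (l : {l : S × ℤ // l.1 ∈ Set.Iic s}) : ¬ s < l.1.1 := not_lt_of_ge l.2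

/-- The morphisms from the standard objects of weight `s` to an object `E` with the same image as
`Δ s` in the quotient. -/
lemma homZero_std_of_quotient_iso (hE : Bdd E)
    (e : (quotD D s).obj E ≅ (quotD D s).obj (sg ((h.restrictLE s).std ⟨s, le_refl s⟩))) (n m : ℤ) :
    ¬ HomZero ((sg ((h.grLE s).std (topLE s n)))⟦m⟧) E ↔ n = 0 ∧ m = 0 := by
  have hb := fun {N : DerivedCategory (D.SubcatLE s)} (hN : Bdd N) (m : ℤ) =>
    (h.isHW_LE s).bijHom_quotient (h.ltInLE_iff s) (h.refines_LE s) (not_lt_LE s)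
      (l := topLE s n) rfl hN m
  have h0 : HomZero ((sg ((h.grLE s).std (topLE s n)))⟦m⟧) E ↔
      HomZero ((sg ((h.grLE s).std (topLE s n)))⟦m⟧)
        ((sg ((h.grLE s).std (topLE s 0)))⟦(0 : ℤ)⟧) := by
    rw [← (hb hE m).homZero_iff, ← (hb (bdd_isTri.shift 0 _ (bdd_sg _)) m).homZero_iff]
    let e' := e ≪≫ (quotD D s).mapIso (h.stdTopIso s).symm
    exact ⟨fun h => HomZero.congr_right e' h, fun h => HomZero.congr_right e'.symm h⟩
  rw [h0]
  constructor
  · intro hne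
    by_contra hcon
    refine hne ((h.isHW_LE s).hom_std_std_shift (h.refines_LE s) (lt_irrefl s) ?_)
    by_contra hcon'
    push Not at hcon'
    exact hcon ⟨congrArg (fun l => l.1.2) hcon'.1, hcon'.2⟩
  · rintro ⟨rfl, rfl⟩ h1
    have h2 := (homZero_shift_iff (0 : ℤ) (add_zero 0)).1 h1
    have h3 := homZero_sg_iff.1 (homZero_shift_zero_iff.1 h2) (𝟙 _)
    have := (h.isHW_LE s).simple (topLE s 0)
    have := (h.isHW_LE s).epi_π (topLE s 0)
    refine Simple.not_isZero ((h.grLE s).L (topLE s 0))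
      (IsZero.of_epi_eq_zero ((h.grLE s).π (topLE s 0)) ?_)
    rw [← Category.id_comp ((h.grLE s).π (topLE s 0)), h3, zero_comp]

/-- A pure indecomposable object of `A_{≤ s}` with a nonzero morphism from `Δ s` has the same image
as `Δ s` in the quotient. -/
lemma quotient_iso_of_pure (hE : Bdd E) (hEi : TrivialIdempotents E)
    (hE₁ : (h.grLE s).StarPure (fun l => l.1.2) E)
    (hE₂ : (h.grLE s).ShriekPure (fun l => l.1.2) E)
    (h0 : ¬ HomZero ((sg ((h.grLE s).std (topLE s 0)))⟦(0 : ℤ)⟧) E) :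
    Nonempty ((quotD D s).obj E ≅ (quotD D s).obj (sg ((h.restrictLE s).std ⟨s, le_refl s⟩))) := by
  have H := h.isHW_LE s
  have R := h.refines_LE s
  obtain ⟨⟨⟨t, n⟩, hl⟩, hsupp, a, ha, huniv⟩ :=
    H.exists_leading R hE (fun hz => h0 (.of_isZero_right hz)) hEi hE₁ hE₂
  obtain rfl : t = s := le_antisymm hl (H.le_of_hom_std R hE hsupp h0)
  obtain ⟨b, hb⟩ : ∃ b : (sg ((h.grLE t).std (topLE t 0)))⟦(0 : ℤ)⟧ ⟶ E, b ≠ 0 := by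
    simpa [HomZero] using h0
  obtain rfl : n = 0 := by
    by_contra hn
    obtain ⟨u, rfl⟩ := huniv (topLE t 0) 0 rfl b
    rw [H.hom_std_std_shift R (lt_irrefl t) (Or.inr (Ne.symm hn)) u, zero_comp] at hb
    exact hb rfl
  obtain ⟨C, g, d, T⟩ := Dist.exists_cone a
  have hC : IsZero ((quotD D t).obj C) := H.isZero_quotient (h.ltInLE_iff t)
    (bdd_isTri.third T (bdd_isTri.shift _ _ (bdd_sg _)) hE)
    (H.supp_cone R hE hsupp T ha huniv)
  have : IsIso ((quotD D t).map a) := (T.map (quotD D t)).isZero₃_iff.1 hC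
  exact ⟨(asIso ((quotD D t).map a)).symm ≪≫ (quotD D t).mapIso (h.stdTopIso t)⟩

end Extension

end WeightData.IsGradedHighestWeight

/-! ### Classification of the indecomposable parity objects -/

namespace WeightData.IsGradedHighestWeight

variable {k : Type y} [Field k] {A : Type u} [Category.{v} A] [Abelian A] [Linear k A]
  [HasShift A ℤ] [∀ n : ℤ, (shiftFunctor A n).Additive]
  {S : Type x} [PartialOrder S]
  {D : WeightData A S} (h : D.IsGradedHighestWeight k) {dag : S → ZMod 2}

/-- The description of the indecomposable parity objects with the image of `Δ s` in the quotient,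
in terms of the derived category of `A_{≤ s}`. -/
lemma isParityExtension_iff {s : S} [HasDerivedCategory.{w₁} (D.SubcatLE s)]
    [HasDerivedCategory.{w₂} (D.QuotLE s)] {E : DerivedCategory.Bounded (D.SubcatLE s)} :
    h.IsParityExtension dag s E ↔ (¬ IsZero E.obj ∧ TrivialIdempotents E.obj) ∧
      (∃ c, IsPureOfParity (h.grLE s) (fun l => l.1.2) (fun l => dag l.1.1 + c) E.obj) ∧
      Nonempty ((quotD D s).obj E.obj ≅
        (quotD D s).obj (sg ((h.restrictLE s).std ⟨s, le_refl s⟩))) := by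
  have hiso : Nonempty ((D.piLT s).obj E ≅
      (D.piLT s).obj (single ((h.restrictLE s).std ⟨s, le_refl s⟩))) ↔
      Nonempty ((quotD D s).obj E.obj ≅
        (quotD D s).obj (sg ((h.restrictLE s).std ⟨s, le_refl s⟩))) :=
    ⟨fun ⟨e⟩ => ⟨(ObjectProperty.ι _).mapIso e⟩,
      fun ⟨e⟩ => ⟨(ObjectProperty.fullyFaithfulι _).preimageIso e⟩⟩
  unfold IsParityExtension
  rw [hiso, ← indecomposable_bounded_iff]
  refine and_congr_right fun hE => and_congr_left fun _ => ⟨fun hp => ?_, fun ⟨c, hc⟩ => ?_⟩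
  · obtain ⟨c, hc⟩ := exists_isPureOfParity hE hp
    exact ⟨c, h.isPureOfParity_restrictLE.1 hc⟩
  · exact isParity_of_isPureOfParity (h.isPureOfParity_restrictLE.2 hc)

variable [HasDerivedCategory.{w} A]

/-- Isomorphisms between `M` and `ι_{≤ s}(E)⟨n⟩[n]` can be looked for in the unbounded derived
category. -/
lemma nonempty_iso_bishift_ι_iff {s : S} [HasDerivedCategory.{w₁} (D.SubcatLE s)]
    {E : DerivedCategory.Bounded (D.SubcatLE s)} {n : ℤ} {M : DerivedCategory.Bounded A} :
    Nonempty (M ≅ bishift ((D.iotaLE s).obj E) n n) ↔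
      Nonempty (M.obj ≅ tw n n ((ιD D s).obj E.obj)) :=
  ⟨fun ⟨e⟩ => ⟨(ObjectProperty.ι _).mapIso e ≪≫ bishiftObjIso _ n n⟩,
    fun ⟨e⟩ => ⟨(ObjectProperty.fullyFaithfulι _).preimageIso
      (e ≪≫ (bishiftObjIso ((D.iotaLE s).obj E) n n).symm)⟩⟩

variable [∀ n : ℤ, Functor.Linear k (shiftFunctor A n)]

include h

lemma nonempty_iso {s : S} [HasDerivedCategory.{w₁} (D.SubcatLE s)]
    [HasDerivedCategory.{w₂} (D.QuotLE s)] {E E' : DerivedCategory.Bounded (D.SubcatLE s)}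
    (hE : h.IsParityExtension dag s E) (hE' : h.IsParityExtension dag s E') :
    Nonempty (E ≅ E') := by
  obtain ⟨⟨-, hi⟩, ⟨c, hc⟩, ⟨e⟩⟩ := h.isParityExtension_iff.1 hE
  obtain ⟨⟨-, hi'⟩, ⟨c', hc'⟩, ⟨e'⟩⟩ := h.isParityExtension_iff.1 hE'
  obtain ⟨a, ha⟩ : ∃ a : (sg ((h.grLE s).std (topLE s 0)))⟦(0 : ℤ)⟧ ⟶ E.obj, a ≠ 0 := by
    simpa [HomZero] using (h.homZero_std_of_quotient_iso E.property e 0 0).2 ⟨rfl, rfl⟩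
  obtain ⟨a', ha'⟩ : ∃ a : (sg ((h.grLE s).std (topLE s 0)))⟦(0 : ℤ)⟧ ⟶ E'.obj, a ≠ 0 := by
    simpa [HomZero] using (h.homZero_std_of_quotient_iso E'.property e' 0 0).2 ⟨rfl, rfl⟩
  have hsupp : ∀ M : DerivedCategory (D.SubcatLE s),
      (h.grLE s).Supp (fun l => l.1.1) (Set.Iic s) M :=
    fun M j => WeightData.filt_mono (fun t ht => ht) (filt_restrict _ subset_rfl
      (fun Y hY => (h.serre_iff _ Y).2 hY) ((h.serre_iff _ _).1 (coh j M).property))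
  obtain ⟨i⟩ := (h.isHW_LE s).nonempty_iso_of_pure (h.refines_LE s) E.property E'.property hi hi'
    hc.starPure hc.shriekPure hc'.starPure hc'.shriekPure (l := topLE s 0) (hsupp _) (hsupp _)
    a ha a' ha'
  exact ⟨(ObjectProperty.fullyFaithfulι _).preimageIso i⟩

lemma indecomposable_isParity_bishift {s : S} [HasDerivedCategory.{w₁} (D.SubcatLE s)]
    [HasDerivedCategory.{w₂} (D.QuotLE s)] {E : DerivedCategory.Bounded (D.SubcatLE s)} (n : ℤ)
    (hE : h.IsParityExtension dag s E) :
    Indecomposable (bishift ((D.iotaLE s).obj E) n n) ∧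
      D.IsParity dag (bishift ((D.iotaLE s).obj E) n n) := by
  obtain ⟨⟨h0, hi⟩, ⟨c, hc⟩, -⟩ := h.isParityExtension_iff.1 hE
  have hb := h.bijHom_ιD E.property E.property
  let i := bishiftObjIso ((D.iotaLE s).obj E) n n
  constructor
  · refine indecomposable_bounded_iff.2 ⟨fun hz => h0 ?_, .of_iso i.symm ?_⟩
    · have h1 : HomZero (tw n n ((ιD D s).obj E.obj)) (tw n n ((ιD D s).obj E.obj)) :=
        .of_isZero_left (hz.of_iso i.symm)
      exact (IsZero.iff_id_eq_zero _).2 (hb.homZero_iff.1 ((homZero_tw_iff n n).1 h1) _)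
    · exact (bijHom_of_fullyFaithful (shiftFunctor _ n) _ _).trivialIdempotents_iff.2
        ((bijHom_of_fullyFaithful (gradeD n) _ _).trivialIdempotents_iff.2
          (hb.trivialIdempotents_iff.2 hi))
  · exact isParity_of_isPureOfParity (IsPureOfParity.of_iso i.symm
      (IsPureOfParity.tw rfl ((h.isPureOfParity_ι_iff E.property).2 hc)))

/-- If `(s, n)` is the leading index of `M`, then `M⟨-n⟩[-n]` comes from `A_{≤ s}`, and it has the
same image as `Δ s` in the quotient. -/
lemma exists_iso_bishift [∀ s, HasDerivedCategory.{w₁} (D.SubcatLE s)]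
    [∀ s, HasDerivedCategory.{w₂} (D.QuotLE s)] {M : DerivedCategory.Bounded A}
    (hM : Indecomposable M) (hMp : D.IsParity dag M) :
    ∃ (s : S) (E : DerivedCategory.Bounded (D.SubcatLE s)) (n : ℤ),
      h.IsParityExtension dag s E ∧ Nonempty (M ≅ bishift ((D.iotaLE s).obj E) n n) := by
  obtain ⟨c, hc⟩ := exists_isPureOfParity hM hMp
  obtain ⟨h0, hi⟩ := indecomposable_bounded_iff.1 hM
  have H := h.isHW
  have R := h.refines_univ
  obtain ⟨⟨s, n⟩, hsupp, a, ha, -⟩ := H.exists_leading R M.property h0 hi hc.starPure hc.shriekPure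
  -- `M = N⟨n⟩[n]`, where `N` comes from `A_{≤ s}`
  let N : DerivedCategory A := tw (-n) (-n) M.obj
  have hN : Bdd N := bdd_isTri.shift _ _ (bounded_map (shiftFunctor A (-n)) M.obj M.property)
  obtain ⟨E, hE, ⟨e⟩⟩ := H.exists_ι_iso (h.mem_serre_gr s) (isLowerSet_Iic s)
    (h.serre_iff (Set.Iic s)) R (h.refines_LE s) hN
    (h.supp_tw (isLowerSet_Iic s) (-n) (-n) M.property hsupp)
  have hEc : IsPureOfParity (h.grLE s) (fun l => l.1.2) (fun l => dag l.1.1 + (c + (-n : ℤ))) E :=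
    (h.isPureOfParity_ι_iff hE).1 (.of_iso e.symm (IsPureOfParity.tw rfl hc))
  have hEi : TrivialIdempotents E := (h.bijHom_ιD hE hE).trivialIdempotents_iff.1 (.of_iso e.symm
    ((bijHom_of_fullyFaithful (shiftFunctor _ (-n)) _ _).trivialIdempotents_iff.2
      ((bijHom_of_fullyFaithful (gradeD (-n)) _ _).trivialIdempotents_iff.2 hi)))
  have hE0 : ¬ HomZero ((sg ((h.grLE s).std (topLE s 0)))⟦(0 : ℤ)⟧) E := fun hz => by
    have h1 := HomZero.congr_right e ((h.homZero_std_ι hE (topLE s 0) 0).2 hz)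
    exact ha ((homZero_std_tw_iff (a := n) (b := n) s (by lia) (by lia)).1 h1 a)
  refine ⟨s, ⟨E, hE⟩, n, h.isParityExtension_iff.2
    ⟨⟨fun hz => hE0 (.of_isZero_right hz), hEi⟩, ⟨_, hEc⟩,
      h.quotient_iso_of_pure hE hEi hEc.starPure hEc.shriekPure hE0⟩,
    nonempty_iso_bishift_ι_iff.2 ⟨(twTwIso (-n) n (by lia) M.obj).symm ≪≫
      (shiftFunctor _ n).mapIso ((gradeD n).mapIso e.symm)⟩⟩

/-- The integer `n` is determined by `ι_{≤ s}(E)⟨n⟩[n]` and `s`. -/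
lemma homZero_std_bishift {s : S} [HasDerivedCategory.{w₁} (D.SubcatLE s)]
    [HasDerivedCategory.{w₂} (D.QuotLE s)] {E : DerivedCategory.Bounded (D.SubcatLE s)}
    (hE : h.IsParityExtension dag s E) (n m : ℤ) :
    ¬ HomZero ((sg (D.gr.std (s, m)))⟦m⟧) (tw n n ((ιD D s).obj E.obj)) ↔ m = n := by
  obtain ⟨-, -, ⟨e⟩⟩ := h.isParityExtension_iff.1 hE
  rw [homZero_std_tw_iff (a := m - n) (b := m - n) s (by lia) (by lia),
    h.homZero_std_ι E.property (topLE s (m - n)), h.homZero_std_of_quotient_iso E.property e]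
  lia

/-- The index `s` is the largest weight of a standard object with a nonzero morphism to
`ι_{≤ s}(E)⟨n⟩[n]`, up to shifts. -/
lemma le_of_iso [∀ s, HasDerivedCategory.{w₁} (D.SubcatLE s)]
    [∀ s, HasDerivedCategory.{w₂} (D.QuotLE s)] {s s' : S}
    {E : DerivedCategory.Bounded (D.SubcatLE s)} {E' : DerivedCategory.Bounded (D.SubcatLE s')}
    {n n' : ℤ} (hE : h.IsParityExtension dag s E)
    (e : tw n n ((ιD D s).obj E.obj) ≅ tw n' n' ((ιD D s').obj E'.obj)) : s ≤ s' := by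
  have h1 := (h.homZero_std_bishift hE n n).2 rfl
  refine h.le_of_hom_std_ι E'.property (a := n - n') (m := n - n') fun hz => h1 ?_
  exact HomZero.congr_right e.symm ((homZero_std_tw_iff s (by lia) (by lia)).2 hz)

lemma eq_of_iso_bishift [∀ s, HasDerivedCategory.{w₁} (D.SubcatLE s)]
    [∀ s, HasDerivedCategory.{w₂} (D.QuotLE s)] {s s' : S}
    {E : DerivedCategory.Bounded (D.SubcatLE s)} {E' : DerivedCategory.Bounded (D.SubcatLE s')}
    {n n' : ℤ} (hE : h.IsParityExtension dag s E) (hE' : h.IsParityExtension dag s' E')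
    (e : Nonempty (bishift ((D.iotaLE s).obj E) n n ≅ bishift ((D.iotaLE s').obj E') n' n')) :
    s = s' ∧ n = n' := by
  obtain ⟨e⟩ := nonempty_iso_bishift_ι_iff.1 e
  replace e := (bishiftObjIso _ n n).symm ≪≫ e
  obtain rfl := le_antisymm (h.le_of_iso hE e) (h.le_of_iso hE' e.symm)
  refine ⟨rfl, (h.homZero_std_bishift hE' n' n).1 fun hz => ?_⟩
  exact (h.homZero_std_bishift hE n n).2 rfl (HomZero.congr_right e.symm hz)

end WeightData.IsGradedHighestWeight

end GradedHW

open GradedHW in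
theorem mainTheorem8 {k : Type y} [Field k] {A : Type u} [Category.{v} A] [Abelian A] [Linear k A]
    [HasShift A ℤ] [∀ n : ℤ, (shiftFunctor A n).Additive]
    [∀ n : ℤ, Functor.Linear k (shiftFunctor A n)]
    {S : Type x} [PartialOrder S] (D : WeightData A S) (h : D.IsGradedHighestWeight k)
    (dag : S → ZMod 2)
    [HasDerivedCategory.{w} A] [∀ s, HasDerivedCategory.{w₁} (D.SubcatLE s)]
    [∀ s, HasDerivedCategory.{w₂} (D.QuotLE s)] :
    (∀ (s : S) (E E' : DerivedCategory.Bounded (D.SubcatLE s)),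
      h.IsParityExtension dag s E → h.IsParityExtension dag s E' → Nonempty (E ≅ E')) ∧
    (∀ (s : S) (E : DerivedCategory.Bounded (D.SubcatLE s)) (n : ℤ),
      h.IsParityExtension dag s E →
        Indecomposable (bishift ((D.iotaLE s).obj E) n n) ∧
          D.IsParity dag (bishift ((D.iotaLE s).obj E) n n)) ∧
    (∀ M : DerivedCategory.Bounded A, Indecomposable M → D.IsParity dag M →
      ∃ (s : S) (E : DerivedCategory.Bounded (D.SubcatLE s)) (n : ℤ),
        h.IsParityExtension dag s E ∧ Nonempty (M ≅ bishift ((D.iotaLE s).obj E) n n)) ∧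
    (∀ (s s' : S) (E : DerivedCategory.Bounded (D.SubcatLE s))
      (E' : DerivedCategory.Bounded (D.SubcatLE s')) (n n' : ℤ),
      h.IsParityExtension dag s E → h.IsParityExtension dag s' E' →
      Nonempty (bishift ((D.iotaLE s).obj E) n n ≅ bishift ((D.iotaLE s').obj E') n' n') →
        s = s' ∧ n = n') :=
  ⟨fun _ _ _ hE hE' => h.nonempty_iso hE hE',
    fun _ _ n hE => h.indecomposable_isParity_bishift n hE,
    fun _ hM hMp => h.exists_iso_bishift hM hMp,
    fun _ _ _ _ _ _ hE hE' e => h.eq_of_iso_bishift hE hE' e⟩
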